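/- Let $p\in[\tfrac12,1]$ and $\varepsilon\in[0,1)$. Let $X_1,X_2,\dots$ be i.i.d. steps taking the values $0,+1,-1$ with probabilities $\varepsilon$, $(1-\varepsilon)p$, $(1-\varepsilon)(1-p)$. Put $S_0=0$ and $S_n=X_1+\dots+X_n$. Let $(C_z)_{z\in\mathbb Z}$ be i.i.d. and independent of the steps, with each $C_z$ equal to $B$ (black) or $W$ (white) with probability $\tfrac12$. The color record is $Y_n=C_{S_n}$, $n\ge 0$. Let $\mathbb N=\{1,2,\dots\}$ and $\Omega=\{B,W\}^{\mathbb N}$. A configuration $\eta\in\Omega$ is called bad if there is a $\delta>0$ such that for every $m\in\mathbb N$ there are $n\in\mathbb N$ with $n>m$ and $\zeta\in\Omega$ with $\zeta_k=\eta_k$ for $1\le k<m$ such that $$\bigl|\mathbb P(Y_0=B\mid Y_k=\eta_k,\ 1\le k<n)-\mathbb P(Y_0=B\mid Y_k=\zeta_k,\ 1\le k<n)\bigr|\ge\delta .$$ Otherwise $\eta$ is called good. Let $\mathcal B=\mathcal B(p,\varepsilon)\subseteq\Omega$ be the set of bad configurations. **Theorem 1.3.** (i) There is an open set $U\subseteq\mathbb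 R^2$ that contains the point $(1,0)$ and the segment $(p_*,1]\times\{0\}$, where $p_*=1/(1+5^5\,12^{-6})$, such that $\mathcal B(p,\varepsilon)=\varnothing$ for all $(p,\varepsilon)\in U$ with $p\in[\tfrac12,1]$ and $\varepsilon\in[0,1)$. Moreover, for all such $(p,\varepsilon)$ there is a version $\eta\mapsto V(B\mid\eta)$ of the conditional probability $\mathbb P(Y_0=B\mid (Y_k)_{k\ge1}=\eta)$ that is continuous on all of $\Omega$ (with the product topology). (ii) If $\varepsilon=0$ and $p\in(\tfrac12,\tfrac45)$, then $\mathcal B=\Omega$. (iii) If $\varepsilon=0$ and $p=\tfrac12$, then $\mathcal B\ne\varnothing$ and $\mathcal B\ne\Omega$. In particular, the configuration $B^\infty=BBB\cdots$ is bad, and the configuration $$BB\,WBB[WWBB]\,WBB[WWBB]^2\,WBB[WWBB]^3\cdots$$ is good, where $[w]^k$ denotes the word $w$ repeated $k$ times. -/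

import Mathlib

open MeasureTheory ProbabilityTheory

namespace RWRS

/-- Parameters of the walk: `p ∈ [1/2, 1]` and `ε ∈ [0, 1)`. -/
structure Params where
  p : ℝ
  ε : ℝ
  half_le_p : 1 / 2 ≤ p
  p_le_one : p ≤ 1
  zero_le_ε : 0 ≤ ε
  ε_lt_one : ε < 1

/-- The two colors; both `Bool` topology and `Bool` σ-algebra are the discrete ones. -/
abbrev Color : Type := Bool

abbrev black : Color := true

abbrev white : Color := false

/-- Law of one step: `0`, `+1`, `-1` with probabilities `ε`, `p (1 - ε)`, `(1 - p) (1 - ε)`. -/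
noncomputable def stepLaw (θ : Params) : Measure ℤ :=
  ENNReal.ofReal θ.ε • Measure.dirac 0
    + ENNReal.ofReal (θ.p * (1 - θ.ε)) • Measure.dirac 1
    + ENNReal.ofReal ((1 - θ.p) * (1 - θ.ε)) • Measure.dirac (-1)

instance (θ : Params) : IsProbabilityMeasure (stepLaw θ) := by
  have h1 := θ.half_le_p
  have h2 := θ.p_le_one
  have h3 := θ.zero_le_ε
  have h4 := θ.ε_lt_one
  have h5 : 0 ≤ θ.p * (1 - θ.ε) := mul_nonneg (by linarith) (by linarith)
  have h6 : 0 ≤ (1 - θ.p) * (1 - θ.ε) := mul_nonneg (by linarith) (by linarith)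
  constructor
  simp only [stepLaw, Measure.coe_add, Measure.coe_smul, Pi.add_apply, Pi.smul_apply,
    measure_univ, smul_eq_mul, mul_one]
  rw [← ENNReal.ofReal_add h3 h5, ← ENNReal.ofReal_add (add_nonneg h3 h5) h6]
  rw [show θ.ε + θ.p * (1 - θ.ε) + (1 - θ.p) * (1 - θ.ε) = 1 by ring]
  simp

/-- Law of the color of one site: black or white with probability `1/2` each. -/
noncomputable def colorLaw : Measure Color :=
  (PMF.uniformOfFintype Color).toMeasure

instance : IsProbabilityMeasure colorLaw := by
  unfold colorLaw
  infer_instance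

/-- The canonical sample space. For `ω = (x, c)`, the integer `x i` is the step from time `i` to
time `i + 1`, and `c z` is the color of the site `z`. -/
abbrev Sample : Type := (ℕ → ℤ) × (ℤ → Color)

/-- The joint law of steps and scenery: all steps and all site colors are independent. -/
noncomputable def law (θ : Params) : Measure Sample :=
  (Measure.infinitePi fun _ : ℕ => stepLaw θ).prod (Measure.infinitePi fun _ : ℤ => colorLaw)

/-- Position of the walk at time `n`. -/
def pos (ω : Sample) (n : ℕ) : ℤ := ∑ i ∈ Finset.range n, ω.1 i

/-- The color record: the color seen at time `n`. -/
def record (ω : Sample) (n : ℕ) : Color := ω.2 (pos ω n)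

/-- A configuration is a possible color record at the times `1, 2, 3, …`. -/
abbrev Config : Type := ℕ+ → Color

/-- The color record at the times `1, 2, 3, …`. -/
def future (ω : Sample) : Config := fun k => record ω k

/-- The event that the record agrees with `η` at the times `1, …, n - 1`. -/
def agreeEvent (η : Config) (n : ℕ+) : Set Sample :=
  {ω | ∀ k : ℕ+, k < n → record ω k = η k}

/-- The event that the color seen at time `0` is black. -/
def blackEvent : Set Sample := {ω | record ω 0 = black}

/-- The conditional probability of black at time `0`, given that the record agrees with `η` at
the times `1, …, n - 1`. -/
noncomputable def condBlack (θ : Params) (η : Config) (n : ℕ+) : ℝ :=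
  (cond (law θ) (agreeEvent η n)).real blackEvent

/-- Bad configurations. -/
def IsBad (θ : Params) (η : Config) : Prop :=
  ∃ δ : ℝ, 0 < δ ∧ ∀ m : ℕ+, ∃ n : ℕ+, ∃ ζ : Config,
    m < n ∧ (∀ k : ℕ+, k < m → ζ k = η k) ∧ δ ≤ |condBlack θ η n - condBlack θ ζ n|

/-- The set of bad configurations. -/
def badSet (θ : Params) : Set Config := {η | IsBad θ η}

/-- `V` is a version of the conditional probability of black at time `0`, given the record at
the times `1, 2, 3, …`. -/
def IsVersion (θ : Params) (V : Config → ℝ) : Prop :=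
  Measurable V ∧
    (fun ω => V (future ω)) =ᵐ[law θ]
      condExp (MeasurableSpace.comap future inferInstance) (law θ)
        (blackEvent.indicator fun _ => (1 : ℝ))

/-- The number `p_*`. -/
noncomputable def pStar : ℝ := 1 / (1 + 5 ^ 5 * ((12 : ℝ) ^ 6)⁻¹)

/-- The monochromatic record `BBB…`. -/
def allBlack : Config := fun _ => black

/-- The word `WBB[WWBB]^k`. -/
def block (k : ℕ) : List Color :=
  [white, black, black] ++ (List.replicate k [white, white, black, black]).flatten

/-- The word `BB WBB[WWBB] WBB[WWBB]^2 ⋯ WBB[WWBB]^L`. -/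
def zigzagPrefix (L : ℕ) : List Color :=
  [black, black] ++ ((List.range L).map fun j => block (j + 1)).flatten

/-- The infinite record `BB WBB[WWBB] WBB[WWBB]^2 WBB[WWBB]^3 ⋯`, read off from its prefixes: the
`L`-th prefix has more than `L` letters and is an initial word of all later ones. -/
def zigzag : Config := fun k => (zigzagPrefix k).getD ((k : ℕ) - 1) black

end RWRS

/-! Everything is reduced to finite sums: by `law_record`, the probability of a finite record is a
sum over step sequences of the path weight times `fit`. If the letters are consistent along the
path, `fit` is `2⁻¹` to the number of visited sites; otherwise it is zero.

Continuity. Let two independent walks read two records that agree before time `m`. At a common cut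
time `k < m` the sites before and after are disjoint for both walks. Exchanging the initial pieces
there preserves the product of probabilities and moves the condition "black at time 0" from one walk
to the other. Hence the two conditional probabilities differ by at most the conditional probability
that no common cut time occurs before `m` (`abs_sub_le_noCommonCut`). The number of non-cut times is
at most three times the number of steps other than `+1` (`card_not_isCut_le`), so the absence of
common cuts is expensive. Comparison with a straight start, which costs `(β/2)^k` with `β = p(1-ε)`,
yields geometric decay whenever `β > p_*` (`sum_noCommonCut_le`, `rate_lt_one`). The uniform limit
of the conditional probabilities is then a continuous version.

Everything bad for `ε = 0`, `1/2 < p < 4/5`. Letters that differ two time units apart force the walk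
to repeat its step. Any finite record can be continued by long legs of length about `Λ`, to and fro
through a scenery in which each site has one neighbor of each color. A path of length `l` has weight
`A^l r^(end point)` with `r = √(p/(1-p))`. Relative to the intended path, its mirror image loses a
factor of order `r^(-2Λ)`, and a path that misses a turn visits about `Λ` more sites and loses
`(r/2)^Λ`; `r < 2` means `p < 4/5`. The surviving paths reveal the scenery near the present
position, hence the path back to time 1 and the colors of both candidates for the site of time 0.
These colors differ, so the limit is `p` or `1-p`, and the mirrored scenery gives the other value
(`exists_continuation`).

The case `p = 1/2`. The same continuation gives the limit `1/2`, while the black record keeps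
conditional probability at least `3/4`, so it is bad. For the record `zigzag`, a path that misses
the first turn must miss all of the first `L` turns; it can be folded in `L` ways into distinct
paths of equal weight and at least equal `fit`, so such paths have share at most `1/L`. All other
paths see one black and one white neighbor of the site of time 1 and give exactly `1/2`. -/

namespace RWRS

open Finset

/-! ### Path sums and scenery probabilities. -/

/-- The possible values of one step. -/
def stepSet : Finset ℤ := {-1, 0, 1}

lemma mem_stepSet {d : ℤ} : d ∈ stepSet ↔ d = -1 ∨ d = 0 ∨ d = 1 := by
  simp [stepSet]

open scoped Classical in
/-- Step sequences of length `N`, continued by zero. -/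
noncomputable def paths (N : ℕ) : Finset (ℕ → ℤ) :=
  (Fintype.piFinset fun _ : Fin N => stepSet).image
    fun f i => if h : i < N then f ⟨i, h⟩ else 0

lemma mem_paths {N : ℕ} {s : ℕ → ℤ} :
    s ∈ paths N ↔ (∀ i < N, s i ∈ stepSet) ∧ ∀ i, N ≤ i → s i = 0 := by
  simp only [paths, mem_image, Fintype.mem_piFinset]
  constructor
  · rintro ⟨f, hf, rfl⟩
    refine ⟨fun i hi => by simp [hi, hf], fun i hi => by simp [Nat.not_lt.mpr hi]⟩
  · rintro ⟨h1, h2⟩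
    refine ⟨fun i => s i, fun i => h1 i i.2, ?_⟩
    funext i
    by_cases hi : i < N
    · simp [hi]
    · simp [hi, h2 i (Nat.not_lt.mp hi)]

lemma sum_paths_prod (N : ℕ) (h : ℤ → ℝ) :
    ∑ s ∈ paths N, ∏ i ∈ range N, h (s i) = (∑ d ∈ stepSet, h d) ^ N := by
  classical
  have key := prod_univ_sum (fun _ : Fin N => stepSet) (fun _ d => h d)
  rw [prod_const, card_univ, Fintype.card_fin] at key
  rw [key, paths, sum_image]
  · refine sum_congr rfl fun f _ => ?_
    rw [Finset.prod_range]
    simp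
  · intro f _ g _ hfg
    funext i
    simpa using congrFun hfg i

/-- Position after `n` steps. -/
def walk (s : ℕ → ℤ) (n : ℕ) : ℤ := ∑ i ∈ range n, s i

@[simp] lemma walk_zero (s : ℕ → ℤ) : walk s 0 = 0 := by simp [walk]

lemma walk_succ (s : ℕ → ℤ) (n : ℕ) : walk s (n + 1) = walk s n + s n := by
  simp [walk, sum_range_succ]

lemma walk_congr {s s' : ℕ → ℤ} {n : ℕ} (h : ∀ i < n, s i = s' i) : walk s n = walk s' n :=
  sum_congr rfl fun i hi => h i (mem_range.mp hi)

/-- Probability of one step. -/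
noncomputable def stepProb (θ : Params) (d : ℤ) : ℝ := (stepLaw θ).real {d}

lemma stepProb_eq (θ : Params) (d : ℤ) : stepProb θ d =
    (if d = 0 then θ.ε else 0) + (if d = 1 then θ.p * (1 - θ.ε) else 0)
      + (if d = -1 then (1 - θ.p) * (1 - θ.ε) else 0) := by
  have h1 := θ.half_le_p
  have h2 := θ.p_le_one
  have h3 := θ.zero_le_ε
  have h4 := θ.ε_lt_one
  have h5 : 0 ≤ θ.p * (1 - θ.ε) := mul_nonneg (by linarith) (by linarith)
  have h6 : 0 ≤ (1 - θ.p) * (1 - θ.ε) := mul_nonneg (by linarith) (by linarith)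
  simp only [stepProb, Measure.real, stepLaw, Measure.coe_add, Measure.coe_smul, Pi.add_apply,
    Pi.smul_apply, smul_eq_mul, Measure.dirac_apply, Set.indicator_apply, Set.mem_singleton_iff,
    Pi.one_apply]
  by_cases e0 : d = 0
  · subst e0; simp [ENNReal.toReal_ofReal, h3]
  by_cases e1 : d = 1
  · subst e1; simp only [zero_ne_one, if_false, mul_zero, zero_add, if_true, mul_one]
    simp [ENNReal.toReal_ofReal h5]
  by_cases e2 : d = -1
  · subst e2; simp only [show ((0:ℤ) = -1) = False by simp, show ((1:ℤ) = -1) = False by simp,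
      if_false, mul_zero, zero_add, if_true, mul_one, add_zero]
    simp [ENNReal.toReal_ofReal h6]
  · simp [e0, e1, e2, Ne.symm e0, Ne.symm e1, Ne.symm e2]

lemma stepProb_nonneg (θ : Params) (d : ℤ) : 0 ≤ stepProb θ d := measureReal_nonneg

lemma sum_stepProb (θ : Params) : ∑ d ∈ stepSet, stepProb θ d = 1 := by
  simp [stepSet, stepProb_eq]; ring

/-- Probability of the first `N` steps. -/
noncomputable def weight (θ : Params) (N : ℕ) (s : ℕ → ℤ) : ℝ := ∏ i ∈ range N, stepProb θ (s i)

lemma weight_nonneg (θ : Params) (N : ℕ) (s : ℕ → ℤ) : 0 ≤ weight θ N s :=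
  prod_nonneg fun _ _ => stepProb_nonneg _ _

/-- Law of the scenery. -/
noncomputable def sceneryLaw : Measure (ℤ → Color) := Measure.infinitePi fun _ : ℤ => colorLaw

instance : IsProbabilityMeasure sceneryLaw := by unfold sceneryLaw; infer_instance

/-- Probability that the scenery shows the colors `a j` at the sites `x j` for `j ∈ I`. -/
noncomputable def fit (x : ℕ → ℤ) (a : ℕ → Color) (I : Finset ℕ) : ℝ :=
  sceneryLaw.real {c | ∀ j ∈ I, c (x j) = a j}

lemma fit_nonneg (x : ℕ → ℤ) (a : ℕ → Color) (I : Finset ℕ) : 0 ≤ fit x a I := measureReal_nonneg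

lemma fit_anti (x : ℕ → ℤ) (a : ℕ → Color) {I J : Finset ℕ} (h : I ⊆ J) :
    fit x a J ≤ fit x a I :=
  measureReal_mono fun _ hc j hj => hc j (h hj)

lemma colorLaw_singleton (b : Color) : colorLaw {b} = 2⁻¹ := by
  rw [colorLaw, PMF.toMeasure_apply_singleton _ _ (measurableSet_singleton b)]
  simp

lemma sceneryLaw_eqOn (F : Finset ℤ) (c₀ : ℤ → Color) :
    sceneryLaw.real {c | ∀ z ∈ F, c z = c₀ z} = 2⁻¹ ^ #F := by
  have : {c : ℤ → Color | ∀ z ∈ F, c z = c₀ z} = Set.pi F fun z => {c₀ z} := by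
    ext c; simp [Set.mem_pi]
  rw [this, Measure.real, sceneryLaw, Measure.infinitePi_pi _ fun z _ => measurableSet_singleton _]
  simp [colorLaw_singleton]

/-- Consistent letters prescribe one fair color at each visited site, so only the number of distinct
sites counts. -/
lemma fit_eq_pow {x : ℕ → ℤ} {a : ℕ → Color} {I : Finset ℕ} {c₀ : ℤ → Color}
    (h : ∀ j ∈ I, c₀ (x j) = a j) : fit x a I = 2⁻¹ ^ #(I.image x) := by
  rw [← sceneryLaw_eqOn _ c₀, fit]
  congr 1
  ext c
  simp only [Set.mem_ofPred_eq, forall_mem_image]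
  exact forall₂_congr fun j hj => by rw [h j hj]

lemma exists_of_fit_ne_zero {x : ℕ → ℤ} {a : ℕ → Color} {I : Finset ℕ} (h : fit x a I ≠ 0) :
    ∃ c : ℤ → Color, ∀ j ∈ I, c (x j) = a j := by
  by_contra! hc
  refine h ?_
  have : {c : ℤ → Color | ∀ j ∈ I, c (x j) = a j} = ∅ := by
    ext c; simpa using hc c
  simp [fit, this]

lemma fit_congr {x y : ℕ → ℤ} {a b : ℕ → Color} {I : Finset ℕ} (h : ∀ j ∈ I, x j = y j)
    (h' : ∀ j ∈ I, a j = b j) : fit x a I = fit y b I := by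
  rw [fit, fit]
  congr 1
  ext c
  exact forall₂_congr fun j hj => by rw [h j hj, h' j hj]

lemma fit_shift (x : ℕ → ℤ) (a : ℕ → Color) (k l : ℕ) :
    fit x a (Icc (k + 1) (k + l)) = fit (fun j => x (k + j)) (fun j => a (k + j)) (Icc 1 l) := by
  rw [fit, fit]
  congr 1
  ext c
  simp only [Set.mem_ofPred_eq, mem_Icc]
  constructor
  · intro h j hj
    exact h _ (by omega)
  · intro h j hj
    have := h (j - k) (by omega)
    rwa [show k + (j - k) = j by omega] at this

/-- The colors are i.i.d., so only the coincidences among the sites matter. This is used for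
translations. -/
lemma fit_comp {f : ℤ → ℤ} (hf : Function.Injective f) (x : ℕ → ℤ) (a : ℕ → Color)
    (I : Finset ℕ) : fit (fun j => f (x j)) a I = fit x a I := by
  by_cases h : ∃ c : ℤ → Color, ∀ j ∈ I, c (x j) = a j
  · obtain ⟨c, hc⟩ := h
    rw [fit_eq_pow hc, fit_eq_pow (c₀ := c ∘ Function.invFun f)]
    · rw [show (fun j => f (x j)) = f ∘ x from rfl, ← image_image, card_image_of_injective _ hf]
    · intro j hj
      simp [Function.leftInverse_invFun hf (x j), hc j hj]
  · have h1 : fit x a I = 0 := by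
      by_contra h0; exact h (exists_of_fit_ne_zero h0)
    have h2 : fit (fun j => f (x j)) a I = 0 := by
      by_contra h0
      obtain ⟨c, hc⟩ := exists_of_fit_ne_zero h0
      exact h ⟨c ∘ f, hc⟩
    rw [h1, h2]

/-- Independence of the scenery on disjoint sets of sites. -/
lemma fit_union {x : ℕ → ℤ} {a : ℕ → Color} {I J : Finset ℕ}
    (h : ∀ i ∈ I, ∀ j ∈ J, x i ≠ x j) : fit x a (I ∪ J) = fit x a I * fit x a J := by
  classical
  by_cases h1 : ∃ c : ℤ → Color, ∀ j ∈ I, c (x j) = a j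
  swap
  · have h1' : fit x a I = 0 := by
      by_contra h0; exact h1 (exists_of_fit_ne_zero h0)
    rw [h1', zero_mul]
    exact le_antisymm (h1' ▸ fit_anti x a subset_union_left) (fit_nonneg ..)
  by_cases h2 : ∃ c : ℤ → Color, ∀ j ∈ J, c (x j) = a j
  swap
  · have h2' : fit x a J = 0 := by
      by_contra h0; exact h2 (exists_of_fit_ne_zero h0)
    rw [h2', mul_zero]
    exact le_antisymm (h2' ▸ fit_anti x a subset_union_right) (fit_nonneg ..)
  obtain ⟨c, hc⟩ := h1
  obtain ⟨c', hc'⟩ := h2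
  rw [fit_eq_pow hc, fit_eq_pow hc',
    fit_eq_pow (c₀ := fun z => if z ∈ I.image x then c z else c' z), image_union,
    card_union_of_disjoint, pow_add]
  · rw [disjoint_left]
    simp only [mem_image, not_exists, not_and]
    rintro _ ⟨i, hi, rfl⟩ j hj e
    exact h i hi j hj e.symm
  · intro j hj
    by_cases hj' : x j ∈ I.image x
    · obtain ⟨i, hi, e⟩ := mem_image.mp hj'
      rcases mem_union.mp hj with hj | hj
      · simp only [hj', if_true]; exact hc j hj
      · exact absurd e (h i hi j hj)
    · rcases mem_union.mp hj with hj | hj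
      · exact absurd (mem_image_of_mem x hj) hj'
      · simp only [hj', if_false]; exact hc' j hj

/-- Probability that the record shows the colors `a j` at the times `j ∈ I`, where `I` is a set of
times up to `N`. -/
noncomputable def recordProb (θ : Params) (N : ℕ) (a : ℕ → Color) (I : Finset ℕ) : ℝ :=
  ∑ s ∈ paths N, weight θ N s * fit (walk s) a I

instance (θ : Params) : IsProbabilityMeasure (law θ) := by unfold law; infer_instance

lemma ae_steps_mem (θ : Params) : ∀ᵐ ω ∂(law θ), ∀ i, ω.1 i ∈ stepSet := by
  rw [ae_all_iff]
  intro i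
  have h0 : ∀ᵐ d ∂(stepLaw θ), d ∈ stepSet := by
    rw [ae_iff]
    simp only [stepLaw, Measure.coe_add, Measure.coe_smul, Pi.add_apply, Pi.smul_apply]
    simp [stepSet]
  have h1 := (measurePreserving_eval_infinitePi (fun _ : ℕ => stepLaw θ)
    i).quasiMeasurePreserving.ae h0
  exact Measure.quasiMeasurePreserving_fst.ae h1

/-- Almost surely all steps lie in `stepSet`; up to a null set the event is then a finite disjoint
union of products, one for each choice of the first `N` steps. -/
lemma law_record (θ : Params) {N : ℕ} (a : ℕ → Color) {I : Finset ℕ} (hI : I ⊆ range (N + 1)) :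
    (law θ).real {ω | ∀ j ∈ I, record ω j = a j} = recordProb θ N a I := by
  set A : (ℕ → ℤ) → Set (ℕ → ℤ) := fun s => Set.pi (range N : Finset ℕ) fun i => {s i} with hA
  set F : (ℕ → ℤ) → Set (ℤ → Color) := fun s => {c | ∀ j ∈ I, c (walk s j) = a j} with hF
  have hwalk : ∀ s x : ℕ → ℤ, x ∈ A s → ∀ j ∈ I, walk x j = walk s j := by
    intro s x hx j hj
    refine walk_congr fun i hi => ?_
    have h1 := mem_range.mp (hI hj)
    exact hx i (by simp; omega)
  have hFm : ∀ s, MeasurableSet (F s) := by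
    intro s
    have : F s = ⋂ j ∈ I, (fun c : ℤ → Color => c (walk s j)) ⁻¹' {a j} := by
      ext c; simp [hF]
    rw [this]
    exact I.measurableSet_biInter fun j _ => measurable_pi_apply _ (measurableSet_singleton _)
  have hAm : ∀ s, MeasurableSet (A s) := fun s =>
    MeasurableSet.pi (Finset.countable_toSet _) fun i _ => measurableSet_singleton _
  have hae : {ω : Sample | ∀ j ∈ I, record ω j = a j}
      =ᵐ[law θ] ⋃ s ∈ paths N, A s ×ˢ F s := by
    filter_upwards [ae_steps_mem θ] with ω hω
    apply propext
    change (∀ j ∈ I, ω.2 (walk ω.1 j) = a j) ↔ ω ∈ ⋃ s ∈ paths N, A s ×ˢ F s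
    simp only [Set.mem_iUnion, Set.mem_prod, exists_prop]
    constructor
    · intro h
      refine ⟨fun i => if i < N then ω.1 i else 0, ?_, ?_, ?_⟩
      · rw [mem_paths]
        exact ⟨fun i hi => by simpa [hi] using hω i, fun i hi => by simp [Nat.not_lt.mpr hi]⟩
      · intro i hi
        have : i < N := by simpa using hi
        simp [this]
      · intro j hj
        have h1 := mem_range.mp (hI hj)
        rw [← h j hj, walk_congr (s := fun i => if i < N then ω.1 i else 0) (s' := ω.1)]
        intro i hi
        simp [show i < N by omega]
    · rintro ⟨s, -, h1, h2⟩ j hj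
      rw [hwalk s _ h1 j hj]
      exact h2 j hj
  rw [measureReal_congr hae, measureReal_biUnion_finset (h := fun _ _ => measure_ne_top _ _),
    recordProb]
  · refine sum_congr rfl fun s _ => ?_
    have h1 : (law θ).real (A s ×ˢ F s) = (Measure.infinitePi fun _ : ℕ => stepLaw θ).real (A s) *
        sceneryLaw.real (F s) := by
      rw [law]
      exact measureReal_prod_prod _ _
    rw [h1, Measure.real, Measure.infinitePi_pi _ fun z _ => measurableSet_singleton _,
      ENNReal.toReal_prod]
    rfl
  · intro s hs s' hs' hne
    refine Set.disjoint_left.mpr fun ω h h' => hne ?_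
    funext i
    by_cases hi : i < N
    · have h1 : ω.1 i = s i := h.1 i (by simpa using hi)
      have h2 : ω.1 i = s' i := h'.1 i (by simpa using hi)
      rw [← h1, h2]
    · rw [(mem_paths.mp hs).2 i (by omega), (mem_paths.mp hs').2 i (by omega)]
  · intro s _
    exact (hAm s).prod (hFm s)

/-- The configuration `η` as a sequence of letters; the letter at time `0` is black. -/
def letters (η : Config) (j : ℕ) : Color := if h : 0 < j then η ⟨j, h⟩ else black

lemma letters_pos (η : Config) (k : ℕ+) : letters η k = η k := by
  rw [letters, dif_pos k.pos]
  rfl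

lemma letters_zero (η : Config) : letters η 0 = black := by simp [letters]

lemma agreeEvent_eq (η : Config) (n : ℕ+) :
    agreeEvent η n = {ω | ∀ j ∈ Icc 1 ((n : ℕ) - 1), record ω j = letters η j} := by
  ext ω
  simp only [agreeEvent, Set.mem_ofPred_eq, mem_Icc]
  constructor
  · intro h j hj
    have hn := n.pos
    have h1 := h ⟨j, by omega⟩ ((PNat.coe_lt_coe _ _).mp (show j < n by omega))
    rw [letters, dif_pos (by omega)]
    exact h1
  · intro h k hk
    have h1 := h k (by rw [← PNat.coe_lt_coe] at hk; have := k.pos; omega)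
    rwa [letters_pos] at h1

/-- With the convention that the letter at time `0` is black, the numerator of the conditional
probability is again a record event, now with time `0` included. -/
lemma blackEvent_inter_agreeEvent_eq (η : Config) (n : ℕ+) :
    agreeEvent η n ∩ blackEvent
      = {ω | ∀ j ∈ range ((n : ℕ) - 1 + 1), record ω j = letters η j} := by
  rw [agreeEvent_eq]
  ext ω
  simp only [Set.mem_inter_iff, blackEvent, Set.mem_ofPred_eq, mem_Icc, mem_range]
  constructor
  · rintro ⟨h1, h2⟩ j hj
    rcases Nat.eq_zero_or_pos j with rfl | h0
    · rw [h2, letters_zero]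
    · exact h1 j (by omega)
  · intro h
    exact ⟨fun j hj => h j (by omega), by rw [h 0 (by omega), letters_zero]⟩

lemma measurable_record (n : ℕ) : Measurable fun ω : Sample => record ω n := by
  have hpos : Measurable fun ω : Sample => pos ω n :=
    Finset.measurable_sum _ fun i _ => (measurable_pi_apply i).comp measurable_fst
  intro t ht
  have : (fun ω : Sample => record ω n) ⁻¹' t
      = ⋃ z : ℤ, {ω | pos ω n = z} ∩ {ω | ω.2 z ∈ t} := by
    ext ω; simp [record]
  rw [this]
  refine MeasurableSet.iUnion fun z => (hpos (measurableSet_singleton z)).inter ?_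
  exact (measurable_pi_apply z).comp measurable_snd ht

lemma measurableSet_agreeEvent (η : Config) (n : ℕ+) : MeasurableSet (agreeEvent η n) := by
  have : agreeEvent η n = ⋂ k : ℕ+, ⋂ _ : k < n, (fun ω => record ω k) ⁻¹' {η k} := by
    ext ω; simp [agreeEvent]
  rw [this]
  exact MeasurableSet.iInter fun k => MeasurableSet.iInter fun _ =>
    measurable_record k (measurableSet_singleton _)

lemma law_agreeEvent (θ : Params) (η : Config) {n : ℕ+} {N : ℕ} (h : (n : ℕ) = N + 1) :
    (law θ).real (agreeEvent η n) = recordProb θ N (letters η) (Icc 1 N) := by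
  rw [agreeEvent_eq, h, Nat.add_sub_cancel, law_record]
  intro j hj
  simp only [mem_Icc] at hj
  simp; omega

lemma law_black_agreeEvent (θ : Params) (η : Config) {n : ℕ+} {N : ℕ} (h : (n : ℕ) = N + 1) :
    (law θ).real (agreeEvent η n ∩ blackEvent)
      = recordProb θ N (letters η) (range (N + 1)) := by
  rw [blackEvent_inter_agreeEvent_eq, h, Nat.add_sub_cancel, law_record]
  rfl

lemma condBlack_eq (θ : Params) (η : Config) {n : ℕ+} {N : ℕ} (h : (n : ℕ) = N + 1) :
    condBlack θ η n = recordProb θ N (letters η) (range (N + 1))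
      / recordProb θ N (letters η) (Icc 1 N) := by
  rw [condBlack, Measure.real, cond_apply (measurableSet_agreeEvent η n), ENNReal.toReal_mul,
    ENNReal.toReal_inv, ← Measure.real, ← Measure.real, law_agreeEvent θ η h,
    law_black_agreeEvent θ η h, div_eq_inv_mul]

lemma recordProb_nonneg (θ : Params) (N : ℕ) (a : ℕ → Color) (I : Finset ℕ) :
    0 ≤ recordProb θ N a I :=
  sum_nonneg fun _ _ => mul_nonneg (weight_nonneg ..) (fit_nonneg ..)

/-! ### Concatenation, cut times and the count of steps other than `+1`. -/

/-- First `k` steps as in `u`, then steps as in `v`. -/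
def concat (k : ℕ) (u v : ℕ → ℤ) (i : ℕ) : ℤ := if i < k then u i else v (i - k)

lemma sum_paths_add {M : Type*} [AddCommMonoid M] (k l : ℕ) (f : (ℕ → ℤ) → M) :
    ∑ s ∈ paths (k + l), f s = ∑ u ∈ paths k, ∑ v ∈ paths l, f (concat k u v) := by
  rw [← sum_product']
  refine sum_nbij' (fun s => (fun i => if i < k then s i else 0, fun i => s (k + i)))
    (fun x => concat k x.1 x.2) ?_ ?_ ?_ ?_ ?_
  · intro s hs
    rw [mem_paths] at hs
    rw [mem_product, mem_paths, mem_paths]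
    refine ⟨⟨fun i hi => ?_, fun i hi => ?_⟩, fun i hi => hs.1 _ (by omega),
      fun i hi => hs.2 _ (by omega)⟩
    · simp only [hi, if_true]; exact hs.1 _ (by omega)
    · simp [Nat.not_lt.mpr hi]
  · rintro ⟨u, v⟩ h
    rw [mem_product, mem_paths, mem_paths] at h
    rw [mem_paths]
    refine ⟨fun i hi => ?_, fun i hi => ?_⟩
    · unfold concat
      split_ifs with h1
      · exact h.1.1 i h1
      · exact h.2.1 _ (by omega)
    · simp only [concat, show ¬ i < k by omega, if_false]
      exact h.2.2 _ (by omega)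
  · intro s _
    funext i
    simp only [concat]
    split_ifs with h1
    · rfl
    · congr 1; omega
  · rintro ⟨u, v⟩ h
    rw [mem_product, mem_paths, mem_paths] at h
    refine Prod.ext ?_ ?_
    · funext i
      by_cases h1 : i < k
      · simp [concat, h1]
      · simp only [h1, if_false]
        exact (h.1.2 i (by omega)).symm
    · funext i
      simp [concat]
  · intro s _
    congr 1
    funext i
    simp only [concat]
    split_ifs with h1
    · rfl
    · congr 1; omega

lemma weight_concat (θ : Params) (k l : ℕ) (u v : ℕ → ℤ) :
    weight θ (k + l) (concat k u v) = weight θ k u * weight θ l v := by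
  rw [weight, prod_range_add]
  congr 1
  · refine prod_congr rfl fun i hi => ?_
    simp [concat, mem_range.mp hi]
  · refine prod_congr rfl fun i hi => ?_
    simp [concat]

lemma walk_concat_of_le {k j : ℕ} (u v : ℕ → ℤ) (h : j ≤ k) :
    walk (concat k u v) j = walk u j :=
  walk_congr fun i hi => by simp [concat, show i < k by omega]

lemma walk_concat_add (k j : ℕ) (u v : ℕ → ℤ) :
    walk (concat k u v) (k + j) = walk u k + walk v j := by
  rw [walk, sum_range_add]
  congr 1
  · exact walk_concat_of_le u v le_rfl
  · refine sum_congr rfl fun i _ => by simp [concat]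

/-- Up to time `N`, the sites visited until time `i` lie strictly to the left of the sites visited
after time `i`. -/
def IsCut (N : ℕ) (s : ℕ → ℤ) (i : ℕ) : Prop :=
  ∀ j ≤ i, ∀ j', i < j' → j' ≤ N → walk s j < walk s j'

/-- Upward and downward crossings of the edge between `y` and `y + 1` alternate, so their difference
depends only on the sides where the walk starts and ends. -/
lemma card_up_sub_card_down {N : ℕ} {s : ℕ → ℤ} (hs : ∀ i < N, s i ∈ stepSet) (y : ℤ) :
    (#{i ∈ range N | s i = 1 ∧ walk s i = y} : ℤ) - #{i ∈ range N | s i = -1 ∧ walk s i = y + 1}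
      = (if y < walk s N then 1 else 0) - (if y < 0 then 1 else 0) := by
  induction N with
  | zero => simp
  | succ N ih =>
    have ih' := ih fun i hi => hs i (by omega)
    have hN := mem_stepSet.mp (hs N (by omega))
    rw [range_add_one, filter_insert, filter_insert, walk_succ]
    have n1 : N ∉ {i ∈ range N | s i = 1 ∧ walk s i = y} := by simp
    have n2 : N ∉ {i ∈ range N | s i = -1 ∧ walk s i = y + 1} := by simp
    rcases hN with h | h | h
    · simp only [h, show ¬ ((-1 : ℤ) = 1) by decide, false_and, if_false, true_and]
      split_ifs at * <;> (try rw [card_insert_of_notMem n2]) <;> push_cast <;> omega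
    · simp only [h, show ¬ ((0 : ℤ) = 1) by decide, show ¬ ((0 : ℤ) = -1) by decide, false_and,
        if_false, add_zero]
      exact ih'
    · simp only [h, show ¬ ((1 : ℤ) = -1) by decide, false_and, if_false, true_and]
      split_ifs at * <;> (try rw [card_insert_of_notMem n1]) <;> push_cast <;> omega

/-- If the edge of an upward step is never crossed downward, the walk cannot return below it later
and cannot have been above it earlier. -/
lemma isCut_of_forall_down {N : ℕ} {s : ℕ → ℤ} (hs : ∀ i < N, s i ∈ stepSet) {i : ℕ}
    (hi : i < N) (h1 : s i = 1)
    (hd : ∀ j < N, s j = -1 → walk s j ≠ walk s i + 1) : IsCut N s i := by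
  have right : ∀ d, i + 1 + d ≤ N → walk s i + 1 ≤ walk s (i + 1 + d) := by
    intro d
    induction d with
    | zero => intro _; rw [add_zero, walk_succ, h1]
    | succ d ih =>
      intro hd'
      have := ih (by omega)
      rw [← add_assoc, walk_succ]
      have h2 := hd (i + 1 + d) (by omega)
      rcases mem_stepSet.mp (hs (i + 1 + d) (by omega)) with h | h | h
      · have := h2 h; omega
      · omega
      · omega
  have left : ∀ d, d ≤ i → walk s (i - d) ≤ walk s i := by
    intro d
    induction d with
    | zero => intro _; simp
    | succ d ih =>
      intro hd'
      have := ih (by omega)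
      have e : i - d = i - (d + 1) + 1 := by omega
      rw [e, walk_succ] at this
      have h2 := hd (i - (d + 1)) (by omega)
      rcases mem_stepSet.mp (hs (i - (d + 1)) (by omega)) with h | h | h
      · have := h2 h; omega
      · omega
      · omega
  intro j hj j' hj' hN
  have a := left (i - j) (by omega)
  have b := right (j' - (i + 1)) (by omega)
  rw [show i - (i - j) = j by omega] at a
  rw [show i + 1 + (j' - (i + 1)) = j' by omega] at b
  omega

/-- Number of steps up to time `N` other than `+1`. -/
def numBad (N : ℕ) (s : ℕ → ℤ) : ℕ := #{i ∈ range N | s i ≠ 1}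

open scoped Classical in
-- A non-cut time carries a step other than `+1`, or a step `+1` over an edge that is also crossed
-- downward. On such an edge there are at most one more upward than downward crossings, hence at
-- most twice as many. This gives `1 + 2 = 3`.
lemma card_not_isCut_le {N : ℕ} {s : ℕ → ℤ} (hs : ∀ i < N, s i ∈ stepSet) :
    #{i ∈ range N | ¬ IsCut N s i} ≤ 3 * numBad N s := by
  set down := {i ∈ range N | s i = -1} with hdown
  set bad := {i ∈ range N | s i ≠ 1} with hbad
  set Y := down.image fun i => walk s i - 1 with hY
  set U := {i ∈ range N | s i = 1 ∧ walk s i ∈ Y} with hU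
  have hsub : {i ∈ range N | ¬ IsCut N s i} ⊆ bad ∪ U := by
    intro i hi
    rw [mem_filter, mem_range] at hi
    rw [mem_union, hbad, hU, mem_filter, mem_filter, mem_range]
    by_cases h1 : s i = 1
    · refine Or.inr ⟨hi.1, h1, ?_⟩
      by_contra hY'
      refine hi.2 (isCut_of_forall_down hs hi.1 h1 fun j hj hj1 hw => hY' ?_)
      rw [hY, mem_image]
      exact ⟨j, by simp [hdown, hj, hj1], by omega⟩
    · exact Or.inl ⟨hi.1, h1⟩
  have hUle : #U ≤ 2 * #down := by
    have h1 : #U = ∑ y ∈ Y, #{i ∈ U | walk s i = y} :=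
      card_eq_sum_card_fiberwise fun i hi => by
        have := mem_coe.mp hi
        rw [hU, mem_filter] at this
        exact this.2.2
    have h2 : #down = ∑ y ∈ Y, #{i ∈ down | walk s i - 1 = y} :=
      card_eq_sum_card_fiberwise fun i hi => mem_image_of_mem _ hi
    rw [h1, h2, mul_sum]
    refine sum_le_sum fun y hy => ?_
    have hcount := card_up_sub_card_down hs y
    have e1 : {i ∈ U | walk s i = y} ⊆ {i ∈ range N | s i = 1 ∧ walk s i = y} := by
      intro i hi
      simp only [hU, mem_filter] at hi ⊢
      exact ⟨hi.1.1, hi.1.2.1, hi.2⟩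
    have e2 : {i ∈ down | walk s i - 1 = y} = {i ∈ range N | s i = -1 ∧ walk s i = y + 1} := by
      ext i
      simp only [hdown, mem_filter, and_assoc]
      exact and_congr_right fun _ => and_congr_right fun _ => by omega
    have e3 : 0 < #{i ∈ down | walk s i - 1 = y} := by
      obtain ⟨i, hi, hiy⟩ := mem_image.mp hy
      exact card_pos.mpr ⟨i, mem_filter.mpr ⟨hi, hiy⟩⟩
    have := card_le_card e1
    rw [← e2] at hcount
    split_ifs at hcount <;> omega
  have hdb : #down ≤ #bad := by
    refine card_le_card fun i hi => ?_
    simp only [hdown, hbad, mem_filter] at hi ⊢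
    exact ⟨hi.1, by rw [hi.2]; decide⟩
  have := (card_le_card hsub).trans (card_union_le _ _)
  have e : numBad N s = #bad := rfl
  omega

lemma le_numBad_add_numBad {N k : ℕ} {s s' : ℕ → ℤ} (hk : k ≤ N)
    (hs : ∀ i < N, s i ∈ stepSet) (hs' : ∀ i < N, s' i ∈ stepSet)
    (h : ∀ i < k, ¬ (IsCut N s i ∧ IsCut N s' i)) :
    k ≤ 3 * (numBad N s + numBad N s') := by
  classical
  have hsub : range k ⊆ {i ∈ range N | ¬ IsCut N s i} ∪ {i ∈ range N | ¬ IsCut N s' i} := by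
    intro i hi
    rw [mem_range] at hi
    have := h i hi
    simp only [mem_union, mem_filter, mem_range]
    by_cases h1 : IsCut N s i
    · exact Or.inr ⟨by omega, fun h2 => this ⟨h1, h2⟩⟩
    · exact Or.inl ⟨by omega, h1⟩
  have h1 := (card_le_card hsub).trans (card_union_le _ _)
  rw [card_range] at h1
  have := card_not_isCut_le hs
  have := card_not_isCut_le hs'
  omega

/-! ### Pairs of paths without a common cut time are rare. -/

/-- A step sequence that stays to the right of its starting point at the times `1, …, l`. -/
def IsGood (l : ℕ) (v : ℕ → ℤ) : Prop := ∀ j, 1 ≤ j → j ≤ l → 0 < walk v j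

lemma isGood_of_isCut_concat {k l : ℕ} {u v : ℕ → ℤ}
    (h : IsCut (k + l) (concat k u v) k) : IsGood l v := by
  intro j hj hjl
  have := h k le_rfl (k + j) (by omega) (by omega)
  rw [walk_concat_add, walk_concat_of_le u v le_rfl] at this
  omega

lemma isCut_concat {k l i : ℕ} {u v : ℕ → ℤ} (hi : i < k)
    (h : IsCut (k + l) (concat k u v) k) (hu : IsCut k u i) :
    IsCut (k + l) (concat k u v) i := by
  intro j hj j' hj' hN
  have h1 := hu j hj k hi le_rfl
  rw [walk_concat_of_le u v (by omega)]
  by_cases hk : j' ≤ k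
  · rw [walk_concat_of_le u v hk]
    exact hu j hj j' hj' hk
  · have h2 := h k le_rfl j' (by omega) hN
    rw [walk_concat_of_le u v le_rfl] at h2
    omega

open scoped Classical in
/-- Probability that the walk reads the letters `a (k + 1), …, a (k + l)` in a fresh scenery while
staying to the right of its starting point. -/
noncomputable def goodProb (θ : Params) (k l : ℕ) (a : ℕ → Color) : ℝ :=
  ∑ v ∈ paths l, if IsGood l v then
    weight θ l v * fit (walk v) (fun j => a (k + j)) (Icc 1 l) else 0

lemma goodProb_nonneg (θ : Params) (k l : ℕ) (a : ℕ → Color) : 0 ≤ goodProb θ k l a := by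
  classical
  exact sum_nonneg fun v _ => by
    split_ifs
    · exact mul_nonneg (weight_nonneg ..) (fit_nonneg ..)
    · exact le_rfl

lemma fit_concat_le (k l : ℕ) (u v : ℕ → ℤ) (a : ℕ → Color) :
    fit (walk (concat k u v)) a (Icc 1 (k + l))
      ≤ fit (walk v) (fun j => a (k + j)) (Icc 1 l) := by
  refine (fit_anti _ _ (Icc_subset_Icc (show 1 ≤ k + 1 by omega) le_rfl)).trans ?_
  rw [fit_shift, ← fit_comp (add_right_injective (walk u k)) (walk v)]
  refine (fit_congr (fun j _ => ?_) fun _ _ => rfl).le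
  rw [walk_concat_add]

lemma walk_ones {k : ℕ} {s : ℕ → ℤ} (hs : ∀ i < k, s i = 1) {j : ℕ} (hj : j ≤ k) :
    walk s j = j := by
  rw [walk, sum_eq_card_nsmul (b := 1) fun i hi => hs i (by have := mem_range.mp hi; omega)]
  simp

lemma fit_ones (k : ℕ) (s : ℕ → ℤ) (hs : ∀ i < k, s i = 1) (a : ℕ → Color) :
    fit (walk s) a (Icc 1 k) = 2⁻¹ ^ k := by
  have hw : ∀ j ≤ k, walk s j = j := fun j hj => walk_ones hs hj
  rw [fit_eq_pow (c₀ := fun z => a z.toNat)]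
  · rw [card_image_of_injOn]
    · simp
    · intro i hi j hj hij
      simp only [coe_Icc, Set.mem_Icc] at hi hj
      rw [hw i hi.2, hw j hj.2] at hij
      exact_mod_cast hij
  · intro j hj
    rw [hw j (mem_Icc.mp hj).2]
    simp

/-- Keep only the paths that start with `k` steps `+1`. They read `k` letters at fresh sites, and a
tail that stays to the right meets none of these sites. The factor `goodProb` is the one in
`sum_firstCut_le`, so it cancels in the comparison. -/
lemma le_recordProb (θ : Params) (k l : ℕ) (a : ℕ → Color) :
    (stepProb θ 1 / 2) ^ k * goodProb θ k l a ≤ recordProb θ (k + l) a (Icc 1 (k + l)) := by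
  classical
  rw [recordProb, sum_paths_add]
  set u₀ : ℕ → ℤ := fun i => if i < k then 1 else 0 with hu₀
  have hmem : u₀ ∈ paths k := by
    rw [mem_paths]
    exact ⟨fun i hi => by simp [hu₀, hi, stepSet], fun i hi => by simp [hu₀, Nat.not_lt.mpr hi]⟩
  have hone : ∀ i < k, u₀ i = 1 := fun i hi => by simp [hu₀, hi]
  refine le_trans ?_ (single_le_sum (fun u _ => sum_nonneg fun v _ =>
    mul_nonneg (weight_nonneg ..) (fit_nonneg ..)) hmem)
  rw [goodProb, mul_sum]
  refine sum_le_sum fun v _ => ?_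
  split_ifs with hv
  · rw [weight_concat]
    have hw : weight θ k u₀ = stepProb θ 1 ^ k := by
      rw [weight, prod_eq_pow_card (b := stepProb θ 1) fun i hi => by
        rw [hone i (mem_range.mp hi)], card_range]
    have hk : walk u₀ k = k := walk_ones hone le_rfl
    have hunion : Icc 1 (k + l) = Icc 1 k ∪ Icc (k + 1) (k + l) := by
      ext j; simp only [mem_union, mem_Icc]; omega
    rw [hunion, fit_union, fit_ones k _ (fun i hi => by simp [concat, hi, hone i hi]), fit_shift, ← fit_comp (add_right_injective (walk u₀ k))
      (walk v), hw, div_pow, inv_pow]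
    · have : fit (fun j => walk u₀ k + walk v j) (fun j => a (k + j)) (Icc 1 l)
        = fit (fun j => walk (concat k u₀ v) (k + j)) (fun j => a (k + j)) (Icc 1 l) :=
        fit_congr (fun j _ => by rw [walk_concat_add]) fun _ _ => rfl
      rw [this]
      exact le_of_eq (by ring)
    · intro i hi j hj
      rw [mem_Icc] at hi hj
      have h1 := hv (j - k) (by omega) (by omega)
      have e : walk (concat k u₀ v) j = walk u₀ k + walk v (j - k) := by
        rw [← walk_concat_add]; congr 1; omega
      have e' : walk u₀ i = i := walk_ones hone hi.2
      rw [e, hk, walk_concat_of_le u₀ v hi.2, e']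
      omega
  · rw [mul_zero]
    exact mul_nonneg (weight_nonneg ..) (fit_nonneg ..)

/-- The generating function of the number of steps other than `+1` factorizes over the steps. -/
lemma sum_weight_pow_numBad (θ : Params) (N : ℕ) (t : ℝ) :
    ∑ u ∈ paths N, weight θ N u * t ^ numBad N u
      = (stepProb θ 1 + t * (1 - stepProb θ 1)) ^ N := by
  have h1 : ∀ u, weight θ N u * t ^ numBad N u
      = ∏ i ∈ range N, (stepProb θ (u i) * if u i ≠ 1 then t else 1) := by
    intro u
    rw [prod_mul_distrib, weight, numBad, prod_ite]
    simp
  rw [sum_congr rfl fun u _ => h1 u, sum_paths_prod N fun d => stepProb θ d * if d ≠ 1 then t else 1]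
  congr 1
  have := sum_stepProb θ
  simp only [stepSet, Int.reduceNeg, ne_eq, ite_not] at this ⊢
  simp at this ⊢
  linear_combination t * this

/-- The pairs of paths without common cut time before `k`. -/
def NoCommonCut (N k : ℕ) (x : (ℕ → ℤ) × (ℕ → ℤ)) : Prop :=
  ∀ i < k, ¬ (IsCut N x.1 i ∧ IsCut N x.2 i)

/-- Weight of a path, times the probability that it reads the letters `a`. -/
noncomputable def pathProb (θ : Params) (N : ℕ) (a : ℕ → Color) (s : ℕ → ℤ) : ℝ :=
  weight θ N s * fit (walk s) a (Icc 1 N)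

lemma pathProb_nonneg (θ : Params) (N : ℕ) (a : ℕ → Color) (s : ℕ → ℤ) :
    0 ≤ pathProb θ N a s := mul_nonneg (weight_nonneg ..) (fit_nonneg ..)

open scoped Classical in
-- At a common cut time `k` both tails stay to the right of their starting points, and dropping the
-- first `k` letters bounds them by `goodProb`. If `k` is the first common cut time, the two initial
-- pieces contain together at least `k / 3` steps other than `+1`. So a factor `t` to the power of
-- three times their number, divided by `t ^ k`, is at least `1` and may be inserted; the sum then
-- factorizes.
lemma sum_firstCut_le (θ : Params) {t : ℝ} (ht : 1 ≤ t) (k l : ℕ) (a b : ℕ → Color) :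
    (∑ x ∈ paths (k + l) ×ˢ paths (k + l),
      if NoCommonCut (k + l) k x ∧ IsCut (k + l) x.1 k ∧ IsCut (k + l) x.2 k then
        pathProb θ (k + l) a x.1 * pathProb θ (k + l) b x.2 else 0)
      ≤ ((stepProb θ 1 + t ^ 3 * (1 - stepProb θ 1)) ^ 2 / t) ^ k
        * (goodProb θ k l a * goodProb θ k l b) := by
  have ht0 : 0 < t := by linarith
  set w : (ℕ → ℤ) → ℝ := fun u => weight θ k u * (t ^ 3) ^ numBad k u with hw
  set g : (ℕ → Color) → (ℕ → ℤ) → ℝ := fun a v => if IsGood l v then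
    weight θ l v * fit (walk v) (fun j => a (k + j)) (Icc 1 l) else 0 with hg
  have hg0 : ∀ a v, 0 ≤ g a v := by
    intro a v
    simp only [hg]
    split_ifs
    · exact mul_nonneg (weight_nonneg ..) (fit_nonneg ..)
    · exact le_rfl
  have hw0 : ∀ u, 0 ≤ w u := fun u => mul_nonneg (weight_nonneg ..) (by positivity)
  have main : ∀ u ∈ paths k, ∀ v ∈ paths l, ∀ u' ∈ paths k, ∀ v' ∈ paths l,
      (if NoCommonCut (k + l) k (concat k u v, concat k u' v') ∧
          IsCut (k + l) (concat k u v) k ∧ IsCut (k + l) (concat k u' v') k then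
        pathProb θ (k + l) a (concat k u v) * pathProb θ (k + l) b (concat k u' v') else 0)
      ≤ t⁻¹ ^ k * ((w u * g a v) * (w u' * g b v')) := by
    intro u hu v hv u' hu' v' hv'
    split_ifs with h
    · obtain ⟨h1, h2, h3⟩ := h
      have hJ := le_numBad_add_numBad le_rfl (mem_paths.mp hu).1 (mem_paths.mp hu').1
        fun i hi hc => h1 i hi ⟨isCut_concat hi h2 hc.1, isCut_concat hi h3 hc.2⟩
      have e1 : g a v = weight θ l v * fit (walk v) (fun j => a (k + j)) (Icc 1 l) := by
        simp only [hg, isGood_of_isCut_concat h2, if_true]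
      have e2 : g b v' = weight θ l v' * fit (walk v') (fun j => b (k + j)) (Icc 1 l) := by
        simp only [hg, isGood_of_isCut_concat h3, if_true]
      have b1 : pathProb θ (k + l) a (concat k u v) ≤ weight θ k u * g a v := by
        rw [pathProb, weight_concat, e1, mul_assoc]
        exact mul_le_mul_of_nonneg_left (mul_le_mul_of_nonneg_left (fit_concat_le ..)
          (weight_nonneg ..)) (weight_nonneg ..)
      have b2 : pathProb θ (k + l) b (concat k u' v') ≤ weight θ k u' * g b v' := by
        rw [pathProb, weight_concat, e2, mul_assoc]
        exact mul_le_mul_of_nonneg_left (mul_le_mul_of_nonneg_left (fit_concat_le ..)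
          (weight_nonneg ..)) (weight_nonneg ..)
      have b3 : 1 ≤ t⁻¹ ^ k * ((t ^ 3) ^ numBad k u * (t ^ 3) ^ numBad k u') := by
        rw [← pow_add, ← pow_mul, inv_pow, inv_mul_eq_div, one_le_div (by positivity)]
        exact pow_le_pow_right₀ ht hJ
      have hb0 : 0 ≤ (weight θ k u * g a v) * (weight θ k u' * g b v') :=
        mul_nonneg (mul_nonneg (weight_nonneg ..) (hg0 ..))
          (mul_nonneg (weight_nonneg ..) (hg0 ..))
      calc pathProb θ (k + l) a (concat k u v) * pathProb θ (k + l) b (concat k u' v')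
          ≤ (weight θ k u * g a v) * (weight θ k u' * g b v') :=
            mul_le_mul b1 b2 (pathProb_nonneg ..) (mul_nonneg (weight_nonneg ..) (hg0 ..))
        _ ≤ ((weight θ k u * g a v) * (weight θ k u' * g b v'))
            * (t⁻¹ ^ k * ((t ^ 3) ^ numBad k u * (t ^ 3) ^ numBad k u')) :=
            le_mul_of_one_le_right hb0 b3
        _ = _ := by simp only [hw]; ring
    · exact mul_nonneg (by positivity)
        (mul_nonneg (mul_nonneg (hw0 _) (hg0 _ _)) (mul_nonneg (hw0 _) (hg0 _ _)))
  have sumwg : ∀ a, ∑ u ∈ paths k, ∑ v ∈ paths l, w u * g a v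
      = (stepProb θ 1 + t ^ 3 * (1 - stepProb θ 1)) ^ k * goodProb θ k l a := by
    intro a
    rw [← sum_mul_sum, sum_weight_pow_numBad]
    rfl
  rw [sum_product, sum_paths_add]
  calc _ ≤ ∑ u ∈ paths k, ∑ v ∈ paths l, ∑ u' ∈ paths k, ∑ v' ∈ paths l,
        t⁻¹ ^ k * ((w u * g a v) * (w u' * g b v')) := by
        refine sum_le_sum fun u hu => sum_le_sum fun v hv => ?_
        rw [sum_paths_add]
        exact sum_le_sum fun u' hu' => sum_le_sum fun v' hv' => main u hu v hv u' hu' v' hv'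
    _ = t⁻¹ ^ k * ((∑ u ∈ paths k, ∑ v ∈ paths l, w u * g a v)
          * (∑ u ∈ paths k, ∑ v ∈ paths l, w u * g b v)) := by
        rw [sum_mul, mul_sum]
        refine sum_congr rfl fun u _ => ?_
        rw [sum_mul, mul_sum]
        refine sum_congr rfl fun v _ => ?_
        simp only [mul_sum]
    _ = _ := by rw [sumwg, sumwg, div_pow, inv_pow, pow_right_comm]; ring

open scoped Classical in
-- Split by the first common cut time `k ≥ m`. In each part `goodProb` cancels between
-- `sum_firstCut_le` and `le_recordProb`, and a geometric series remains.
lemma sum_noCommonCut_le (θ : Params) {t : ℝ} (ht : 1 ≤ t) {m N : ℕ} (hm : m ≤ N)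
    (a b : ℕ → Color) (hβ : 0 < stepProb θ 1)
    (hρ : 4 * (stepProb θ 1 + t ^ 3 * (1 - stepProb θ 1)) ^ 2 / (t * stepProb θ 1 ^ 2) < 1) :
    (∑ x ∈ paths N ×ˢ paths N, if NoCommonCut N m x then
        pathProb θ N a x.1 * pathProb θ N b x.2 else 0)
      ≤ (4 * (stepProb θ 1 + t ^ 3 * (1 - stepProb θ 1)) ^ 2 / (t * stepProb θ 1 ^ 2)) ^ m
        / (1 - 4 * (stepProb θ 1 + t ^ 3 * (1 - stepProb θ 1)) ^ 2 / (t * stepProb θ 1 ^ 2))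
        * (recordProb θ N a (Icc 1 N) * recordProb θ N b (Icc 1 N)) := by
  set β := stepProb θ 1 with hβdef
  set ρ := 4 * (β + t ^ 3 * (1 - β)) ^ 2 / (t * β ^ 2) with hρdef
  have ht0 : 0 < t := by linarith
  have hρ0 : 0 ≤ ρ := by positivity
  set T := recordProb θ N a (Icc 1 N) * recordProb θ N b (Icc 1 N) with hT
  have hT0 : 0 ≤ T := mul_nonneg (recordProb_nonneg ..) (recordProb_nonneg ..)
  have hk : ∀ k ∈ Ico m (N + 1), (∑ x ∈ paths N ×ˢ paths N,
      if NoCommonCut N k x ∧ IsCut N x.1 k ∧ IsCut N x.2 k then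
        pathProb θ N a x.1 * pathProb θ N b x.2 else 0) ≤ ρ ^ k * T := by
    intro k hk
    obtain ⟨l, rfl⟩ : ∃ l, N = k + l := ⟨N - k, by have := (mem_Ico.mp hk).2; omega⟩
    refine (sum_firstCut_le θ ht k l a b).trans ?_
    have h1 := le_recordProb θ k l a
    have h2 := le_recordProb θ k l b
    have h3 := mul_le_mul h1 h2 (mul_nonneg (by positivity) (goodProb_nonneg ..))
      (recordProb_nonneg ..)
    rw [← hβdef] at h3 ⊢
    have e : ρ = ((β + t ^ 3 * (1 - β)) ^ 2 / t) * ((β / 2) ^ 2)⁻¹ := by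
      rw [hρdef]; field_simp; ring
    calc ((β + t ^ 3 * (1 - β)) ^ 2 / t) ^ k * (goodProb θ k l a * goodProb θ k l b)
        = ρ ^ k * ((β / 2) ^ k * goodProb θ k l a * ((β / 2) ^ k * goodProb θ k l b)) := by
          rw [e, mul_pow, inv_pow, pow_right_comm]; field_simp
      _ ≤ _ := mul_le_mul_of_nonneg_left h3 (by positivity)
  have hle : ∀ x ∈ paths N ×ˢ paths N, (if NoCommonCut N m x then
        pathProb θ N a x.1 * pathProb θ N b x.2 else 0)
      ≤ ∑ k ∈ Ico m (N + 1), if NoCommonCut N k x ∧ IsCut N x.1 k ∧ IsCut N x.2 k then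
        pathProb θ N a x.1 * pathProb θ N b x.2 else 0 := by
    intro x _
    have hnn : 0 ≤ pathProb θ N a x.1 * pathProb θ N b x.2 :=
      mul_nonneg (pathProb_nonneg ..) (pathProb_nonneg ..)
    split_ifs with h
    · have hex : ∃ k, IsCut N x.1 k ∧ IsCut N x.2 k :=
        ⟨N, fun j _ j' h1 h2 => by omega, fun j _ j' h1 h2 => by omega⟩
      have hN : Nat.find hex ≤ N := Nat.find_min' hex
        ⟨fun j _ j' h1 h2 => by omega, fun j _ j' h1 h2 => by omega⟩
      have hmk : m ≤ Nat.find hex := by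
        by_contra hc
        exact h _ (by omega) (Nat.find_spec hex)
      refine le_trans ?_ (single_le_sum (fun k _ => by split_ifs <;> simp [hnn])
        (mem_Ico.mpr ⟨hmk, Nat.lt_succ_of_le hN⟩))
      rw [if_pos ⟨fun i hi => Nat.find_min hex hi, Nat.find_spec hex⟩]
    · exact sum_nonneg fun k _ => by split_ifs <;> simp [hnn]
  calc _ ≤ _ := sum_le_sum hle
    _ ≤ ∑ k ∈ Ico m (N + 1), ρ ^ k * T := by
        rw [sum_comm]; exact sum_le_sum hk
    _ = (∑ k ∈ Ico m (N + 1), ρ ^ k) * T := by rw [sum_mul]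
    _ ≤ _ := mul_le_mul_of_nonneg_right (geom_sum_Ico_le_of_lt_one hρ0 hρ) hT0

/-! ### Exchange of initial pieces at the first common cut time. -/

/-- First `k` steps as in `s'`, later steps as in `s`. -/
def graft (k : ℕ) (s' s : ℕ → ℤ) (i : ℕ) : ℤ := if i < k then s' i else s i

lemma walk_graft_of_le {k j : ℕ} (s' s : ℕ → ℤ) (h : j ≤ k) :
    walk (graft k s' s) j = walk s' j :=
  walk_congr fun i hi => by simp [graft, show i < k by omega]

lemma walk_graft_of_ge {k j : ℕ} (s' s : ℕ → ℤ) (h : k ≤ j) :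
    walk (graft k s' s) j = walk s' k - walk s k + walk s j := by
  obtain ⟨d, rfl⟩ := Nat.exists_eq_add_of_le h
  induction d with
  | zero => rw [add_zero, walk_graft_of_le s' s le_rfl]; ring
  | succ d ih =>
    rw [← add_assoc, walk_succ, ih (by omega), walk_succ]
    simp [graft]
    ring

lemma graft_mem_paths {N k : ℕ} {s s' : ℕ → ℤ} (hs' : s' ∈ paths N) (hs : s ∈ paths N) :
    graft k s' s ∈ paths N := by
  rw [mem_paths] at *
  refine ⟨fun i hi => ?_, fun i hi => ?_⟩
  · unfold graft
    split_ifs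
    · exact hs'.1 i hi
    · exact hs.1 i hi
  · unfold graft
    split_ifs
    · exact hs'.2 i hi
    · exact hs.2 i hi

lemma graft_graft (k : ℕ) (s s' : ℕ → ℤ) : graft k (graft k s s') (graft k s' s) = s := by
  funext i
  unfold graft
  split_ifs <;> rfl

/-- The step at a cut time before `N` leads above all earlier sites and has size at most one, so the
position at the cut time is the maximum so far. This makes the cut survive when another initial
piece is grafted. -/
lemma IsCut.walk_le {N k j : ℕ} {s : ℕ → ℤ} (hs : s ∈ paths N) (hk : k < N) (h : IsCut N s k)
    (hj : j ≤ k) : walk s j ≤ walk s k := by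
  have h1 := h j hj (k + 1) (by omega) (by omega)
  rw [walk_succ] at h1
  rcases mem_stepSet.mp ((mem_paths.mp hs).1 k hk) with h | h | h <;> omega

lemma isCut_graft_self {N k : ℕ} {s s' : ℕ → ℤ} (hs' : s' ∈ paths N) (hk : k < N)
    (h : IsCut N s k) (h' : IsCut N s' k) : IsCut N (graft k s' s) k := by
  intro j hj j' hj' hN
  rw [walk_graft_of_le s' s hj, walk_graft_of_ge s' s (by omega)]
  have h1 := h'.walk_le hs' hk hj
  have h2 := h k le_rfl j' hj' hN
  omega

lemma isCut_graft {N k i : ℕ} {s s' : ℕ → ℤ} (hk : k < N) (h : IsCut N s k) (hi : i < k) (hi' : IsCut N s' i) :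
    IsCut N (graft k s' s) i := by
  intro j hj j' hj' hN
  rcases le_total j' k with hjk | hjk
  · rw [walk_graft_of_le s' s (by omega), walk_graft_of_le s' s hjk]
    exact hi' j hj j' hj' hN
  · rw [walk_graft_of_le s' s (by omega), walk_graft_of_ge s' s hjk]
    have h1 := hi' j hj k hi hk.le
    have h2 : walk s k ≤ walk s j' := by
      rcases hjk.lt_or_eq with h3 | h3
      · exact (h k le_rfl j' h3 hN).le
      · rw [h3]
    omega

lemma fit_cut {N k : ℕ} {s : ℕ → ℤ} (h : IsCut N s k) (hk : k ≤ N) (a : ℕ → Color) :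
    fit (walk s) a (range (N + 1))
        = fit (walk s) a (range (k + 1)) * fit (walk s) a (Icc (k + 1) N) ∧
      fit (walk s) a (Icc 1 N) = fit (walk s) a (Icc 1 k) * fit (walk s) a (Icc (k + 1) N) := by
  constructor
  · rw [← fit_union]
    · congr 1
      ext j; simp only [mem_union, mem_Icc, mem_range]; omega
    · intro i hi j hj
      rw [mem_range] at hi
      rw [mem_Icc] at hj
      exact (h i (by omega) j (by omega) hj.2).ne
  · rw [← fit_union]
    · congr 1
      ext j; simp only [mem_union, mem_Icc]; omega
    · intro i hi j hj
      rw [mem_Icc] at hi hj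
      exact (h i (by omega) j (by omega) hj.2).ne

lemma fit_graft_first {k : ℕ} {s s' : ℕ → ℤ} {a b : ℕ → Color} (h : ∀ j ≤ k, a j = b j)
    {I : Finset ℕ} (hI : ∀ j ∈ I, j ≤ k) :
    fit (walk (graft k s' s)) a I = fit (walk s') b I :=
  fit_congr (fun j hj => walk_graft_of_le s' s (hI j hj)) fun j hj => h j (hI j hj)

lemma fit_graft_last (N k : ℕ) (s s' : ℕ → ℤ) (a : ℕ → Color) :
    fit (walk (graft k s' s)) a (Icc (k + 1) N) = fit (walk s) a (Icc (k + 1) N) := by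
  rw [← fit_comp (add_right_injective (walk s' k - walk s k)) (walk s)]
  refine fit_congr (fun j hj => walk_graft_of_ge s' s ?_) fun _ _ => rfl
  rw [mem_Icc] at hj
  omega

lemma weight_graft (θ : Params) (N k : ℕ) (s s' : ℕ → ℤ) :
    weight θ N (graft k s' s) * weight θ N (graft k s s') = weight θ N s * weight θ N s' := by
  simp only [weight, ← prod_mul_distrib]
  refine prod_congr rfl fun i _ => ?_
  unfold graft
  split_ifs
  · rw [mul_comm]
  · rfl

/-- `k` is the first common cut time of a pair of paths. -/
def IsFirstCut (N k : ℕ) (x : (ℕ → ℤ) × (ℕ → ℤ)) : Prop :=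
  NoCommonCut N k x ∧ IsCut N x.1 k ∧ IsCut N x.2 k

/-- Exchange of the first `k` steps of two paths. -/
def swapAt (k : ℕ) (x : (ℕ → ℤ) × (ℕ → ℤ)) : (ℕ → ℤ) × (ℕ → ℤ) :=
  (graft k x.2 x.1, graft k x.1 x.2)

lemma swapAt_swapAt (k : ℕ) (x : (ℕ → ℤ) × (ℕ → ℤ)) : swapAt k (swapAt k x) = x :=
  Prod.ext (graft_graft k _ _) (graft_graft k _ _)

/-- The exchange is an involution and keeps earlier cut times, so an earlier common cut of the new
pair would also be one of the old pair. -/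
lemma isFirstCut_swapAt {N k : ℕ} (hk : k < N) {x : (ℕ → ℤ) × (ℕ → ℤ)}
    (hx : x ∈ paths N ×ˢ paths N) (h : IsFirstCut N k x) : IsFirstCut N k (swapAt k x) := by
  obtain ⟨hx1, hx2⟩ := mem_product.mp hx
  obtain ⟨h0, h1, h2⟩ := h
  have c1 : IsCut N (swapAt k x).1 k := isCut_graft_self hx2 hk h1 h2
  have c2 : IsCut N (swapAt k x).2 k := isCut_graft_self hx1 hk h2 h1
  refine ⟨fun i hi hc => h0 i hi ?_, c1, c2⟩
  have e := swapAt_swapAt k x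
  have d1 : IsCut N (swapAt k (swapAt k x)).1 i :=
    isCut_graft hk c1 hi hc.2
  have d2 : IsCut N (swapAt k (swapAt k x)).2 i :=
    isCut_graft hk c2 hi hc.1
  rw [e] at d1 d2
  exact ⟨d1, d2⟩

open scoped Classical in
-- Reindexing by `swapAt`: the product of the weights is unchanged, the scenery factors split at the
-- cut, and since the records agree up to `k`, the factor for time `0` moves from one path to the
-- other.
lemma sum_isFirstCut_comm (θ : Params) {N k : ℕ} (hk : k < N) {a b : ℕ → Color}
    (h : ∀ j ≤ k, a j = b j) :
    (∑ x ∈ paths N ×ˢ paths N, if IsFirstCut N k x then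
      (weight θ N x.1 * fit (walk x.1) a (range (N + 1))) * pathProb θ N b x.2 else 0)
    = ∑ x ∈ paths N ×ˢ paths N, if IsFirstCut N k x then
      pathProb θ N a x.1 * (weight θ N x.2 * fit (walk x.2) b (range (N + 1))) else 0 := by
  rw [← sum_filter, ← sum_filter]
  have hmaps : ∀ x ∈ {x ∈ paths N ×ˢ paths N | IsFirstCut N k x},
      swapAt k x ∈ {x ∈ paths N ×ˢ paths N | IsFirstCut N k x} := by
    intro x hx
    rw [mem_filter] at hx ⊢
    obtain ⟨hx1, hx2⟩ := mem_product.mp hx.1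
    exact ⟨mem_product.mpr ⟨graft_mem_paths hx2 hx1, graft_mem_paths hx1 hx2⟩,
      isFirstCut_swapAt hk hx.1 hx.2⟩
  refine sum_nbij' (swapAt k) (swapAt k) hmaps hmaps (fun x _ => swapAt_swapAt k x)
    (fun x _ => swapAt_swapAt k x) ?_
  rintro ⟨s, s'⟩ hx
  have hx' := hmaps _ hx
  rw [mem_filter] at hx hx'
  obtain ⟨-, -, h1, h2⟩ := hx
  obtain ⟨-, -, h3, h4⟩ := hx'
  simp only [swapAt, pathProb] at *
  have w := weight_graft θ N k s s'
  have hr : ∀ j ∈ range (k + 1), j ≤ k := fun j hj => by have := mem_range.mp hj; omega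
  have hc : ∀ j ∈ Icc 1 k, j ≤ k := fun j hj => (mem_Icc.mp hj).2
  rw [(fit_cut h1 hk.le a).1, (fit_cut h2 hk.le b).2, (fit_cut h3 hk.le a).2,
    (fit_cut h4 hk.le b).1, fit_graft_first h hc, fit_graft_last,
    fit_graft_first (fun j hj => (h j hj).symm) hr, fit_graft_last]
  linear_combination -(fit (walk s') b (Icc 1 k) * fit (walk s) a (Icc (k + 1) N) *
    (fit (walk s) a (range (k + 1)) * fit (walk s') b (Icc (k + 1) N))) * w

open scoped Classical in
lemma sum_eq_noCommonCut_add {N : ℕ} (m : ℕ) (S : Finset ((ℕ → ℤ) × (ℕ → ℤ)))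
    (F : (ℕ → ℤ) × (ℕ → ℤ) → ℝ) :
    ∑ x ∈ S, F x = (∑ x ∈ S, if NoCommonCut N m x then F x else 0)
      + ∑ k ∈ range m, ∑ x ∈ S, if IsFirstCut N k x then F x else 0 := by
  induction m with
  | zero => simp [NoCommonCut]
  | succ m ih =>
    rw [ih, sum_range_succ, add_comm (∑ k ∈ range m, _), ← add_assoc, ← sum_add_distrib]
    congr 1
    refine sum_congr rfl fun x _ => ?_
    have : NoCommonCut N (m + 1) x ↔ NoCommonCut N m x ∧ ¬ (IsCut N x.1 m ∧ IsCut N x.2 m) := by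
      simp only [NoCommonCut]
      constructor
      · exact fun h => ⟨fun i hi => h i (by omega), h m (by omega)⟩
      · intro h i hi
        rcases Nat.lt_succ_iff_lt_or_eq.mp hi with h1 | rfl
        · exact h.1 i h1
        · exact h.2
    simp only [this, IsFirstCut]
    by_cases h1 : NoCommonCut N m x <;> by_cases h2 : IsCut N x.1 m ∧ IsCut N x.2 m <;>
      simp [h1, h2]

/-- This is the difference of two conditional probabilities, multiplied by both denominators. Pairs
with a common cut time before `m` cancel by `sum_isFirstCut_comm`; each remaining term is a
difference of two numbers between `0` and the product of the two `pathProb`. -/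
lemma abs_sub_le_noCommonCut (θ : Params) {N m : ℕ} (hm : m ≤ N) {a b : ℕ → Color}
    (h : ∀ j < m, a j = b j) [DecidablePred (NoCommonCut N m)] :
    |recordProb θ N a (range (N + 1)) * recordProb θ N b (Icc 1 N)
        - recordProb θ N a (Icc 1 N) * recordProb θ N b (range (N + 1))|
      ≤ ∑ x ∈ paths N ×ˢ paths N, if NoCommonCut N m x then
        pathProb θ N a x.1 * pathProb θ N b x.2 else 0 := by
  classical
  have key : recordProb θ N a (range (N + 1)) * recordProb θ N b (Icc 1 N)
        - recordProb θ N a (Icc 1 N) * recordProb θ N b (range (N + 1))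
      = ∑ x ∈ paths N ×ˢ paths N, if NoCommonCut N m x then
        ((weight θ N x.1 * fit (walk x.1) a (range (N + 1))) * pathProb θ N b x.2
        - pathProb θ N a x.1 * (weight θ N x.2 * fit (walk x.2) b (range (N + 1)))) else 0 := by
    simp only [recordProb]
    have e1 := sum_eq_noCommonCut_add (N := N) m (paths N ×ˢ paths N) fun x =>
      (weight θ N x.1 * fit (walk x.1) a (range (N + 1))) * pathProb θ N b x.2
    have e2 := sum_eq_noCommonCut_add (N := N) m (paths N ×ˢ paths N) fun x =>
      pathProb θ N a x.1 * (weight θ N x.2 * fit (walk x.2) b (range (N + 1)))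
    have hk := sum_congr rfl fun k hk => sum_isFirstCut_comm θ (N := N) (k := k)
      (lt_of_lt_of_le (mem_range.mp hk) hm) (a := a) (b := b)
      fun j hj => h j (lt_of_le_of_lt hj (mem_range.mp hk))
    simp only [pathProb] at hk e1 e2 ⊢
    rw [sum_mul_sum, sum_mul_sum, ← sum_product', ← sum_product', e1, e2, hk, add_sub_add_right_eq_sub, ← sum_sub_distrib]
    refine sum_congr rfl fun x _ => ?_
    split_ifs
    · rfl
    · ring
  rw [key]
  refine (abs_sum_le_sum_abs _ _).trans (sum_le_sum fun x _ => ?_)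
  split_ifs
  swap
  · simp
  have hsub : Icc 1 N ⊆ range (N + 1) := fun j hj => by
    rw [mem_Icc] at hj; rw [mem_range]; omega
  have b1 : weight θ N x.1 * fit (walk x.1) a (range (N + 1)) ≤ pathProb θ N a x.1 :=
    mul_le_mul_of_nonneg_left (fit_anti _ _ hsub) (weight_nonneg ..)
  have b2 : weight θ N x.2 * fit (walk x.2) b (range (N + 1)) ≤ pathProb θ N b x.2 :=
    mul_le_mul_of_nonneg_left (fit_anti _ _ hsub) (weight_nonneg ..)
  have c1 : 0 ≤ weight θ N x.1 * fit (walk x.1) a (range (N + 1)) :=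
    mul_nonneg (weight_nonneg ..) (fit_nonneg ..)
  have c2 : 0 ≤ weight θ N x.2 * fit (walk x.2) b (range (N + 1)) :=
    mul_nonneg (weight_nonneg ..) (fit_nonneg ..)
  rw [abs_le]
  constructor
  · have := mul_le_mul_of_nonneg_left b2 (pathProb_nonneg θ N a x.1)
    have := mul_nonneg c1 (pathProb_nonneg θ N b x.2)
    linarith
  · have := mul_le_mul_of_nonneg_right b1 (pathProb_nonneg θ N b x.2)
    have := mul_nonneg (pathProb_nonneg θ N a x.1) c2
    linarith

/-! ### Geometric forgetting above the threshold. -/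

lemma stepProb_one (θ : Params) : stepProb θ 1 = θ.p * (1 - θ.ε) := by
  simp [stepProb_eq]

lemma stepProb_one_pos (θ : Params) : 0 < stepProb θ 1 := by
  rw [stepProb_one]
  exact mul_pos (by linarith [θ.half_le_p]) (by linarith [θ.ε_lt_one])

lemma stepProb_one_le (θ : Params) : stepProb θ 1 ≤ 1 := measureReal_le_one

/-- The path that always steps to the right visits fresh sites and can read any record. -/
lemma recordProb_pos (θ : Params) (N : ℕ) (a : ℕ → Color) : 0 < recordProb θ N a (Icc 1 N) := by
  have h := le_recordProb θ N 0 a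
  have h1 : goodProb θ N 0 a = 1 := by
    have : paths 0 = {0} := by
      ext s
      rw [mem_paths, mem_singleton, funext_iff]
      simp
    have hg : IsGood 0 0 := fun j h1 h2 => by omega
    rw [goodProb, this, sum_singleton, if_pos hg]
    simp [weight, fit]
  rw [h1, mul_one, add_zero] at h
  exact lt_of_lt_of_le (pow_pos (half_pos (stepProb_one_pos θ)) N) h

/-- The rate at which the conditional probability forgets the far record. -/
noncomputable def rate (θ : Params) : ℝ :=
  4 * (stepProb θ 1 + (144 / 25) ^ 3 * (1 - stepProb θ 1)) ^ 2 / (144 / 25 * stepProb θ 1 ^ 2)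

lemma rate_nonneg (θ : Params) : 0 ≤ rate θ := by unfold rate; positivity

lemma rate_lt_one (θ : Params) (h : pStar < θ.p * (1 - θ.ε)) : rate θ < 1 := by
  rw [← stepProb_one] at h
  have h0 := stepProb_one_pos θ
  have h1 := stepProb_one_le θ
  unfold rate
  set β := stepProb θ 1
  rw [div_lt_one (by positivity)]
  -- With `t = 144/25` one has `5 t³ = 12⁶/5⁵`, so `β > p_*` is exactly this inequality, and `4
  -- (6/5)² = t` finishes the bound. At `β = p_*` this `t` minimizes `(β + t³(1-β))²/t`.
  have h2 : (5 : ℝ) * (144 / 25) ^ 3 * (1 - β) < β := by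
    unfold pStar at h
    rw [div_lt_iff₀ (by positivity)] at h
    norm_num at h ⊢
    linarith
  have h3 : β + (144 / 25) ^ 3 * (1 - β) < 6 / 5 * β := by linarith
  have h4 : 0 ≤ β + (144 / 25) ^ 3 * (1 - β) := by
    have : 0 ≤ 1 - β := by linarith
    positivity
  nlinarith

lemma abs_condBlack_sub_le (θ : Params) (h : pStar < θ.p * (1 - θ.ε)) {η ζ : Config} {m n : ℕ+}
    (hmn : m < n) (hagree : ∀ k : ℕ+, k < m → ζ k = η k) :
    |condBlack θ η n - condBlack θ ζ n| ≤ rate θ ^ (m : ℕ) / (1 - rate θ) := by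
  classical
  have hmn' : (m : ℕ) < n := hmn
  obtain ⟨N, hN⟩ : ∃ N, (n : ℕ) = N + 1 := ⟨n - 1, by omega⟩
  have hl : ∀ j < (m : ℕ), letters η j = letters ζ j := by
    intro j hj
    unfold letters
    split_ifs with h0
    · exact (hagree ⟨j, h0⟩ hj).symm
    · rfl
  rw [condBlack_eq θ η hN, condBlack_eq θ ζ hN]
  have p1 := recordProb_pos θ N (letters η)
  have p2 := recordProb_pos θ N (letters ζ)
  rw [div_sub_div _ _ p1.ne' p2.ne', abs_div, abs_of_pos (mul_pos p1 p2), div_le_iff₀ (mul_pos p1 p2)]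
  exact (abs_sub_le_noCommonCut θ (by omega) hl).trans
    (sum_noCommonCut_le θ (by norm_num) (by omega) _ _ (stepProb_one_pos θ) (rate_lt_one θ h))

lemma badSet_eq_empty (θ : Params) (h : pStar < θ.p * (1 - θ.ε)) : badSet θ = ∅ := by
  rw [Set.eq_empty_iff_forall_notMem]
  rintro η ⟨δ, hδ, hη⟩
  have h1 := rate_lt_one θ h
  obtain ⟨M, hM⟩ := exists_pow_lt_of_lt_one (mul_pos hδ (sub_pos.mpr h1)) h1
  obtain ⟨n, ζ, hmn, hagree, hle⟩ := hη M.succPNat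
  have h2 := hle.trans (abs_condBlack_sub_le θ h hmn hagree)
  rw [le_div_iff₀ (sub_pos.mpr h1), Nat.succPNat_coe] at h2
  have h3 := pow_le_pow_of_le_one (rate_nonneg θ) h1.le (Nat.le_succ M)
  linarith

end RWRS

/-! ### A continuous version of the conditional probability. -/

namespace RWRS

open Finset Filter Topology

lemma measurable_future : Measurable future :=
  measurable_pi_lambda _ fun k => measurable_record k

lemma measurableSet_blackEvent : MeasurableSet blackEvent :=
  measurable_record 0 (measurableSet_singleton _)

/-- The configurations that agree with `η` at the times before `n`. -/
def cyl (η : Config) (n : ℕ+) : Set Config := {ζ | ∀ k : ℕ+, k < n → ζ k = η k}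

lemma measurableSet_cyl (η : Config) (n : ℕ+) : MeasurableSet (cyl η n) := by
  have : cyl η n = ⋂ k : ℕ+, ⋂ _ : k < n, (fun ζ : Config => ζ k) ⁻¹' {η k} := by
    ext ω; simp [cyl]
  rw [this]
  exact MeasurableSet.iInter fun k => MeasurableSet.iInter fun _ =>
    measurable_pi_apply k (measurableSet_singleton _)

lemma future_preimage_cyl (η : Config) (n : ℕ+) : future ⁻¹' cyl η n = agreeEvent η n := rfl

lemma agreeEvent_congr {η ζ : Config} {n : ℕ+} (h : ζ ∈ cyl η n) :
    agreeEvent ζ n = agreeEvent η n := by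
  ext ω
  exact forall₂_congr fun k hk => by rw [h k hk]

lemma condBlack_congr (θ : Params) {η ζ : Config} {n : ℕ+} (h : ζ ∈ cyl η n) :
    condBlack θ ζ n = condBlack θ η n := by
  rw [condBlack, condBlack, agreeEvent_congr h]

lemma cyl_eq_union (η : Config) (n : ℕ+) :
    cyl η n = cyl (Function.update η n true) (n + 1) ∪ cyl (Function.update η n false) (n + 1) := by
  have hsucc : ∀ k : ℕ+, k < n + 1 ↔ k < n ∨ k = n := fun k => by
    rw [PNat.lt_add_one_iff, le_iff_lt_or_eq]
  ext ζ
  simp only [cyl, Set.mem_union, Set.mem_ofPred_eq]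
  constructor
  · intro h
    have key : ∀ c, ζ n = c → ∀ k < n + 1, ζ k = Function.update η n c k := by
      intro c hc k hk
      rcases (hsucc k).mp hk with h1 | rfl
      · rw [Function.update_of_ne h1.ne, h k h1]
      · simp [hc]
    rcases hc : ζ n with _ | _
    · exact Or.inr (key _ hc)
    · exact Or.inl (key _ hc)
  · rintro (h | h) k hk <;>
    · rw [h k ((hsucc k).mpr (Or.inl hk)), Function.update_of_ne hk.ne]

lemma cyl_disjoint (η : Config) (n : ℕ+) : Disjoint (cyl (Function.update η n true) (n + 1))
    (cyl (Function.update η n false) (n + 1)) := by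
  rw [Set.disjoint_left]
  intro ζ h1 h2
  have e1 := h1 n (PNat.lt_add_right n 1)
  have e2 := h2 n (PNat.lt_add_right n 1)
  simp only [Function.update_self] at e1 e2
  rw [e1] at e2
  exact Bool.noConfusion e2

lemma update_mem_cyl (η : Config) (n : ℕ+) (c : Color) : Function.update η n c ∈ cyl η n :=
  fun _ hk => Function.update_of_ne hk.ne _ _

lemma condBlack_mul (θ : Params) (η : Config) (n : ℕ+) :
    condBlack θ η n * (law θ).real (agreeEvent η n)
      = (law θ).real (agreeEvent η n ∩ blackEvent) := by
  have hN : (n : ℕ) = (n - 1 : ℕ) + 1 := by have := n.pos; omega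
  rw [condBlack_eq θ η hN, law_agreeEvent θ η hN, law_black_agreeEvent θ η hN,
    div_mul_cancel₀ _ (recordProb_pos ..).ne']

lemma law_agreeEvent_pos (θ : Params) (η : Config) (n : ℕ+) :
    0 < (law θ).real (agreeEvent η n) := by
  have hN : (n : ℕ) = (n - 1 : ℕ) + 1 := by have := n.pos; omega
  rw [law_agreeEvent θ η hN]
  exact recordProb_pos ..

lemma condBlack_nonneg (θ : Params) (η : Config) (n : ℕ+) : 0 ≤ condBlack θ η n :=
  measureReal_nonneg

lemma law_agreeEvent_split (θ : Params) (η : Config) (n : ℕ+) (B : Set Sample)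
    (hB : MeasurableSet B) :
    (law θ).real (agreeEvent η n ∩ B)
      = (law θ).real (agreeEvent (Function.update η n true) (n + 1) ∩ B)
        + (law θ).real (agreeEvent (Function.update η n false) (n + 1) ∩ B) := by
  rw [← measureReal_union, ← Set.union_inter_distrib_right]
  · congr 2
    rw [← future_preimage_cyl, cyl_eq_union, Set.preimage_union]
    rfl
  · exact ((cyl_disjoint η n).preimage future).mono Set.inter_subset_left Set.inter_subset_left
  · exact (measurableSet_agreeEvent _ _).inter hB

/-- The value at `n` is a weighted mean of the values at the two one-letter extensions, and both are
close to the value along `η`. -/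
lemma abs_condBlack_succ_sub_le (θ : Params) (h : pStar < θ.p * (1 - θ.ε)) (η : Config) (n : ℕ+) :
    |condBlack θ η n - condBlack θ η (n + 1)| ≤ rate θ ^ (n : ℕ) / (1 - rate θ) := by
  set r := rate θ ^ (n : ℕ) / (1 - rate θ)
  set v := condBlack θ η (n + 1)
  have child : ∀ c, |(law θ).real (agreeEvent (Function.update η n c) (n + 1) ∩ blackEvent)
      - v * (law θ).real (agreeEvent (Function.update η n c) (n + 1))|
      ≤ r * (law θ).real (agreeEvent (Function.update η n c) (n + 1)) := by
    intro c
    rw [← condBlack_mul, ← sub_mul, abs_mul, abs_of_pos (law_agreeEvent_pos ..)]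
    refine mul_le_mul_of_nonneg_right ?_ (law_agreeEvent_pos ..).le
    rw [abs_sub_comm]
    exact abs_condBlack_sub_le θ h (PNat.lt_add_right n 1) (update_mem_cyl η n c)
  have s1 := law_agreeEvent_split θ η n blackEvent measurableSet_blackEvent
  have s2 := law_agreeEvent_split θ η n Set.univ MeasurableSet.univ
  simp only [Set.inter_univ] at s2
  have hp := law_agreeEvent_pos θ η n
  rw [← condBlack_mul] at s1
  have : |(condBlack θ η n - v) * (law θ).real (agreeEvent η n)|
      ≤ r * (law θ).real (agreeEvent η n) := by
    rw [sub_mul, s1, s2, mul_add, mul_add, add_sub_add_comm]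
    exact (abs_add_le _ _).trans (add_le_add (child true) (child false))
  rw [abs_mul, abs_of_pos hp] at this
  exact le_of_mul_le_mul_right this hp

lemma continuous_condBlack (θ : Params) (n : ℕ+) : Continuous fun η => condBlack θ η n := by
  have : (fun η => condBlack θ η n)
      = (fun r : {k : ℕ+ // k < n} → Color =>
          condBlack θ (fun k => if h : k < n then r ⟨k, h⟩ else black) n) ∘
        fun η k => η k.1 := by
    funext η
    refine (condBlack_congr θ fun k hk => ?_).symm
    simp [hk]
  rw [this]
  have : Finite {k : ℕ+ // k < n} := (Set.finite_Iio n).to_subtype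
  exact continuous_of_discreteTopology.comp (continuous_pi fun k => continuous_apply _)

/-- The values form a Cauchy sequence with geometric rate uniform in the record, and each depends on
finitely many letters; the uniform limit is continuous. -/
lemma exists_limit_condBlack (θ : Params) (h : pStar < θ.p * (1 - θ.ε)) :
    ∃ V : Config → ℝ, Continuous V ∧ (∀ η, 0 ≤ V η) ∧ ∃ C, ∀ η (n : ℕ),
      |condBlack θ η n.succPNat - V η| ≤ C * rate θ ^ n := by
  have h1 := rate_lt_one θ h
  have h0 := rate_nonneg θ
  have hd : ∀ η (n : ℕ), dist (condBlack θ η n.succPNat) (condBlack θ η (n + 1).succPNat)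
      ≤ (1 - rate θ)⁻¹ * rate θ ^ n := by
    intro η n
    refine (abs_condBlack_succ_sub_le θ h η n.succPNat).trans ?_
    rw [div_eq_inv_mul]
    refine mul_le_mul_of_nonneg_left ?_ (inv_nonneg.mpr (sub_pos.mpr h1).le)
    exact pow_le_pow_of_le_one h0 h1.le (by simp)
  choose V hV using fun η => cauchySeq_tendsto_of_complete
    (cauchySeq_of_le_geometric _ _ h1 (hd η))
  have hdist : ∀ η (n : ℕ), |condBlack θ η n.succPNat - V η|
      ≤ ((1 - rate θ)⁻¹ / (1 - rate θ)) * rate θ ^ n := by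
    intro η n
    have := dist_le_of_le_geometric_of_tendsto _ _ h1 (hd η) (hV η) n
    rw [Real.dist_eq] at this
    refine this.trans (le_of_eq (by ring))
  refine ⟨V, ?_, fun η => ge_of_tendsto' (hV η) fun n => condBlack_nonneg .., _, hdist⟩
  have hunif : TendstoUniformly (fun (n : ℕ) η => condBlack θ η n.succPNat) V atTop := by
    rw [Metric.tendstoUniformly_iff]
    intro e he
    have ht : Tendsto (fun n : ℕ => ((1 - rate θ)⁻¹ / (1 - rate θ)) * rate θ ^ n) atTop (𝓝 0) := by
      simpa using (tendsto_pow_atTop_nhds_zero_of_lt_one h0 h1).const_mul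
        ((1 - rate θ)⁻¹ / (1 - rate θ))
    filter_upwards [ht.eventually_lt_const he] with n hn η
    rw [dist_comm, Real.dist_eq]
    exact (hdist η n).trans_lt hn
  exact hunif.continuous (Frequently.of_forall fun n => continuous_condBlack θ _)

/-- A uniform limit of the conditional probabilities is a density on the level of cylinders. -/
lemma setIntegral_cyl (θ : Params) {V : Config → ℝ} (hV : Integrable V ((law θ).map future))
    {C r : ℝ} (hr0 : 0 ≤ r) (hr1 : r < 1)
    (h : ∀ η (n : ℕ), |condBlack θ η n.succPNat - V η| ≤ C * r ^ n) (η : Config) (n : ℕ) :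
    ∫ ζ in cyl η n.succPNat, V ζ ∂((law θ).map future)
      = (law θ).real (agreeEvent η n.succPNat ∩ blackEvent) := by
  have hmap : ∀ η n, ((law θ).map future).real (cyl η n) = (law θ).real (agreeEvent η n) :=
    fun η n => map_measureReal_apply measurable_future (measurableSet_cyl η n)
  have : IsProbabilityMeasure ((law θ).map future) :=
    Measure.isProbabilityMeasure_map measurable_future.aemeasurable
  -- Splitting the cylinder `d` times refines it to depth `n + d`, where the approximation error is
  -- `C * r ^ (n + d)` on every piece.
  have approx : ∀ d n η, |∫ ζ in cyl η n.succPNat, V ζ ∂((law θ).map future)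
      - (law θ).real (agreeEvent η n.succPNat ∩ blackEvent)|
      ≤ C * r ^ (n + d) * (law θ).real (agreeEvent η n.succPNat) := by
    intro d
    induction d with
    | zero =>
      intro n η
      rw [← condBlack_mul, ← hmap, ← smul_eq_mul (b := ((law θ).map future).real _), ]
      have e : condBlack θ η n.succPNat • ((law θ).map future).real (cyl η n.succPNat)
          = ∫ ζ in cyl η n.succPNat, condBlack θ η n.succPNat ∂((law θ).map future) := by
        rw [setIntegral_const, smul_eq_mul, smul_eq_mul, mul_comm]
      rw [e, ← integral_sub hV.integrableOn (integrable_const _), ← Real.norm_eq_abs]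
      refine norm_setIntegral_le_of_norm_le_const (measure_lt_top _ _) fun ζ hζ => ?_
      rw [Real.norm_eq_abs, abs_sub_comm, ← condBlack_congr θ hζ]
      exact h ζ n
    | succ d ih =>
      intro n η
      have s1 := law_agreeEvent_split θ η n.succPNat blackEvent measurableSet_blackEvent
      have s2 := law_agreeEvent_split θ η n.succPNat Set.univ MeasurableSet.univ
      simp only [Set.inter_univ] at s2
      rw [cyl_eq_union, setIntegral_union (cyl_disjoint ..) (measurableSet_cyl ..)
        hV.integrableOn hV.integrableOn, s1, s2, add_sub_add_comm, mul_add]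
      refine (abs_add_le _ _).trans (add_le_add ?_ ?_)
      · have := ih (n + 1) (Function.update η n.succPNat true)
        rwa [show n + 1 + d = n + (d + 1) by ring] at this
      · have := ih (n + 1) (Function.update η n.succPNat false)
        rwa [show n + 1 + d = n + (d + 1) by ring] at this
  have hlim : Tendsto (fun d : ℕ => C * r ^ (n + d) * (law θ).real (agreeEvent η n.succPNat))
      atTop (𝓝 0) := by
    have h1 : Tendsto (fun d : ℕ => r ^ (n + d)) atTop (𝓝 0) := by
      simp_rw [add_comm n]
      exact (tendsto_add_atTop_iff_nat n).mpr (tendsto_pow_atTop_nhds_zero_of_lt_one hr0 hr1)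
    simpa using (h1.const_mul C).mul_const ((law θ).real (agreeEvent η n.succPNat))
  have := ge_of_tendsto' hlim fun d => approx d n η
  exact sub_eq_zero.mp (abs_eq_zero.mp (le_antisymm this (abs_nonneg _)))

/-- Both measures agree on cylinders, hence on all initial segments of times. Every finite set of
times lies in such a segment, so uniqueness of projective limits applies. -/
lemma map_restrict_eq (θ : Params) {V : Config → ℝ} (hV : Integrable V ((law θ).map future))
    (hV0 : ∀ η, 0 ≤ V η)
    (h : ∀ η (n : ℕ), ∫ ζ in cyl η n.succPNat, V ζ ∂((law θ).map future)
      = (law θ).real (agreeEvent η n.succPNat ∩ blackEvent)) :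
    (((law θ).restrict blackEvent).map future)
      = ((law θ).map future).withDensity fun η => ENNReal.ofReal (V η) := by
  have hcyl : ∀ η (n : ℕ), (((law θ).restrict blackEvent).map future) (cyl η n.succPNat)
      = (((law θ).map future).withDensity fun η => ENNReal.ofReal (V η)) (cyl η n.succPNat) := by
    intro η n
    rw [withDensity_apply _ (measurableSet_cyl ..), ← ofReal_integral_eq_lintegral_ofReal
      hV.integrableOn (Eventually.of_forall hV0), h,
      Measure.map_apply measurable_future (measurableSet_cyl ..), Measure.restrict_apply
      (measurable_future (measurableSet_cyl ..)), ofReal_measureReal]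
    rfl
  have : IsFiniteMeasure (((law θ).map future).withDensity fun η => ENNReal.ofReal (V η)) :=
    isFiniteMeasure_withDensity_ofReal hV.2
  have hIio : ∀ n : ℕ, (((law θ).restrict blackEvent).map future).map
        (Finset.restrict (π := fun _ : ℕ+ => Color) (Finset.Iio n.succPNat))
      = (((law θ).map future).withDensity fun η => ENNReal.ofReal (V η)).map
        (Finset.restrict (π := fun _ : ℕ+ => Color) (Finset.Iio n.succPNat)) := by
    intro n
    refine Measure.ext_of_singleton fun r => ?_
    rw [Measure.map_apply (Finset.measurable_restrict _) (measurableSet_singleton _),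
      Measure.map_apply (Finset.measurable_restrict _) (measurableSet_singleton _)]
    have : Finset.restrict (π := fun _ : ℕ+ => Color) (Finset.Iio n.succPNat) ⁻¹' {r}
        = cyl (fun k => if h : k ∈ Finset.Iio n.succPNat then r ⟨k, h⟩ else black) n.succPNat := by
      ext ζ
      simp only [Set.mem_preimage, Set.mem_singleton_iff, cyl, Set.mem_ofPred_eq, funext_iff]
      constructor
      · intro h k hk
        rw [dif_pos (Finset.mem_Iio.mpr hk)]
        exact h ⟨k, Finset.mem_Iio.mpr hk⟩
      · rintro h ⟨k, hk⟩
        have := h k (Finset.mem_Iio.mp hk)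
        rwa [dif_pos hk] at this
    rw [this]
    exact hcyl _ n
  refine IsProjectiveLimit.unique (P := fun I => (((law θ).map future).withDensity
    fun η => ENNReal.ofReal (V η)).map (Finset.restrict (π := fun _ : ℕ+ => Color) I)) ?_
    (fun I => rfl)
  intro I
  obtain ⟨n, hn⟩ : ∃ n : ℕ, I ⊆ Finset.Iio n.succPNat := by
    refine ⟨∑ k ∈ I, (k : ℕ), fun k hk => Finset.mem_Iio.mpr ?_⟩
    rw [← PNat.coe_lt_coe, Nat.succPNat_coe, Nat.lt_succ_iff]
    exact single_le_sum (f := fun k : ℕ+ => (k : ℕ)) (fun _ _ => Nat.zero_le _) hk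
  have e : Finset.restrict (π := fun _ : ℕ+ => Color) I
      = Finset.restrict₂ hn ∘ Finset.restrict (Finset.Iio n.succPNat) := rfl
  beta_reduce
  rw [e, ← Measure.map_map (Finset.measurable_restrict₂ _) (Finset.measurable_restrict _),
    ← Measure.map_map (Finset.measurable_restrict₂ _) (Finset.measurable_restrict _), hIio]

lemma exists_continuous_version (θ : Params) (h : pStar < θ.p * (1 - θ.ε)) :
    ∃ V : Config → ℝ, IsVersion θ V ∧ Continuous V := by
  obtain ⟨V, hVc, hV0, C, hC⟩ := exists_limit_condBlack θ h
  have hprob : IsProbabilityMeasure ((law θ).map future) :=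
    Measure.isProbabilityMeasure_map measurable_future.aemeasurable
  have hVm : Measurable V := hVc.measurable
  have hVi : Integrable V ((law θ).map future) := by
    obtain ⟨K, hK⟩ := isCompact_univ.exists_bound_of_continuousOn hVc.continuousOn
    exact Integrable.of_bound hVm.aestronglyMeasurable K
      (Eventually.of_forall fun η => hK η (Set.mem_univ _))
  have hdens := map_restrict_eq θ hVi hV0
    (setIntegral_cyl θ hVi (rate_nonneg θ) (rate_lt_one θ h) hC)
  have hVf : Integrable (fun ω => V (future ω)) (law θ) :=
    hVi.comp_measurable measurable_future
  refine ⟨V, ⟨hVm, ?_⟩, hVc⟩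
  have hle : MeasurableSpace.comap future inferInstance ≤ (inferInstance : MeasurableSpace Sample) :=
    measurable_future.comap_le
  refine ae_eq_condExp_of_forall_setIntegral_eq hle
    ((integrable_const (1 : ℝ)).indicator measurableSet_blackEvent)
    (fun _ _ _ => hVf.integrableOn) ?_ ?_
  · rintro _ ⟨t, ht, rfl⟩ -
    have e1 : ∫ ω in future ⁻¹' t, V (future ω) ∂(law θ)
        = ∫ η in t, V η ∂((law θ).map future) :=
      (setIntegral_map ht hVm.aestronglyMeasurable measurable_future.aemeasurable).symm
    rw [e1, setIntegral_indicator measurableSet_blackEvent, setIntegral_const, smul_eq_mul,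
      mul_one]
    have e2 := congrArg (fun μ => μ t) hdens
    simp only [withDensity_apply _ ht] at e2
    rw [← ofReal_integral_eq_lintegral_ofReal hVi.integrableOn (Eventually.of_forall hV0),
      Measure.map_apply measurable_future ht, Measure.restrict_apply (measurable_future ht)] at e2
    rw [Measure.real, e2, ENNReal.toReal_ofReal (integral_nonneg hV0)]
  · have : Measurable[MeasurableSpace.comap future inferInstance] fun ω => V (future ω) :=
      hVm.comp (comap_measurable future)
    exact this.stronglyMeasurable.aestronglyMeasurable

/-- The parameter region with a continuous conditional probability. -/
lemma exists_open_region : ∃ U : Set (ℝ × ℝ), IsOpen U ∧ ((1 : ℝ), (0 : ℝ)) ∈ U ∧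
    Set.Ioc pStar 1 ×ˢ {(0 : ℝ)} ⊆ U ∧ ∀ θ : Params, (θ.p, θ.ε) ∈ U →
      badSet θ = ∅ ∧ ∃ V : Config → ℝ, IsVersion θ V ∧ Continuous V := by
  -- The region is where the step `+1` has probability above `p_*`; on the line `ε = 0` this reads
  -- `p > p_*`.
  refine ⟨{x | pStar < x.1 * (1 - x.2)}, isOpen_lt continuous_const (by fun_prop), ?_, ?_, ?_⟩
  · simp only [Set.mem_ofPred_eq, pStar]
    norm_num
  · rintro ⟨x, y⟩ ⟨hx, hy⟩
    simp only [Set.mem_singleton_iff, Set.mem_Ioc] at hx hy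
    simp [hy, hx.1]
  · exact fun θ hθ => ⟨badSet_eq_empty θ hθ, exists_continuous_version θ hθ⟩

end RWRS

/-! ### Walks without holding: removal of the first step, and constraints from reading. -/

namespace RWRS

open Finset

/-- The step sequence that starts with `d` and continues with `v`. -/
def stepCons (d : ℤ) (v : ℕ → ℤ) (i : ℕ) : ℤ := if i = 0 then d else v (i - 1)

lemma walk_stepCons (d : ℤ) (v : ℕ → ℤ) (j : ℕ) : walk (stepCons d v) (1 + j) = d + walk v j := by
  rw [walk, sum_range_add]
  congr 1
  · simp [stepCons]
  · exact sum_congr rfl fun i _ => by simp [stepCons]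

lemma sum_paths_one_add (θ : Params) (hε : θ.ε = 0) (l : ℕ) (h : (ℕ → ℤ) → ℝ) :
    ∑ s ∈ paths (1 + l), weight θ (1 + l) s * h s
      = ∑ v ∈ paths l, weight θ l v * (θ.p * h (stepCons 1 v) + (1 - θ.p) * h (stepCons (-1) v)) := by
  rw [sum_paths_add]
  have hc : ∀ u v, concat 1 u v = stepCons (u 0) v := by
    intro u v
    funext i
    rcases Nat.eq_zero_or_pos i with rfl | hi
    · simp [concat, stepCons]
    · simp [concat, stepCons, show i ≠ 0 by omega]
  have hp : ∀ f : ℤ → ℝ, ∑ u ∈ paths 1, f (u 0) = ∑ d ∈ stepSet, f d := by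
    intro f
    refine sum_nbij' (fun u => u 0) (fun d i => if i = 0 then d else 0) ?_ ?_ ?_ ?_ ?_
    · intro u hu
      exact (mem_paths.mp hu).1 0 (by omega)
    · intro d hd
      rw [mem_paths]
      refine ⟨fun i hi => by rw [if_pos (by omega)]; exact hd, fun i hi => if_neg (by omega)⟩
    · intro u hu
      funext i
      rcases Nat.eq_zero_or_pos i with rfl | hi
      · simp
      · simp [show i ≠ 0 by omega, (mem_paths.mp hu).2 i hi]
    · simp
    · simp
  have h1 : ∀ u ∈ paths 1, (∑ v ∈ paths l, weight θ (1 + l) (concat 1 u v) * h (concat 1 u v))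
      = stepProb θ (u 0) * ∑ v ∈ paths l, weight θ l v * h (stepCons (u 0) v) := by
    intro u _
    rw [mul_sum]
    refine sum_congr rfl fun v _ => ?_
    rw [weight_concat, hc]
    simp [weight, mul_assoc]
  rw [sum_congr rfl h1, hp fun d => stepProb θ d * ∑ v ∈ paths l, weight θ l v * h (stepCons d v)]
  simp only [stepSet, stepProb_eq, hε]
  simp only [Int.reduceNeg, mem_insert, mem_singleton, sum_insert, sum_singleton, reduceCtorEq,
    neg_eq_zero, one_ne_zero, zero_ne_one, or_self, not_false_eq_true]
  norm_num
  rw [mul_sum, mul_sum, ← sum_add_distrib]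
  exact sum_congr rfl fun v _ => by ring

/-- Probability that the scenery is black at `z` and shows the letters `a` along the path `v`. -/
noncomputable def blackFit (l : ℕ) (v : ℕ → ℤ) (a : ℕ → Color) (z : ℤ) : ℝ :=
  sceneryLaw.real {c | c z = black ∧ ∀ j ∈ range (l + 1), c (walk v j) = a j}

lemma blackFit_nonneg (l : ℕ) (v : ℕ → ℤ) (a : ℕ → Color) (z : ℤ) : 0 ≤ blackFit l v a z :=
  measureReal_nonneg

lemma blackFit_le (l : ℕ) (v : ℕ → ℤ) (a : ℕ → Color) (z : ℤ) :
    blackFit l v a z ≤ fit (walk v) a (range (l + 1)) :=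
  measureReal_mono fun _ hc => hc.2

lemma blackFit_eq_fit (l : ℕ) (v : ℕ → ℤ) (a : ℕ → Color) (z : ℤ) : blackFit l v a z
    = fit (fun j => if j = 0 then z else walk v (j - 1))
        (fun j => if j = 0 then black else a (j - 1)) (range (1 + l + 1)) := by
  rw [blackFit, fit]
  congr 1
  ext c
  simp only [Set.mem_ofPred_eq, mem_range]
  constructor
  · rintro ⟨h1, h2⟩ j hj
    split_ifs with h0
    · exact h1
    · exact h2 (j - 1) (by omega)
  · intro h
    refine ⟨by simpa using h 0 (by omega), fun j hj => ?_⟩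
    simpa using h (j + 1) (by omega)

/-- With the site of time 1 as origin, the first step has no influence on the letters from time 1
on. -/
lemma recordProb_eq_tail (θ : Params) (hε : θ.ε = 0) (l : ℕ) (a : ℕ → Color) :
    recordProb θ (1 + l) a (Icc 1 (1 + l))
      = ∑ v ∈ paths l, weight θ l v * fit (walk v) (fun j => a (1 + j)) (range (l + 1)) := by
  rw [recordProb, sum_paths_one_add θ hε]
  refine sum_congr rfl fun v _ => ?_
  have : ∀ d, fit (walk (stepCons d v)) a (Icc 1 (1 + l))
      = fit (walk v) (fun j => a (1 + j)) (range (l + 1)) := by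
    intro d
    rw [← fit_comp (add_right_injective d) (walk v)]
    rw [fit, fit]
    congr 1
    ext c
    simp only [Set.mem_ofPred_eq, mem_range, mem_Icc]
    constructor
    · intro h j hj
      rw [← walk_stepCons]
      exact h _ (by omega)
    · intro h j hj
      have := h (j - 1) (by omega)
      rwa [← walk_stepCons, show 1 + (j - 1) = j by omega] at this
  rw [this, this]
  ring

/-- Seen from the site of time 1, the site of time 0 is `-d` when the first step is `d`. -/
lemma recordProb_eq_tail_black (θ : Params) (hε : θ.ε = 0) (l : ℕ) {a : ℕ → Color}
    (ha : a 0 = black) :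
    recordProb θ (1 + l) a (range (1 + l + 1))
      = ∑ v ∈ paths l, weight θ l v * (θ.p * blackFit l v (fun j => a (1 + j)) (-1)
        + (1 - θ.p) * blackFit l v (fun j => a (1 + j)) 1) := by
  rw [recordProb, sum_paths_one_add θ hε]
  refine sum_congr rfl fun v _ => ?_
  have : ∀ d, fit (walk (stepCons d v)) a (range (1 + l + 1))
      = blackFit l v (fun j => a (1 + j)) (-d) := by
    intro d
    rw [blackFit_eq_fit, ← fit_comp (add_right_injective d) (fun j => if j = 0 then -d else _)]
    refine fit_congr (fun j _ => ?_) fun j _ => ?_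
    · split_ifs with h
      · simp [h]
      · rw [← walk_stepCons, show 1 + (j - 1) = j by omega]
    · split_ifs with h
      · rw [h, ha]
      · rw [show 1 + (j - 1) = j by omega]
  rw [this, this, neg_neg]

/-- The walk and some scenery produce the letters `a 0, …, a l`; all steps are `1` or `-1`. -/
def Reads (l : ℕ) (a : ℕ → Color) (v : ℕ → ℤ) : Prop :=
  (∀ i < l, v i = 1 ∨ v i = -1) ∧ ∃ c : ℤ → Color, ∀ j ≤ l, c (walk v j) = a j

lemma reads_of_ne_zero {θ : Params} (hε : θ.ε = 0) {l : ℕ} {a : ℕ → Color} {v : ℕ → ℤ}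
    (hv : v ∈ paths l) (h : weight θ l v * fit (walk v) a (range (l + 1)) ≠ 0) : Reads l a v := by
  refine ⟨fun i hi => ?_, ?_⟩
  · have h1 : stepProb θ (v i) ≠ 0 :=
      prod_ne_zero_iff.mp (left_ne_zero_of_mul h) i (mem_range.mpr hi)
    rcases mem_stepSet.mp ((mem_paths.mp hv).1 i hi) with h2 | h2 | h2
    · exact Or.inr h2
    · rw [h2, stepProb_eq, hε] at h1
      simp at h1
    · exact Or.inl h2
  · obtain ⟨c, hc⟩ := exists_of_fit_ne_zero (right_ne_zero_of_mul h)
    exact ⟨c, fun j hj => hc j (mem_range.mpr (by omega))⟩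

namespace Reads

variable {l : ℕ} {a : ℕ → Color} {v : ℕ → ℤ}

lemma letter_eq (h : Reads l a v) {i j : ℕ} (hi : i ≤ l) (hj : j ≤ l)
    (hw : walk v i = walk v j) : a i = a j := by
  obtain ⟨-, c, hc⟩ := h
  rw [← hc i hi, ← hc j hj, hw]

/-- A walk that reverses its step is back at the same site two time units later and reads the same
letter. -/
lemma step_succ_eq (h : Reads l a v) {j : ℕ} (hj : j + 2 ≤ l) (ha : a j ≠ a (j + 2)) :
    v (j + 1) = v j := by
  by_contra hne
  refine ha (h.letter_eq (by omega) hj ?_)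
  rw [walk_succ, walk_succ]
  have h1 := h.1 j (by omega)
  have h2 := h.1 (j + 1) (by omega)
  omega

lemma straight (h : Reads l a v) {t L : ℕ} (hL : t + L ≤ l)
    (ha : ∀ i, i + 2 ≤ L → a (t + i) ≠ a (t + i + 2)) : ∀ i < L, v (t + i) = v t := by
  intro i
  induction i with
  | zero => intro _; rfl
  | succ i ih =>
    intro hi
    rw [← ih (by omega), ← add_assoc]
    exact h.step_succ_eq (by omega) (ha i (by omega))

end Reads

lemma walk_straight {v : ℕ → ℤ} {t L : ℕ} {d : ℤ} (h : ∀ i < L, v (t + i) = d) :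
    ∀ i ≤ L, walk v (t + i) = walk v t + d * i := by
  intro i
  induction i with
  | zero => intro _; simp
  | succ i ih =>
    intro hi
    rw [← add_assoc, walk_succ, ih (by omega), h i (by omega)]
    push_cast
    ring

/-- A path does not go straight through a site where the letters before and after agree, if it
also goes straight through this site at a time when they differ. -/
lemma Reads.not_straight {l : ℕ} {a : ℕ → Color} {v : ℕ → ℤ} (h : Reads l a v) {t u : ℕ}
    (ht : t + 2 ≤ l) (hu : u + 2 ≤ l) (hat : a t = a (t + 2)) (hau : a u ≠ a (u + 2))
    (hw : walk v (t + 1) = walk v (u + 1)) : v (t + 1) ≠ v t := by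
  intro hs
  have hs' := h.step_succ_eq hu hau
  have h1 := h.1 t (by omega)
  have h2 := h.1 u (by omega)
  have w1 := walk_succ v t
  have w2 := walk_succ v u
  have w3 : walk v (t + 2) = walk v (t + 1) + v (t + 1) := walk_succ v (t + 1)
  have w4 : walk v (u + 2) = walk v (u + 1) + v (u + 1) := walk_succ v (u + 1)
  by_cases hd : v t = v u
  · refine hau ?_
    rw [h.letter_eq (i := u) (j := t) (by omega) (by omega) (by omega),
      h.letter_eq (i := u + 2) (j := t + 2) (by omega) (by omega) (by omega), hat]
  · refine hau ?_
    rw [h.letter_eq (i := u) (j := t + 2) (by omega) (by omega) (by omega),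
      h.letter_eq (i := u + 2) (j := t) (by omega) (by omega) (by omega), hat]

lemma le_card_image_of_straight {v : ℕ → ℤ} {l t L : ℕ} {d : ℤ} (hd : d = 1 ∨ d = -1)
    (hL : t + L ≤ l) (h : ∀ i < L, v (t + i) = d) :
    L + 1 ≤ #((range (l + 1)).image (walk v)) := by
  have hsub : (range (L + 1)).image (fun i => walk v (t + i)) ⊆ (range (l + 1)).image (walk v) := by
    intro z hz
    obtain ⟨i, hi, rfl⟩ := mem_image.mp hz
    rw [mem_range] at hi
    exact mem_image_of_mem _ (mem_range.mpr (by omega))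
  refine le_trans (le_of_eq ?_) (card_le_card hsub)
  rw [card_image_of_injOn, card_range]
  intro i hi j hj hij
  simp only [coe_range, Set.mem_Iio] at hi hj
  simp only [walk_straight h i (by omega), walk_straight h j (by omega)] at hij
  rcases hd with rfl | rfl <;> omega

/-- A walk with steps `±1` visits every site between `0` and its end point. -/
lemma walk_lt_card_image {v : ℕ → ℤ} {l : ℕ} (h : ∀ i < l, v i = 1 ∨ v i = -1) :
    walk v l < #((range (l + 1)).image (walk v)) := by
  have hsub : ∀ n ≤ l, ∀ z, 0 ≤ z → z ≤ walk v n → z ∈ (range (l + 1)).image (walk v) := by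
    intro n
    induction n with
    | zero =>
      intro _ z h0 h1
      exact mem_image.mpr ⟨0, by simp, by simp at h1 ⊢; omega⟩
    | succ n ih =>
      intro hn z h0 h1
      rcases h1.lt_or_eq with h2 | h2
      · refine ih (by omega) z h0 ?_
        rw [walk_succ] at h2
        rcases h n (by omega) with h3 | h3 <;> omega
      · exact mem_image.mpr ⟨n + 1, mem_range.mpr (by omega), h2.symm⟩
  rcases lt_or_ge (walk v l) 0 with h0 | h0
  · exact lt_of_lt_of_le h0 (by positivity)
  · have h1 : Icc 0 (walk v l) ⊆ (range (l + 1)).image (walk v) := fun z hz =>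
      hsub l le_rfl z (mem_Icc.mp hz).1 (mem_Icc.mp hz).2
    have h2 := card_le_card h1
    rw [Int.card_Icc] at h2
    omega

/-- Each step contributes `A` and a factor `r` or `r⁻¹`, so only the length and the end point
matter. -/
lemma weight_eq_zpow {θ : Params} {A r : ℝ} (hr : r ≠ 0) (h1 : stepProb θ 1 = A * r)
    (h2 : stepProb θ (-1) = A * r⁻¹) {l : ℕ} {v : ℕ → ℤ} (h : ∀ i < l, v i = 1 ∨ v i = -1) :
    weight θ l v = A ^ l * r ^ walk v l := by
  induction l with
  | zero => simp [weight]
  | succ l ih =>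
    have e : weight θ (l + 1) v = weight θ l v * stepProb θ (v l) := by
      simp [weight, prod_range_succ]
    rw [e, ih fun i hi => h i (by omega), walk_succ, zpow_add₀ hr, pow_succ]
    rcases h l (by omega) with h3 | h3
    · rw [h3, h1, zpow_one]; ring
    · rw [h3, h2, zpow_neg_one]; ring

/-! ### Alternating sceneries and zigzag continuations. -/

/-- Every site has one neighbor of each color. -/
def IsAlternating (e : ℤ → Color) : Prop := ∀ z, e (z + 2) = !e z

lemma IsAlternating.neg {e : ℤ → Color} (he : IsAlternating e) : IsAlternating fun z => e (-z) := by
  intro z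
  have := he (-z - 2)
  rw [show -z - 2 + 2 = -z by ring] at this
  simp only [show -(z + 2) = -z - 2 by ring, this, Bool.not_not]

lemma IsAlternating.ne {e : ℤ → Color} (he : IsAlternating e) {z w : ℤ} (h : w = z + 2) :
    e z ≠ e w := by
  rw [h, he z]
  cases e z <;> simp

lemma exists_isAlternating (b : Color) : ∃ e, IsAlternating e ∧ e 0 = b := by
  refine ⟨fun z => if z % 4 = 0 ∨ z % 4 = 1 then b else !b, fun z => ?_, by simp⟩
  beta_reduce
  by_cases h : z % 4 = 0 ∨ z % 4 = 1
  · rw [if_pos h, if_neg (by omega)]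
  · rw [if_neg h, if_pos (by omega), Bool.not_not]

/-- From time `M` on, the letters `a` are those of a zigzag walk in the scenery `e` that starts
from `0`: first `M + 1` steps to the left, then three long legs. -/
structure IsZigzag (M Λ : ℕ) (e : ℤ → Color) (a : ℕ → Color) : Prop where
  leg₁ : ∀ i ≤ M + 1, a (M + i) = e (-i)
  leg₂ : ∀ i ≤ Λ, a (2 * M + 1 + i) = e (-(M + 1) + i)
  leg₃ : ∀ i ≤ Λ + 1, a (2 * M + 1 + Λ + i) = e (Λ - (M + 1) - i)
  leg₄ : ∀ i ≤ Λ + 1, a (2 * M + 2 + 2 * Λ + i) = e (-(M + 2) + i)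

lemma exists_isZigzag (M Λ : ℕ) (e : ℤ → Color) (b : ℕ → Color) (hb : b M = e 0) :
    ∃ a, IsZigzag M Λ e a ∧ ∀ j ≤ M, a j = b j := by
  refine ⟨fun j => if j ≤ M then b j else if j ≤ 2 * M + 1 then e (M - j)
    else if j ≤ 2 * M + 1 + Λ then e (j - (3 * M + 2))
    else if j ≤ 2 * M + 2 + 2 * Λ then e (2 * Λ + M - j)
    else e (j - (3 * M + 4 + 2 * Λ)), ⟨?_, ?_, ?_, ?_⟩, fun j hj => if_pos hj⟩
  · intro i hi
    rcases Nat.eq_zero_or_pos i with rfl | h0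
    · simp [hb]
    · rw [if_neg (by omega), if_pos (by omega)]
      congr 1
      push_cast
      ring
  · intro i hi
    rw [if_neg (by omega)]
    split_ifs <;> (congr 1; omega)
  · intro i hi
    rw [if_neg (by omega)]
    split_ifs <;> (congr 1; omega)
  · intro i hi
    rw [if_neg (by omega), if_neg (by omega)]
    split_ifs <;> (congr 1; omega)

/-- The path read backwards from the letters `a M, a (M - 1), …` in the scenery `e`. -/
def back (e : ℤ → Color) (a : ℕ → Color) (M : ℕ) : ℕ → ℤ
  | 0 => 0
  | k + 1 => if e (back e a M k + 1) = a (M - (k + 1)) then back e a M k + 1 else back e a M k - 1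

lemma back_succ (e : ℤ → Color) (a : ℕ → Color) (M k : ℕ) :
    back e a M (k + 1) = back e a M k + 1 ∨ back e a M (k + 1) = back e a M k - 1 := by
  rw [back]
  split_ifs <;> simp

lemma abs_back_le (e : ℤ → Color) (a : ℕ → Color) (M k : ℕ) : |back e a M k| ≤ k := by
  induction k with
  | zero => simp [back]
  | succ k ih =>
    rw [abs_le] at *
    push_cast
    rcases back_succ e a M k with h | h <;> omega

lemma back_congr {e : ℤ → Color} {a b : ℕ → Color} {M : ℕ} (h : ∀ j ≤ M, a j = b j) (k : ℕ) :
    back e a M k = back e b M k := by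
  induction k with
  | zero => rfl
  | succ k ih => rw [back, back, ih, h _ (Nat.sub_le _ _)]

lemma IsAlternating.back_neg {e : ℤ → Color} (he : IsAlternating e) (a : ℕ → Color) (M k : ℕ) :
    back (fun z => e (-z)) a M k = -back e a M k := by
  induction k with
  | zero => rfl
  | succ k ih =>
    rw [back, back, ih]
    have := he.ne (z := back e a M k - 1) (w := back e a M k + 1) (by ring)
    rw [show -(-back e a M k + 1) = back e a M k - 1 by ring]
    revert this
    generalize e (back e a M k - 1) = x
    generalize e (back e a M k + 1) = y
    generalize a (M - (k + 1)) = z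
    cases x <;> cases y <;> cases z <;> simp <;> ring

/-- Exactly one neighbor of the current site has the color of the preceding letter, so going back in
time leaves no choice. -/
lemma IsAlternating.back_unique {e : ℤ → Color} (he : IsAlternating e) {a : ℕ → Color} {M : ℕ}
    {y : ℕ → ℤ} (hM : y M = 0) (hstep : ∀ j < M, y j = y (j + 1) + 1 ∨ y j = y (j + 1) - 1)
    (hread : ∀ j ≤ M, e (y j) = a j) : ∀ k ≤ M, y (M - k) = back e a M k := by
  intro k
  induction k with
  | zero => intro _; simpa [back] using hM
  | succ k ih =>
    intro hk
    have h1 := ih (by omega)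
    have h2 := hstep (M - (k + 1)) (by omega)
    rw [show M - (k + 1) + 1 = M - k by omega, h1] at h2
    have h3 := hread (M - (k + 1)) (by omega)
    have := he.ne (z := back e a M k - 1) (w := back e a M k + 1) (by ring)
    rw [back]
    rcases h2 with h2 | h2
    · rw [h2] at h3 ⊢
      rw [if_pos h3]
    · rw [h2] at h3 ⊢
      rw [if_neg]
      rw [← h3]
      exact this.symm

lemma IsAlternating.read_back {e : ℤ → Color} (he : IsAlternating e) {a : ℕ → Color} {M : ℕ}
    (h0 : a M = e 0) : ∀ k ≤ M, e (back e a M k) = a (M - k) := by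
  intro k
  cases k with
  | zero => intro _; simp [back, h0]
  | succ k =>
    intro _
    have := he.ne (z := back e a M k - 1) (w := back e a M k + 1) (by ring)
    rw [back]
    split_ifs with h
    · exact h
    · revert this h
      generalize e (back e a M k - 1) = x
      generalize e (back e a M k + 1) = y
      generalize a (M - (k + 1)) = z
      cases x <;> cases y <;> cases z <;> simp

/-- A path that turns between any two consecutive legs; `τ` is the direction of the last leg. -/
def Turns (M Λ : ℕ) (τ : ℤ) (v : ℕ → ℤ) : Prop :=
  v M = -τ ∧ v (2 * M + 1) = τ ∧ v (2 * M + 1 + Λ) = -τ ∧ v (2 * M + 2 + 2 * Λ) = τ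

section Zigzag

variable {M Λ : ℕ} {e : ℤ → Color} {a : ℕ → Color} {v : ℕ → ℤ}

lemma IsZigzag.steps (hz : IsZigzag M Λ e a) (he : IsAlternating e)
    (h : Reads (2 * M + 2 + 2 * Λ + (Λ + 1)) a v) :
    (∀ i < M + 1, v (M + i) = v M) ∧ (∀ i < Λ, v (2 * M + 1 + i) = v (2 * M + 1)) ∧
    (∀ i < Λ + 1, v (2 * M + 1 + Λ + i) = v (2 * M + 1 + Λ)) ∧
    (∀ i < Λ + 1, v (2 * M + 2 + 2 * Λ + i) = v (2 * M + 2 + 2 * Λ)) := by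
  refine ⟨h.straight (by omega) fun i hi => ?_, h.straight (by omega) fun i hi => ?_,
    h.straight (by omega) fun i hi => ?_, h.straight (by omega) fun i hi => ?_⟩
  · rw [add_assoc, hz.leg₁ _ (by omega), hz.leg₁ _ (by omega)]
    exact (he.ne (by push_cast; ring)).symm
  · rw [add_assoc (2 * M + 1), hz.leg₂ _ (by omega), hz.leg₂ _ (by omega)]
    exact he.ne (by push_cast; ring)
  · rw [add_assoc (2 * M + 1 + Λ), hz.leg₃ _ (by omega), hz.leg₃ _ (by omega)]
    exact (he.ne (by push_cast; ring)).symm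
  · rw [add_assoc (2 * M + 2 + 2 * Λ), hz.leg₄ _ (by omega), hz.leg₄ _ (by omega)]
    exact he.ne (by push_cast; ring)

lemma IsZigzag.walk_eq (hz : IsZigzag M Λ e a) (he : IsAlternating e)
    (h : Reads (2 * M + 2 + 2 * Λ + (Λ + 1)) a v) :
    walk v (2 * M + 1) = walk v M + v M * (M + 1) ∧
    (∀ i ≤ Λ, walk v (2 * M + 1 + i) = walk v (2 * M + 1) + v (2 * M + 1) * i) ∧
    (∀ i ≤ Λ + 1, walk v (2 * M + 1 + Λ + i)
      = walk v (2 * M + 1 + Λ) + v (2 * M + 1 + Λ) * i) ∧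
    (∀ i ≤ Λ + 1, walk v (2 * M + 2 + 2 * Λ + i)
      = walk v (2 * M + 2 + 2 * Λ) + v (2 * M + 2 + 2 * Λ) * i) := by
  obtain ⟨h1, h2, h3, h4⟩ := hz.steps he h
  refine ⟨?_, walk_straight h2, walk_straight h3, walk_straight h4⟩
  have := walk_straight h1 (M + 1) le_rfl
  rw [show M + (M + 1) = 2 * M + 1 by ring] at this
  rw [this]
  push_cast
  ring

/-- Missing the second or the third turn merges two long legs into one straight run. If both are
made, leg 3 returns over the site of the first turn; being one step longer than leg 2, it goes
straight through that site between different letters. The letters around the first turn agree, so by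
`Reads.not_straight` that turn is made too. -/
lemma IsZigzag.turns_or_card (hz : IsZigzag M Λ e a) (he : IsAlternating e) (hΛ : 1 ≤ Λ)
    (h : Reads (2 * M + 2 + 2 * Λ + (Λ + 1)) a v) :
    Turns M Λ 1 v ∨ Turns M Λ (-1) v ∨
      2 * Λ ≤ #((range (2 * M + 2 + 2 * Λ + (Λ + 1) + 1)).image (walk v)) := by
  obtain ⟨h1, h2, h3, h4⟩ := hz.steps he h
  obtain ⟨w1, w2, w3, w4⟩ := hz.walk_eq he h
  have d1 := h.1 M (by omega)
  have d2 := h.1 (2 * M + 1) (by omega)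
  have d3 := h.1 (2 * M + 1 + Λ) (by omega)
  have d4 := h.1 (2 * M + 2 + 2 * Λ) (by omega)
  by_cases e23 : v (2 * M + 1) = v (2 * M + 1 + Λ)
  · refine Or.inr (Or.inr ?_)
    have := le_card_image_of_straight (l := 2 * M + 2 + 2 * Λ + (Λ + 1)) (t := 2 * M + 1)
      (L := 2 * Λ + 1) (v := v) d2 (by omega) fun i hi => by
        rcases lt_or_ge i Λ with hi' | hi'
        · exact h2 i hi'
        · have := h3 (i - Λ) (by omega)
          rw [show 2 * M + 1 + Λ + (i - Λ) = 2 * M + 1 + i by omega] at this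
          rw [this, e23]
    omega
  by_cases e34 : v (2 * M + 1 + Λ) = v (2 * M + 2 + 2 * Λ)
  · refine Or.inr (Or.inr ?_)
    have := le_card_image_of_straight (l := 2 * M + 2 + 2 * Λ + (Λ + 1)) (t := 2 * M + 1 + Λ)
      (L := 2 * Λ + 2) (v := v) d3 (by omega) fun i hi => by
        rcases lt_or_ge i (Λ + 1) with hi' | hi'
        · exact h3 i hi'
        · have := h4 (i - (Λ + 1)) (by omega)
          rw [show 2 * M + 2 + 2 * Λ + (i - (Λ + 1)) = 2 * M + 1 + Λ + i by omega] at this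
          rw [this, e34]
    omega
  have e12 : v (2 * M + 1) ≠ v M := by
    have l1 := hz.leg₁ M (by omega)
    have l2 := hz.leg₂ 1 hΛ
    have l3 := hz.leg₃ (Λ - 1) (by omega)
    have l3' := hz.leg₃ (Λ + 1) le_rfl
    rw [show M + M = 2 * M by ring] at l1
    have hw : walk v (2 * M + 1) = walk v (2 * M + 2 * Λ + 1) := by
      have := w3 Λ (by omega)
      rw [show 2 * M + 1 + Λ + Λ = 2 * M + 2 * Λ + 1 by ring, w2 Λ le_rfl] at this
      rw [this]
      have e32 : v (2 * M + 1 + Λ) = -v (2 * M + 1) := by omega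
      rw [e32]
      ring
    rw [← h1 M (by omega), show M + M = 2 * M by ring]
    refine h.not_straight (t := 2 * M) (u := 2 * M + 2 * Λ) (by omega) (by omega) ?_ ?_ hw
    · rw [l1, show 2 * M + 2 = 2 * M + 1 + 1 by ring, l2]
      congr 1
      push_cast
      ring
    · rw [show 2 * M + 2 * Λ = 2 * M + 1 + Λ + (Λ - 1) by omega, l3,
        show 2 * M + 1 + Λ + (Λ - 1) + 2 = 2 * M + 1 + Λ + (Λ + 1) by omega, l3']
      exact (he.ne (by omega)).symm
  rcases d4 with d4 | d4
  · exact Or.inl ⟨by omega, by omega, by omega, by omega⟩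
  · exact Or.inr (Or.inl ⟨by omega, by omega, by omega, by omega⟩)

/-- The last leg runs through this whole interval, in coordinates with origin at the position at
time `M` and orientation `τ`. -/
lemma IsZigzag.scenery_eq (hz : IsZigzag M Λ e a) (he : IsAlternating e) {τ : ℤ}
    (h : Reads (2 * M + 2 + 2 * Λ + (Λ + 1)) a v) (hv : Turns M Λ τ v) {c : ℤ → Color}
    (hc : ∀ j ≤ 2 * M + 2 + 2 * Λ + (Λ + 1), c (walk v j) = a j) {i : ℤ}
    (h1 : -(M + 2) ≤ i) (h2 : i ≤ Λ - (M + 1)) : c (walk v M + τ * i) = e i := by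
  obtain ⟨w1, w2, w3, w4⟩ := hz.walk_eq he h
  obtain ⟨t1, t2, t3, t4⟩ := hv
  obtain ⟨k, hk⟩ := Int.eq_ofNat_of_zero_le (show 0 ≤ i + (M + 2) by omega)
  have := w3 (Λ + 1) le_rfl
  rw [show 2 * M + 1 + Λ + (Λ + 1) = 2 * M + 2 + 2 * Λ by ring] at this
  have e1 := w4 k (by omega)
  have e2 : walk v M + τ * i = walk v (2 * M + 2 + 2 * Λ + k) := by
    rw [e1, this, w2 Λ le_rfl, w1, t1, t2, t3, t4, show i = k - (M + 2) by omega]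
    push_cast
    ring
  rw [e2, hc _ (by omega), hz.leg₄ k (by omega)]
  congr 1
  omega

lemma Reads.abs_walk_sub_le {l : ℕ} (h : Reads l a v) {j d : ℕ} (hj : j + d ≤ l) :
    |walk v j - walk v (j + d)| ≤ d := by
  induction d with
  | zero => simp
  | succ d ih =>
    have h1 := ih (by omega)
    have h2 := h.1 (j + d) (by omega)
    rw [← add_assoc, walk_succ]
    rw [abs_le] at *
    push_cast
    omega

/-- Up to time `M` the path stays within distance `M` of its position at time `M`. There the scenery
is known by `scenery_eq`, so `back_unique` applies; `Λ ≥ 2M + 2` makes the known interval long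
enough. -/
lemma IsZigzag.walk_eq_back (hz : IsZigzag M Λ e a) (he : IsAlternating e) (hΛ : 2 * M + 2 ≤ Λ)
    {τ : ℤ} (hτ : τ = 1 ∨ τ = -1)
    (h : Reads (2 * M + 2 + 2 * Λ + (Λ + 1)) a v) (hv : Turns M Λ τ v) :
    walk v M = -τ * back e a M M := by
  obtain ⟨c, hc⟩ := h.2
  have hττ : τ * τ = 1 := by rcases hτ with rfl | rfl <;> norm_num
  have key := he.back_unique (a := a) (M := M) (y := fun j => τ * (walk v j - walk v M)) (by simp)
    (fun j hj => by
      rw [walk_succ]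
      have := h.1 j (by omega)
      rcases hτ with rfl | rfl <;> omega)
    (fun j hj => by
      have h1 := h.abs_walk_sub_le (j := j) (d := M - j) (by omega)
      rw [show j + (M - j) = M by omega, abs_le] at h1
      rw [← hz.scenery_eq he h hv hc, ← mul_assoc, hττ, ← hc j (by omega)]
      · congr 1; ring
      · rcases hτ with rfl | rfl <;> omega
      · rcases hτ with rfl | rfl <;> omega) M le_rfl
  simp only [Nat.sub_self, walk_zero] at key
  rw [← key, ← mul_assoc, neg_mul, hττ]
  ring

/-- The known interval reaches beyond distance `M` on both sides, so it contains both neighbors of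
the starting point and the color of `z` is forced. -/
lemma IsZigzag.blackFit_eq (hz : IsZigzag M Λ e a) (he : IsAlternating e) (hΛ : 2 * M + 2 ≤ Λ)
    {τ : ℤ} (hτ : τ = 1 ∨ τ = -1)
    (h : Reads (2 * M + 2 + 2 * Λ + (Λ + 1)) a v) (hv : Turns M Λ τ v) {z : ℤ}
    (hz1 : z = 1 ∨ z = -1) :
    blackFit (2 * M + 2 + 2 * Λ + (Λ + 1)) v a z = if e (back e a M M + τ * z) = black then
      fit (walk v) a (range (2 * M + 2 + 2 * Λ + (Λ + 1) + 1)) else 0 := by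
  have hττ : τ * τ = 1 := by rcases hτ with rfl | rfl <;> norm_num
  have hw := hz.walk_eq_back he hΛ hτ h hv
  have hb := abs_back_le e a M M
  rw [abs_le] at hb
  have hcz : ∀ c : ℤ → Color, (∀ j ∈ range (2 * M + 2 + 2 * Λ + (Λ + 1) + 1), c (walk v j) = a j) →
      c z = e (back e a M M + τ * z) := by
    intro c hc
    rw [← hz.scenery_eq he h hv (fun j hj => hc j (mem_range.mpr (by omega)))]
    · rw [hw, mul_add, ← mul_assoc, hττ]
      congr 1
      ring
    · rcases hτ with rfl | rfl <;> omega
    · rcases hτ with rfl | rfl <;> omega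
  rw [blackFit, fit]
  split_ifs with hblack
  · congr 1
    ext c
    simp only [Set.mem_ofPred_eq, and_iff_right_iff_imp]
    exact fun hc => (hcz c hc).trans hblack
  · have : {c : ℤ → Color | c z = black ∧
        ∀ j ∈ range (2 * M + 2 + 2 * Λ + (Λ + 1) + 1), c (walk v j) = a j} = ∅ := by
      ext c
      simp only [Set.mem_ofPred_eq, Set.mem_empty_iff_false, iff_false, not_and]
      exact fun h1 h2 => hblack ((hcz c h2).symm.trans h1)
    rw [this, measureReal_empty]

/-- The probability of black at time `0` selected by the zigzag record. -/
noncomputable def zigzagValue (θ : Params) (e : ℤ → Color) (a : ℕ → Color) (M : ℕ) : ℝ :=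
  if e (back e a M M - 1) = black then θ.p else 1 - θ.p

/-- Reflection interchanges the two neighbors of the site found by `back`, one of which is black and
the other white. -/
lemma IsAlternating.zigzagValue_neg (θ : Params) (he : IsAlternating e) (M : ℕ) :
    zigzagValue θ (fun z => e (-z)) a M = 1 - zigzagValue θ e a M := by
  unfold zigzagValue
  beta_reduce
  rw [he.back_neg, show -(-back e a M M - 1) = back e a M M + 1 by ring]
  have := he.ne (z := back e a M M - 1) (w := back e a M M + 1) (by ring)
  revert this
  generalize e (back e a M M - 1) = x
  generalize e (back e a M M + 1) = y
  cases x <;> cases y <;> simp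

lemma IsZigzag.blackFit_turns (θ : Params) (hz : IsZigzag M Λ e a) (he : IsAlternating e)
    (hΛ : 2 * M + 2 ≤ Λ) (h : Reads (2 * M + 2 + 2 * Λ + (Λ + 1)) a v) :
    (Turns M Λ 1 v → θ.p * blackFit (2 * M + 2 + 2 * Λ + (Λ + 1)) v a (-1)
        + (1 - θ.p) * blackFit (2 * M + 2 + 2 * Λ + (Λ + 1)) v a 1
      = zigzagValue θ e a M * fit (walk v) a (range (2 * M + 2 + 2 * Λ + (Λ + 1) + 1))) ∧
    (Turns M Λ (-1) v → θ.p * blackFit (2 * M + 2 + 2 * Λ + (Λ + 1)) v a (-1)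
        + (1 - θ.p) * blackFit (2 * M + 2 + 2 * Λ + (Λ + 1)) v a 1
      = (1 - zigzagValue θ e a M) *
        fit (walk v) a (range (2 * M + 2 + 2 * Λ + (Λ + 1) + 1))) := by
  have := he.ne (z := back e a M M - 1) (w := back e a M M + 1) (by ring)
  constructor <;> intro hv
  · rw [hz.blackFit_eq he hΛ (Or.inl rfl) h hv (Or.inl rfl),
      hz.blackFit_eq he hΛ (Or.inl rfl) h hv (Or.inr rfl), zigzagValue]
    simp only [one_mul, ← sub_eq_add_neg]
    revert this
    generalize e (back e a M M - 1) = x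
    generalize e (back e a M M + 1) = y
    cases x <;> cases y <;> simp
  · rw [hz.blackFit_eq he hΛ (Or.inr rfl) h hv (Or.inl rfl),
      hz.blackFit_eq he hΛ (Or.inr rfl) h hv (Or.inr rfl), zigzagValue]
    simp only [neg_mul, one_mul, neg_neg, ← sub_eq_add_neg]
    revert this
    generalize e (back e a M M - 1) = x
    generalize e (back e a M M + 1) = y
    cases x <;> cases y <;> simp

lemma IsZigzag.walk_le_of_turns_neg (hz : IsZigzag M Λ e a) (he : IsAlternating e)
    (h : Reads (2 * M + 2 + 2 * Λ + (Λ + 1)) a v) (hv : Turns M Λ (-1) v) :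
    walk v (2 * M + 2 + 2 * Λ + (Λ + 1)) ≤ (2 * M + 1 : ℕ) - (Λ : ℤ) := by
  obtain ⟨w1, w2, w3, w4⟩ := hz.walk_eq he h
  obtain ⟨t1, t2, t3, t4⟩ := hv
  have e3 := w3 (Λ + 1) le_rfl
  rw [show 2 * M + 1 + Λ + (Λ + 1) = 2 * M + 2 + 2 * Λ by ring] at e3
  have e0 := h.abs_walk_sub_le (j := 0) (d := M) (by omega)
  rw [zero_add, walk_zero, abs_le] at e0
  rw [w4 _ le_rfl, e3, w2 Λ le_rfl, w1, t1, t2, t3, t4]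
  push_cast
  linarith

open scoped Classical in
-- A reading path is determined by its first `M` steps and its four leg directions, which gives the
-- factor `3 ^ 4`. The point is that the bound does not grow with `Λ`.
lemma IsZigzag.card_reads_le (hz : IsZigzag M Λ e a) (he : IsAlternating e) :
    #{v ∈ paths (2 * M + 2 + 2 * Λ + (Λ + 1)) | Reads (2 * M + 2 + 2 * Λ + (Λ + 1)) a v}
      ≤ #(paths M) * 81 := by
  have hcard : #(paths M ×ˢ (stepSet ×ˢ stepSet ×ˢ stepSet ×ˢ stepSet)) = #(paths M) * 81 := by
    simp [card_product, stepSet]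
  rw [← hcard]
  refine card_le_card_of_injOn (fun v => (fun i => if i < M then v i else 0, v M, v (2 * M + 1),
    v (2 * M + 1 + Λ), v (2 * M + 2 + 2 * Λ))) ?_ ?_
  · intro v hv
    have hv' := mem_paths.mp (mem_filter.mp (mem_coe.mp hv)).1
    simp only [coe_product, Set.mem_prod, mem_coe]
    refine ⟨mem_paths.mpr ⟨fun i hi => ?_, fun i hi => ?_⟩, hv'.1 _ (by omega), hv'.1 _ (by omega),
      hv'.1 _ (by omega), hv'.1 _ (by omega)⟩
    · rw [if_pos hi]; exact hv'.1 _ (by omega)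
    · rw [if_neg (by omega)]
  · intro v hv w hw hvw
    obtain ⟨hv1, hv2⟩ := mem_filter.mp (mem_coe.mp hv)
    obtain ⟨hw1, hw2⟩ := mem_filter.mp (mem_coe.mp hw)
    simp only [Prod.mk.injEq] at hvw
    obtain ⟨g0, g1, g2, g3, g4⟩ := hvw
    obtain ⟨v1, v2, v3, v4⟩ := hz.steps he hv2
    obtain ⟨w1, w2, w3, w4⟩ := hz.steps he hw2
    funext i
    rcases lt_or_ge i M with hi | hi
    · simpa [hi] using congrFun g0 i
    rcases lt_or_ge i (2 * M + 1) with hi1 | hi1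
    · rw [show i = M + (i - M) by omega, v1 _ (by omega), w1 _ (by omega), g1]
    rcases lt_or_ge i (2 * M + 1 + Λ) with hi2 | hi2
    · rw [show i = 2 * M + 1 + (i - (2 * M + 1)) by omega, v2 _ (by omega), w2 _ (by omega), g2]
    rcases lt_or_ge i (2 * M + 2 + 2 * Λ) with hi3 | hi3
    · rw [show i = 2 * M + 1 + Λ + (i - (2 * M + 1 + Λ)) by omega, v3 _ (by omega),
        w3 _ (by omega), g3]
    rcases lt_or_ge i (2 * M + 2 + 2 * Λ + (Λ + 1)) with hi4 | hi4
    · rw [show i = 2 * M + 2 + 2 * Λ + (i - (2 * M + 2 + 2 * Λ)) by omega, v4 _ (by omega),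
        w4 _ (by omega), g4]
    · rw [(mem_paths.mp hv1).2 i hi4, (mem_paths.mp hw1).2 i hi4]

/-- The zigzag path itself, preceded by the path read backwards. -/
lemma IsZigzag.exists_path (hz : IsZigzag M Λ e a) (he : IsAlternating e) (hΛ : 2 * M + 2 ≤ Λ) :
    ∃ v ∈ paths (2 * M + 2 + 2 * Λ + (Λ + 1)),
      (∀ i < 2 * M + 2 + 2 * Λ + (Λ + 1), v i = 1 ∨ v i = -1) ∧
      (Λ : ℤ) - (2 * M + 1 : ℕ) ≤ walk v (2 * M + 2 + 2 * Λ + (Λ + 1)) ∧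
      2⁻¹ ^ (Λ + 2) ≤ fit (walk v) a (range (2 * M + 2 + 2 * Λ + (Λ + 1) + 1)) := by
  set v : ℕ → ℤ := fun i => if i < M then back e a M (M - (i + 1)) - back e a M (M - i)
    else if i < 2 * M + 1 then -1 else if i < 2 * M + 1 + Λ then 1
    else if i < 2 * M + 2 + 2 * Λ then -1 else if i < 2 * M + 2 + 2 * Λ + (Λ + 1) then 1 else 0
    with hv
  have hstep : ∀ i < 2 * M + 2 + 2 * Λ + (Λ + 1), v i = 1 ∨ v i = -1 := by
    intro i hi
    simp only [hv]
    split_ifs with h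
    · have := back_succ e a M (M - (i + 1))
      rw [show M - (i + 1) + 1 = M - i by omega] at this
      omega
    all_goals simp
  have hb := abs_back_le e a M M
  rw [abs_le] at hb
  have w0 : ∀ j ≤ M, walk v j = back e a M (M - j) - back e a M M := by
    intro j
    induction j with
    | zero => intro _; simp
    | succ j ih =>
      intro hj
      rw [walk_succ, ih (by omega)]
      simp only [hv, if_pos (show j < M by omega)]
      ring
  have wM := w0 M le_rfl
  rw [Nat.sub_self, back] at wM
  have w1 : ∀ i ≤ M + 1, walk v (M + i) = -back e a M M - i := by
    intro i hi
    rw [walk_straight (d := -1) (L := M + 1) (fun i hi => ?_) i hi, wM]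
    · ring
    · simp only [hv]
      rw [if_neg (by omega), if_pos (by omega)]
  have w2 : ∀ i ≤ Λ, walk v (2 * M + 1 + i) = -back e a M M - (M + 1) + i := by
    intro i hi
    rw [walk_straight (d := 1) (L := Λ) (fun i hi => ?_) i hi]
    · have := w1 (M + 1) le_rfl
      rw [show M + (M + 1) = 2 * M + 1 by ring] at this
      rw [this]
      push_cast
      ring
    · simp only [hv]
      rw [if_neg (by omega), if_neg (by omega), if_pos (by omega)]
  have w3 : ∀ i ≤ Λ + 1, walk v (2 * M + 1 + Λ + i) = -back e a M M - (M + 1) + Λ - i := by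
    intro i hi
    rw [walk_straight (d := -1) (L := Λ + 1) (fun i hi => ?_) i hi, w2 Λ le_rfl]
    · ring
    · simp only [hv]
      rw [if_neg (by omega), if_neg (by omega), if_neg (by omega), if_pos (by omega)]
  have w4 : ∀ i ≤ Λ + 1, walk v (2 * M + 2 + 2 * Λ + i) = -back e a M M - (M + 2) + i := by
    intro i hi
    rw [walk_straight (d := 1) (L := Λ + 1) (fun i hi => ?_) i hi]
    · have := w3 (Λ + 1) le_rfl
      rw [show 2 * M + 1 + Λ + (Λ + 1) = 2 * M + 2 + 2 * Λ by ring] at this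
      rw [this]
      push_cast
      ring
    · simp only [hv]
      rw [if_neg (by omega), if_neg (by omega), if_neg (by omega), if_neg (by omega),
        if_pos (by omega)]
  have hread : ∀ j ≤ 2 * M + 2 + 2 * Λ + (Λ + 1), e (walk v j + back e a M M) = a j ∧
      -(M + 2) - back e a M M ≤ walk v j ∧ walk v j ≤ Λ - (M + 1) - back e a M M := by
    intro j hj
    rcases lt_or_ge j M with hi | hi
    · have h1 := he.read_back (a := a) (M := M) (by simpa using hz.leg₁ 0 (by omega)) (M - j)
        (by omega)
      have h2 := abs_back_le e a M (M - j)
      rw [abs_le] at h2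
      rw [w0 j (by omega), sub_add_cancel, h1]
      exact ⟨by congr 1; omega, by omega, by omega⟩
    rcases lt_or_ge j (2 * M + 1) with hi1 | hi1
    · obtain ⟨i, rfl⟩ := Nat.exists_eq_add_of_le hi
      rw [hz.leg₁ i (by omega), w1 i (by omega)]
      exact ⟨by congr 1; ring, by omega, by omega⟩
    rcases lt_or_ge j (2 * M + 1 + Λ) with hi2 | hi2
    · obtain ⟨i, rfl⟩ := Nat.exists_eq_add_of_le hi1
      rw [hz.leg₂ i (by omega), w2 i (by omega)]
      exact ⟨by congr 1; ring, by omega, by omega⟩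
    rcases lt_or_ge j (2 * M + 2 + 2 * Λ) with hi3 | hi3
    · obtain ⟨i, rfl⟩ := Nat.exists_eq_add_of_le hi2
      rw [hz.leg₃ i (by omega), w3 i (by omega)]
      exact ⟨by congr 1; ring, by omega, by omega⟩
    · obtain ⟨i, rfl⟩ := Nat.exists_eq_add_of_le hi3
      rw [hz.leg₄ i (by omega), w4 i (by omega)]
      exact ⟨by congr 1; ring, by omega, by omega⟩
  refine ⟨v, mem_paths.mpr ⟨fun i hi => ?_, fun i hi => ?_⟩, hstep, ?_, ?_⟩
  · rw [mem_stepSet]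
    rcases hstep i hi with h | h <;> simp [h]
  · simp only [hv]
    rw [if_neg (by omega), if_neg (by omega), if_neg (by omega), if_neg (by omega),
      if_neg (by omega)]
  · rw [w4 _ le_rfl]
    push_cast
    omega
  · rw [fit_eq_pow (c₀ := fun z => e (z + back e a M M)) fun j hj => (hread j (by
      have := mem_range.mp hj; omega)).1]
    refine pow_le_pow_of_le_one (by norm_num) (by norm_num) ?_
    have hsub : (range (2 * M + 2 + 2 * Λ + (Λ + 1) + 1)).image (walk v)
        ⊆ Icc (-(M + 2) - back e a M M) (Λ - (M + 1) - back e a M M) := by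
      intro z hz
      obtain ⟨j, hj, rfl⟩ := mem_image.mp hz
      exact mem_Icc.mpr (hread j (by have := mem_range.mp hj; omega)).2
    have := card_le_card hsub
    rw [Int.card_Icc] at this
    omega

end Zigzag

end RWRS

/-! ### Long legs dominate for `p < 4/5`; all records are bad for `1/2 < p < 4/5`. -/

namespace RWRS

open Finset Filter Topology

/-- Take `A = √(p(1-p))` and `r = √(p/(1-p))`; then `r < 2` means `p < 4/5`. If `p = 1/2`, then `r =
1` and mirrored paths are not suppressed, but their error carries the factor `2p - 1 = 0`. -/
lemma exists_step_factor (θ : Params) (hε : θ.ε = 0) (hp : θ.p < 4 / 5) :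
    ∃ A r : ℝ, 0 < A ∧ 1 ≤ r ∧ r < 2 ∧ stepProb θ 1 = A * r ∧ stepProb θ (-1) = A * r⁻¹ ∧
      (2 * θ.p - 1 = 0 ∨ 1 < r) := by
  have h0 := θ.half_le_p
  have hq : 0 < 1 - θ.p := by linarith
  have hp0 : 0 < θ.p := by linarith
  have e1 : stepProb θ 1 = θ.p := by rw [stepProb_one, hε]; ring
  have e2 : stepProb θ (-1) = 1 - θ.p := by simp [stepProb_eq, hε]
  have sp := Real.sqrt_pos.mpr hp0
  have sq := Real.sqrt_pos.mpr hq
  have hpp := Real.mul_self_sqrt hp0.le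
  have hqq := Real.mul_self_sqrt hq.le
  refine ⟨√θ.p * √(1 - θ.p), √θ.p / √(1 - θ.p), mul_pos sp sq, ?_, ?_, ?_, ?_, ?_⟩
  · rw [one_le_div sq]
    exact Real.sqrt_le_sqrt (by linarith)
  · rw [div_lt_iff₀ sq]
    nlinarith
  · rw [e1]
    field_simp
    linarith
  · rw [e2]
    field_simp
    linarith
  · rcases h0.eq_or_lt with h | h
    · left; linarith
    · right
      rw [one_lt_div sq]
      exact Real.sqrt_lt_sqrt hq.le (by linarith)

/-- The drift gains at most a factor `r` per visited site, and each site costs `1/2`; as `r < 2`,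
extra sites are a loss. -/
lemma zpow_mul_two_inv_le {r : ℝ} (hr1 : 1 ≤ r) (hr2 : r < 2) {w : ℤ} {n L : ℕ} (hw : w ≤ n)
    (hn : L ≤ n) : r ^ w * 2⁻¹ ^ n ≤ (r / 2) ^ L := by
  have h1 : r ^ w ≤ r ^ n := by
    rw [← zpow_natCast]
    exact zpow_le_zpow_right₀ hr1 hw
  calc r ^ w * 2⁻¹ ^ n ≤ r ^ n * 2⁻¹ ^ n := by gcongr
    _ = (r / 2) ^ n := by rw [← mul_pow, div_eq_mul_inv]
    _ ≤ (r / 2) ^ L := pow_le_pow_of_le_one (by positivity) (by linarith) hn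

lemma zigzagValue_mem (θ : Params) (e : ℤ → Color) (a : ℕ → Color) (M : ℕ) :
    0 ≤ zigzagValue θ e a M ∧ zigzagValue θ e a M ≤ 1 ∧
      |1 - 2 * zigzagValue θ e a M| = 2 * θ.p - 1 := by
  have := θ.half_le_p
  have := θ.p_le_one
  unfold zigzagValue
  split_ifs
  · exact ⟨by linarith, by linarith, by rw [abs_of_nonpos (by linarith)]; ring⟩
  · exact ⟨by linarith, by linarith, by rw [abs_of_nonneg (by linarith)]; ring⟩

/-- The three cases of `turns_or_card`: no error for the intended orientation; for the mirrored one
the value is `1 - x` instead of `x`, and the path ends about `Λ` to the left; otherwise at least `2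
* Λ` sites are visited. -/
lemma IsZigzag.abs_term_le {θ : Params} {A r : ℝ} (hA : 0 < A) (hr1 : 1 ≤ r)
    (hr2 : r < 2) (hs1 : stepProb θ 1 = A * r) (hs2 : stepProb θ (-1) = A * r⁻¹) {M Λ : ℕ}
    {e : ℤ → Color} {a : ℕ → Color} {v : ℕ → ℤ} (hz : IsZigzag M Λ e a) (he : IsAlternating e)
    (hΛ : 2 * M + 2 ≤ Λ) (h : Reads (2 * M + 2 + 2 * Λ + (Λ + 1)) a v) :
    |weight θ (2 * M + 2 + 2 * Λ + (Λ + 1)) v *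
        (θ.p * blackFit (2 * M + 2 + 2 * Λ + (Λ + 1)) v a (-1)
        + (1 - θ.p) * blackFit (2 * M + 2 + 2 * Λ + (Λ + 1)) v a 1)
      - zigzagValue θ e a M * (weight θ (2 * M + 2 + 2 * Λ + (Λ + 1)) v *
        fit (walk v) a (range (2 * M + 2 + 2 * Λ + (Λ + 1) + 1)))|
      ≤ A ^ (2 * M + 2 + 2 * Λ + (Λ + 1)) *
        ((2 * θ.p - 1) * (r ^ (2 * M + 1) * r⁻¹ ^ Λ * 2⁻¹ ^ Λ) + (r / 2) ^ (2 * Λ)) := by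
  have hr0 : 0 < r := by linarith
  have hp1 := θ.half_le_p
  have hp2 := θ.p_le_one
  set l := 2 * M + 2 + 2 * Λ + (Λ + 1)
  set f := fit (walk v) a (range (l + 1))
  have hf : f = 2⁻¹ ^ #((range (l + 1)).image (walk v)) := by
    obtain ⟨c, hc⟩ := h.2
    exact fit_eq_pow fun j hj => hc j (by have := mem_range.mp hj; omega)
  have hw : weight θ l v = A ^ l * r ^ walk v l := weight_eq_zpow hr0.ne' hs1 hs2 h.1
  obtain ⟨v0, v1, v2⟩ := zigzagValue_mem θ e a M
  obtain ⟨bp, bm⟩ := hz.blackFit_turns θ he hΛ h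
  have hE1 : 0 ≤ (2 * θ.p - 1) * (r ^ (2 * M + 1) * r⁻¹ ^ Λ * 2⁻¹ ^ Λ) :=
    mul_nonneg (by linarith) (by positivity)
  have hE2 : 0 ≤ (r / 2) ^ (2 * Λ) := by positivity
  rcases hz.turns_or_card he (by omega) h with ht | ht | hcard
  · rw [bp ht, mul_left_comm, sub_self, abs_zero]
    positivity
  · rw [bm ht]
    have h1 : weight θ l v * ((1 - zigzagValue θ e a M) * f)
        - zigzagValue θ e a M * (weight θ l v * f)
        = (1 - 2 * zigzagValue θ e a M) * (weight θ l v * f) := by ring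
    rw [h1, abs_mul, v2, abs_of_nonneg (mul_nonneg (weight_nonneg ..) (fit_nonneg ..)), hw, mul_assoc,
      mul_left_comm]
    refine mul_le_mul_of_nonneg_left (le_add_of_le_of_nonneg ?_ hE2) (by positivity)
    refine mul_le_mul_of_nonneg_left ?_ (by linarith)
    have hle := hz.walk_le_of_turns_neg he h ht
    have b1 : r ^ walk v l ≤ r ^ (2 * M + 1) * r⁻¹ ^ Λ := by
      calc r ^ walk v l ≤ r ^ (((2 * M + 1 : ℕ) : ℤ) - (Λ : ℤ)) := zpow_le_zpow_right₀ hr1 hle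
        _ = _ := by rw [zpow_sub₀ hr0.ne', zpow_natCast, zpow_natCast, inv_pow, div_eq_mul_inv]
    have b2 : f ≤ 2⁻¹ ^ Λ := by
      rw [hf]
      refine pow_le_pow_of_le_one (by norm_num) (by norm_num) ?_
      have := le_card_image_of_straight (l := l) (h.1 (2 * M + 1) (by omega)) (by omega)
        (hz.steps he h).2.1
      omega
    exact mul_le_mul b1 b2 (fit_nonneg ..) (by positivity)
  · have hb1 := blackFit_le l v a (-1)
    have hb2 := blackFit_le l v a 1
    have hb3 := blackFit_nonneg l v a (-1)
    have hb4 := blackFit_nonneg l v a 1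
    have hf0 : 0 ≤ f := fit_nonneg ..
    have hin : |θ.p * blackFit l v a (-1) + (1 - θ.p) * blackFit l v a 1
        - zigzagValue θ e a M * f| ≤ f := by
      have c1 := mul_le_mul_of_nonneg_left hb1 (show 0 ≤ θ.p by linarith)
      have c2 := mul_le_mul_of_nonneg_left hb2 (show 0 ≤ 1 - θ.p by linarith)
      have c3 := mul_nonneg (show 0 ≤ θ.p by linarith) hb3
      have c4 := mul_nonneg (show 0 ≤ 1 - θ.p by linarith) hb4
      have c5 := mul_nonneg v0 hf0
      have c6 := mul_le_mul_of_nonneg_right v1 hf0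
      rw [abs_le]
      constructor <;> linarith
    rw [mul_left_comm, ← mul_sub, abs_mul, abs_of_nonneg (weight_nonneg ..)]
    refine (mul_le_mul_of_nonneg_left hin (weight_nonneg ..)).trans ?_
    rw [hw, mul_assoc]
    refine mul_le_mul_of_nonneg_left (le_add_of_nonneg_of_le hE1 ?_) (by positivity)
    rw [hf]
    exact zpow_mul_two_inv_le hr1 hr2 (walk_lt_card_image h.1).le hcard

lemma abs_zigzag_sub_le (θ : Params) (hε : θ.ε = 0) (hp : θ.p < 4 / 5) (M : ℕ) {δ : ℝ}
    (hδ : 0 < δ) : ∃ Λ₀, ∀ Λ ≥ Λ₀, ∀ e a, IsAlternating e → IsZigzag M Λ e a →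
      |∑ v ∈ paths (2 * M + 2 + 2 * Λ + (Λ + 1)),
          weight θ (2 * M + 2 + 2 * Λ + (Λ + 1)) v *
            (θ.p * blackFit (2 * M + 2 + 2 * Λ + (Λ + 1)) v a (-1)
            + (1 - θ.p) * blackFit (2 * M + 2 + 2 * Λ + (Λ + 1)) v a 1)
        - zigzagValue θ e a M * ∑ v ∈ paths (2 * M + 2 + 2 * Λ + (Λ + 1)),
          weight θ (2 * M + 2 + 2 * Λ + (Λ + 1)) v *
            fit (walk v) a (range (2 * M + 2 + 2 * Λ + (Λ + 1) + 1))|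
      ≤ δ * ∑ v ∈ paths (2 * M + 2 + 2 * Λ + (Λ + 1)),
          weight θ (2 * M + 2 + 2 * Λ + (Λ + 1)) v *
            fit (walk v) a (range (2 * M + 2 + 2 * Λ + (Λ + 1) + 1)) := by
  classical
  obtain ⟨A, r, hA, hr1, hr2, hs1, hs2, hr⟩ := exists_step_factor θ hε hp
  have hr0 : 0 < r := by linarith
  set K : ℝ := ((#(paths M) * 81 : ℕ) : ℝ)
  have hlim : Tendsto (fun Λ : ℕ => K * ((2 * θ.p - 1) * (r ^ (2 * M + 1) * (r⁻¹ * r⁻¹) ^ Λ)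
      + (r / 2) ^ Λ)) atTop (𝓝 0) := by
    have t2 : Tendsto (fun Λ : ℕ => (r / 2) ^ Λ) atTop (𝓝 0) :=
      tendsto_pow_atTop_nhds_zero_of_lt_one (by positivity) (by linarith)
    have t1 : Tendsto (fun Λ : ℕ => (2 * θ.p - 1) * (r ^ (2 * M + 1) * (r⁻¹ * r⁻¹) ^ Λ))
        atTop (𝓝 0) := by
      rcases hr with h0 | h1
      · simp [h0]
      · have : r⁻¹ < 1 := inv_lt_one_of_one_lt₀ h1
        have t := tendsto_pow_atTop_nhds_zero_of_lt_one (r := r⁻¹ * r⁻¹) (by positivity)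
          (mul_lt_one_of_nonneg_of_lt_one_left (by positivity) this this.le)
        simpa using (t.const_mul (r ^ (2 * M + 1))).const_mul (2 * θ.p - 1)
    simpa using (t1.add t2).const_mul K
  -- These constants come from `exists_path`: its end point falls short of `Λ` by at most `2M + 1`,
  -- and it visits at most `Λ + 2` sites.
  have hpos : 0 < δ * (r⁻¹ ^ (2 * M + 1) * 2⁻¹ ^ 2) := by positivity
  obtain ⟨Λ₁, hΛ₁⟩ := eventually_atTop.mp (hlim.eventually_lt_const hpos)
  refine ⟨max Λ₁ (2 * M + 2), fun Λ hΛ e a he hz => ?_⟩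
  have hΛ' : 2 * M + 2 ≤ Λ := (le_max_right _ _).trans hΛ
  have hsmall := hΛ₁ Λ ((le_max_left _ _).trans hΛ)
  have hterm := fun v => hz.abs_term_le hA hr1 hr2 hs1 hs2 (v := v) he hΛ'
  have hcard := hz.card_reads_le he
  obtain ⟨v₀, hv₀, hst, hwalk, hfit⟩ := hz.exists_path he hΛ'
  set l := 2 * M + 2 + 2 * Λ + (Λ + 1)
  have hlow : A ^ l * (r ^ Λ * r⁻¹ ^ (2 * M + 1)) * 2⁻¹ ^ (Λ + 2)
      ≤ ∑ v ∈ paths l, weight θ l v * fit (walk v) a (range (l + 1)) := by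
    refine le_trans ?_ (single_le_sum (fun v _ => mul_nonneg (weight_nonneg ..) (fit_nonneg ..)) hv₀)
    rw [weight_eq_zpow hr0.ne' hs1 hs2 hst]
    refine mul_le_mul (mul_le_mul_of_nonneg_left ?_ (by positivity)) hfit (by positivity)
      (by positivity)
    calc r ^ Λ * r⁻¹ ^ (2 * M + 1) = r ^ ((Λ : ℤ) - ((2 * M + 1 : ℕ) : ℤ)) := by
          rw [zpow_sub₀ hr0.ne', zpow_natCast, zpow_natCast, inv_pow, div_eq_mul_inv]
      _ ≤ _ := zpow_le_zpow_right₀ hr1 hwalk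
  refine le_trans ?_ (mul_le_mul_of_nonneg_left hlow hδ.le)
  rw [mul_sum, ← sum_sub_distrib]
  set Q := A ^ l * ((2 * θ.p - 1) * (r ^ (2 * M + 1) * r⁻¹ ^ Λ * 2⁻¹ ^ Λ) + (r / 2) ^ (2 * Λ))
  have hQ : 0 ≤ Q := by
    refine mul_nonneg (by positivity) (add_nonneg (mul_nonneg ?_ (by positivity)) (by positivity))
    linarith [θ.half_le_p]
  have hsum : |∑ v ∈ paths l, (weight θ l v * (θ.p * blackFit l v a (-1)
      + (1 - θ.p) * blackFit l v a 1)
      - zigzagValue θ e a M * (weight θ l v * fit (walk v) a (range (l + 1))))| ≤ K * Q := by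
    refine (abs_sum_le_sum_abs _ _).trans ?_
    calc _ ≤ ∑ v ∈ paths l, if Reads l a v then Q else 0 := by
          refine sum_le_sum fun v hv => ?_
          split_ifs with hread
          · exact hterm v hread
          · have h0 : weight θ l v * fit (walk v) a (range (l + 1)) = 0 := by
              by_contra hne
              exact hread (reads_of_ne_zero hε hv hne)
            rcases mul_eq_zero.mp h0 with h1 | h1
            · simp [h1]
            · have b1 := le_antisymm (h1 ▸ blackFit_le l v a (-1)) (blackFit_nonneg ..)
              have b2 := le_antisymm (h1 ▸ blackFit_le l v a 1) (blackFit_nonneg ..)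
              simp [h1, b1, b2]
      _ = #{v ∈ paths l | Reads l a v} * Q := by
          rw [← sum_filter, sum_const, nsmul_eq_mul]
      _ ≤ K * Q := mul_le_mul_of_nonneg_right (Nat.cast_le.mpr hcard) hQ
  refine hsum.trans ?_
  -- Both sides are measured in units of `A ^ l * (r / 2) ^ Λ`; what remains is the null sequence of
  -- `hlim` against a positive constant.
  have hfac : 0 < A ^ l * (r ^ Λ * 2⁻¹ ^ Λ) := by positivity
  have e1 : K * Q = (A ^ l * (r ^ Λ * 2⁻¹ ^ Λ)) *
      (K * ((2 * θ.p - 1) * (r ^ (2 * M + 1) * (r⁻¹ * r⁻¹) ^ Λ) + (r / 2) ^ Λ)) := by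
    have : r ^ Λ * r⁻¹ ^ Λ = 1 := by rw [← mul_pow, mul_inv_cancel₀ hr0.ne', one_pow]
    have h2 : (r / 2) ^ (2 * Λ) = r ^ Λ * 2⁻¹ ^ Λ * (r / 2) ^ Λ := by
      rw [two_mul, pow_add, ← mul_pow r, ← div_eq_mul_inv]
    simp only [Q]
    rw [h2, mul_pow]
    linear_combination (-K * A ^ l * (2 * θ.p - 1) * r ^ (2 * M + 1) * r⁻¹ ^ Λ * 2⁻¹ ^ Λ) * this
  have e2 : δ * (A ^ l * (r ^ Λ * r⁻¹ ^ (2 * M + 1)) * 2⁻¹ ^ (Λ + 2))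
      = (A ^ l * (r ^ Λ * 2⁻¹ ^ Λ)) * (δ * (r⁻¹ ^ (2 * M + 1) * 2⁻¹ ^ 2)) := by ring
  rw [e1, e2]
  exact mul_le_mul_of_nonneg_left hsmall.le hfac.le

lemma condBlack_eq_tail (θ : Params) (hε : θ.ε = 0) (η : Config) {n : ℕ+} {l : ℕ}
    (h : (n : ℕ) = l + 2) : condBlack θ η n
      = (∑ v ∈ paths l, weight θ l v * (θ.p * blackFit l v (fun j => letters η (1 + j)) (-1)
        + (1 - θ.p) * blackFit l v (fun j => letters η (1 + j)) 1))
        / ∑ v ∈ paths l, weight θ l v * fit (walk v) (fun j => letters η (1 + j)) (range (l + 1)) := by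
  rw [condBlack_eq θ η (N := 1 + l) (by omega), recordProb_eq_tail θ hε,
    recordProb_eq_tail_black θ hε l (letters_zero η)]

lemma tail_pos (θ : Params) (hε : θ.ε = 0) (a : ℕ → Color) (l : ℕ) :
    0 < ∑ v ∈ paths l, weight θ l v * fit (walk v) (fun j => a (1 + j)) (range (l + 1)) := by
  rw [← recordProb_eq_tail θ hε]
  exact recordProb_pos ..

/-- For `p < 4 / 5`, a record can be continued so that the scenery around the walk becomes an
alternating scenery `e` of which one color is prescribed; this prescribes the conditional
probability of black at time `0`. -/
lemma exists_continuation (θ : Params) (hε : θ.ε = 0) (hp : θ.p < 4 / 5) (η : Config) (m : ℕ+)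
    {δ : ℝ} (hδ : 0 < δ) : ∃ (n : ℕ+) (ζ₁ ζ₂ : Config) (x : ℝ), m < n ∧
      (∀ k < m, ζ₁ k = η k) ∧ (∀ k < m, ζ₂ k = η k) ∧ |1 - 2 * x| = 2 * θ.p - 1 ∧
      |condBlack θ ζ₁ n - x| ≤ δ ∧ |condBlack θ ζ₂ n - (1 - x)| ≤ δ := by
  obtain ⟨Λ, hΛ⟩ := abs_zigzag_sub_le θ hε hp m hδ
  have hΛ := hΛ Λ le_rfl
  set l := 2 * (m : ℕ) + 2 + 2 * Λ + (Λ + 1)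
  set b : ℕ → Color := fun j => letters η (1 + j)
  obtain ⟨e, he, he0⟩ := exists_isAlternating (b m)
  obtain ⟨a₁, hz₁, ha₁⟩ := exists_isZigzag m Λ e b he0.symm
  -- A scenery and its reflection have the same color at `0`, so both can continue the same initial
  -- letters.
  obtain ⟨a₂, hz₂, ha₂⟩ := exists_isZigzag m Λ (fun z => e (-z)) b (by simp [he0])
  have hlet : ∀ a : ℕ → Color, ∀ j,
      letters (fun k => a ((k : ℕ) - 1)) (1 + j) = a j := by
    intro a j
    rw [letters, dif_pos (by omega)]
    change a (1 + j - 1) = a j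
    congr 1
    omega
  have hagree : ∀ a : ℕ → Color, (∀ j ≤ (m : ℕ), a j = b j) →
      ∀ k < m, a ((k : ℕ) - 1) = η k := by
    intro a ha k hk
    have hk' : (k : ℕ) < m := hk
    have := k.pos
    rw [ha _ (by omega)]
    simp only [b]
    rw [show 1 + ((k : ℕ) - 1) = k by omega, letters_pos]
  obtain ⟨n, hn⟩ : ∃ n : ℕ+, (n : ℕ) = l + 2 := ⟨(l + 1).succPNat, rfl⟩
  have hcond : ∀ (e : ℤ → Color) (a : ℕ → Color), IsAlternating e → IsZigzag m Λ e a →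
      |condBlack θ (fun k => a ((k : ℕ) - 1)) n - zigzagValue θ e a m| ≤ δ := by
    intro e a he hz
    have h1 := hΛ e a he hz
    have hpos := tail_pos θ hε (letters fun k => a ((k : ℕ) - 1)) l
    rw [condBlack_eq_tail θ hε _ hn]
    simp only [hlet] at hpos ⊢
    rw [div_sub' hpos.ne', abs_div, abs_of_pos hpos, div_le_iff₀ hpos, mul_comm _ (zigzagValue ..)]
    exact h1
  refine ⟨n, fun k => a₁ ((k : ℕ) - 1), fun k => a₂ ((k : ℕ) - 1),
    zigzagValue θ e a₁ m, ?_, hagree a₁ ha₁, hagree a₂ ha₂, (zigzagValue_mem θ e a₁ m).2.2,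
    hcond e a₁ he hz₁, ?_⟩
  · rw [← PNat.coe_lt_coe]
    omega
  · have h2 := hcond _ a₂ he.neg hz₂
    rw [he.zigzagValue_neg] at h2
    have : zigzagValue θ e a₂ m = zigzagValue θ e a₁ m := by
      unfold zigzagValue
      rw [back_congr fun j hj => (ha₂ j hj).trans (ha₁ j hj).symm]
    rwa [this] at h2

/-- The two continuations have values near `x` and `1 - x`, which are `2p - 1` apart, so they cannot
both be close to the value at `η`. -/
lemma badSet_eq_univ (θ : Params) (h1 : 1 / 2 < θ.p) (h2 : θ.p < 4 / 5) (hε : θ.ε = 0) :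
    badSet θ = Set.univ := by
  rw [Set.eq_univ_iff_forall]
  intro η
  refine ⟨(2 * θ.p - 1) / 4, by linarith, fun m => ?_⟩
  obtain ⟨n, ζ₁, ζ₂, x, hmn, hζ₁, hζ₂, hx, hc₁, hc₂⟩ :=
    exists_continuation θ hε h2 η m (δ := (2 * θ.p - 1) / 4) (by linarith)
  by_cases h : (2 * θ.p - 1) / 4 ≤ |condBlack θ η n - condBlack θ ζ₁ n|
  · exact ⟨n, ζ₁, hmn, hζ₁, h⟩
  · refine ⟨n, ζ₂, hmn, hζ₂, ?_⟩
    by_contra h'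
    rw [not_le] at h h'
    rw [abs_lt] at h h'
    rw [abs_le] at hc₁ hc₂
    have : |1 - 2 * x| < 2 * θ.p - 1 := by
      rw [abs_lt]
      constructor <;> linarith
    linarith

/-! ### The black record at `p = 1/2`. -/

lemma half_le_blackFit (l : ℕ) (v : ℕ → ℤ) (a : ℕ → Color) (z : ℤ) (ha : ∀ j ≤ l, a j = black) :
    1 / 2 * fit (walk v) a (range (l + 1)) ≤ blackFit l v a z := by
  have h1 : fit (walk v) a (range (l + 1)) = 2⁻¹ ^ #((range (l + 1)).image (walk v)) :=
    fit_eq_pow (c₀ := fun _ => black) fun j hj =>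
      (ha j (by have := mem_range.mp hj; omega)).symm
  have h2 : blackFit l v a z = 2⁻¹ ^ #(insert z ((range (l + 1)).image (walk v))) := by
    rw [← sceneryLaw_eqOn _ fun _ => black, blackFit]
    congr 1
    ext c
    simp only [Set.mem_ofPred_eq, forall_mem_insert, forall_mem_image]
    exact and_congr_right fun _ => forall₂_congr fun j hj => by
      rw [ha j (by have := mem_range.mp hj; omega)]
  rw [h1, h2, ← one_div, ← pow_succ']
  exact pow_le_pow_of_le_one (by norm_num) (by norm_num) (card_insert_le _ _)

lemma blackFit_eq_of_visited {l : ℕ} {v : ℕ → ℤ} {a : ℕ → Color} {z : ℤ} {i : ℕ} (hi : i ≤ l)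
    (hz : walk v i = z) (ha : a i = black) :
    blackFit l v a z = fit (walk v) a (range (l + 1)) := by
  rw [blackFit, fit]
  congr 1
  ext c
  simp only [Set.mem_ofPred_eq, and_iff_right_iff_imp]
  intro hc
  rw [← hz, hc i (mem_range.mpr (by omega)), ha]

/-- One neighbor of the site of time 1 is the site of time 2, hence black; the other is black with
conditional probability at least `1/2`. Each is the site of time 0 with weight `1/2`, which gives
`1/2 + 1/4`. -/
lemma three_fourths_le_condBlack (θ : Params) (hp : θ.p = 1 / 2) (hε : θ.ε = 0) {n : ℕ+}
    (hn : 3 ≤ (n : ℕ)) : 3 / 4 ≤ condBlack θ allBlack n := by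
  obtain ⟨l, hl⟩ := Nat.exists_eq_add_of_le' (show 2 ≤ (n : ℕ) by omega)
  rw [condBlack_eq_tail θ hε _ hl, le_div_iff₀ (tail_pos θ hε _ l), mul_sum]
  set a : ℕ → Color := fun j => letters allBlack (1 + j)
  have ha : ∀ j, a j = black := fun j => by simp [a, letters, allBlack]
  refine sum_le_sum fun v hv => ?_
  by_cases h0 : weight θ l v * fit (walk v) a (range (l + 1)) = 0
  · rw [h0, mul_zero]
    exact mul_nonneg (weight_nonneg ..) (add_nonneg (mul_nonneg (by rw [hp]; norm_num)
      (blackFit_nonneg ..)) (mul_nonneg (by rw [hp]; norm_num) (blackFit_nonneg ..)))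
  · have hread := reads_of_ne_zero hε hv h0
    have b1 := half_le_blackFit l v a (-1) fun j _ => ha j
    have b2 := half_le_blackFit l v a 1 fun j _ => ha j
    have hw : walk v 1 = v 0 := by rw [← zero_add 1, walk_succ]; simp
    rw [mul_left_comm, hp]
    refine mul_le_mul_of_nonneg_left ?_ (weight_nonneg ..)
    rcases hread.1 0 (by omega) with h | h
    · have b3 := blackFit_eq_of_visited (l := l) (i := 1) (by omega) (hw.trans h) (ha 1)
      linarith
    · have b3 := blackFit_eq_of_visited (l := l) (i := 1) (by omega) (hw.trans h) (ha 1)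
      linarith

lemma allBlack_mem_badSet (θ : Params) (hp : θ.p = 1 / 2) (hε : θ.ε = 0) :
    allBlack ∈ badSet θ := by
  refine ⟨1 / 8, by norm_num, fun m => ?_⟩
  -- Using `m + 1` instead of `m` ensures `n ≥ 3`, so that the letter at time 2 is among those
  -- prescribed.
  obtain ⟨n, ζ, -, x, hmn, hζ, -, hx, hc, -⟩ := exists_continuation θ hε (by rw [hp]; norm_num)
    allBlack (m + 1) (δ := 1 / 8) (by norm_num)
  have hm : m < n := (PNat.lt_add_right m 1).trans hmn
  refine ⟨n, ζ, hm, fun k hk => hζ k (hk.trans (PNat.lt_add_right m 1)), ?_⟩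
  have h3 : 3 ≤ (n : ℕ) := by
    have h1 : ((m + 1 : ℕ+) : ℕ) < n := hmn
    have := m.pos
    rw [PNat.add_coe, PNat.one_coe] at h1
    omega
  have hb := three_fourths_le_condBlack θ hp hε h3
  have hx' : x = 1 / 2 := by
    rw [hp] at hx
    have : 1 - 2 * x = 0 := abs_eq_zero.mp (by rw [hx]; norm_num)
    linarith
  rw [hx', abs_le] at hc
  exact le_trans (by linarith) (le_abs_self _)

end RWRS

/-! ### The good record at `p = 1/2`. -/

namespace RWRS

open Finset

/-- The periodic coloring `WBBW` of the natural numbers. -/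
def periodicColor (k : ℕ) : Color := if k % 4 = 1 ∨ k % 4 = 2 then black else white

/-- Besides its period 4, the coloring is symmetric under `k ↦ 3 - k`; this lets a folded leg lie on
the next one with matching letters. -/
lemma periodicColor_congr {k k' : ℕ} (h : (k + k') % 4 = 3 ∨ k % 4 = k' % 4) :
    periodicColor k = periodicColor k' := by
  unfold periodicColor
  split_ifs <;> first | rfl | omega

lemma periodicColor_ne {k k' : ℕ} (h : k' = k + 2) : periodicColor k ≠ periodicColor k' := by
  unfold periodicColor
  split_ifs <;> first | decide | omega

/-- The times, counted from the second letter on, at which the zigzag record allows a turn. -/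
def turnTime (i : ℕ) : ℕ := (2 * i + 1) * (i + 2)

lemma turnTime_zero : turnTime 0 = 2 := rfl

/-- Leg `i` is block `i + 1`. Each leg is four steps longer than the one before, so after a turn it
runs past the previous turning site. -/
lemma turnTime_succ (i : ℕ) : turnTime (i + 1) = turnTime i + (4 * i + 7) := by
  unfold turnTime; ring

lemma turnTime_strictMono : StrictMono turnTime :=
  strictMono_nat_of_lt_succ fun i => by rw [turnTime_succ]; omega

lemma two_le_turnTime (i : ℕ) : 2 ≤ turnTime i :=
  turnTime_strictMono.monotone (Nat.zero_le i)

lemma le_turnTime (i : ℕ) : i ≤ turnTime i := turnTime_strictMono.le_apply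

/-- The letters `a` are those of the zigzag record up to its turning time with number `L`. -/
structure IsZigzagRecord (L : ℕ) (a : ℕ → Color) : Prop where
  start : ∀ j ≤ 2, a j = periodicColor (j + 1)
  leg : ∀ i < L, ∀ k ≤ 4 * i + 7, a (turnTime i + k) = periodicColor k

lemma length_flatten_replicate (n : ℕ) :
    (List.replicate n [white, white, black, black]).flatten.length = 4 * n := by
  simp [mul_comm]

lemma getD_flatten_replicate (n k : ℕ) (hk : k < 4 * n) :
    (List.replicate n [white, white, black, black]).flatten.getD k black = periodicColor (k + 3) := by
  induction n generalizing k with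
  | zero => omega
  | succ n ih =>
    rw [List.replicate_succ, List.flatten_cons]
    rcases lt_or_ge k 4 with h | h
    · rw [List.getD_append _ _ _ _ (by simpa using h)]
      interval_cases k <;> rfl
    · rw [List.getD_append_right _ _ _ _ (by simpa using h)]
      have := ih (k - 4) (by omega)
      simp only [List.length_cons, List.length_nil] at this ⊢
      rw [this]
      exact periodicColor_congr (Or.inr (by omega))

lemma length_block (j : ℕ) : (block (j + 1)).length = 4 * j + 7 := by
  rw [block, List.length_append, length_flatten_replicate]
  simp
  ring

lemma getD_block (j k : ℕ) (hk : k < 4 * j + 7) :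
    (block (j + 1)).getD k black = periodicColor k := by
  rw [block]
  rcases lt_or_ge k 3 with h | h
  · rw [List.getD_append _ _ _ _ (by simpa using h)]
    interval_cases k <;> rfl
  · rw [List.getD_append_right _ _ _ _ (by simpa using h)]
    have := getD_flatten_replicate (j + 1) (k - 3) (by omega)
    simp only [List.length_cons, List.length_nil] at this ⊢
    rw [this]
    exact periodicColor_congr (Or.inr (by omega))

lemma zigzagPrefix_succ (L : ℕ) : zigzagPrefix (L + 1) = zigzagPrefix L ++ block (L + 1) := by
  simp [zigzagPrefix, List.range_succ]

lemma length_zigzagPrefix (L : ℕ) : (zigzagPrefix L).length = turnTime L := by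
  induction L with
  | zero => rfl
  | succ L ih => rw [zigzagPrefix_succ, List.length_append, ih, length_block, turnTime_succ]

lemma getD_zigzagPrefix (L : ℕ) :
    (∀ j < 2, (zigzagPrefix L).getD j black = black) ∧
    ∀ i < L, ∀ k < 4 * i + 7, (zigzagPrefix L).getD (turnTime i + k) black = periodicColor k := by
  induction L with
  | zero => exact ⟨fun j hj => by interval_cases j <;> rfl, fun i hi => by omega⟩
  | succ L ih =>
    have hlen := length_zigzagPrefix L
    rw [zigzagPrefix_succ]
    refine ⟨fun j hj => ?_, fun i hi k hk => ?_⟩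
    · rw [List.getD_append _ _ _ _ (by have := two_le_turnTime L; omega)]
      exact ih.1 j hj
    · rcases Nat.lt_succ_iff_lt_or_eq.mp hi with h | rfl
      · have h1 := turnTime_strictMono.monotone (show i + 1 ≤ L by omega)
        rw [turnTime_succ] at h1
        rw [List.getD_append _ _ _ _ (by omega)]
        exact ih.2 i h k hk
      · rw [List.getD_append_right _ _ _ _ (by omega), hlen, Nat.add_sub_cancel_left]
        exact getD_block i k hk

lemma isZigzagRecord_of_agree {L : ℕ} {ζ : Config} {m : ℕ+} (hm : (m : ℕ) = turnTime L + 2)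
    (h : ∀ k < m, ζ k = zigzag k) : IsZigzagRecord L fun j => letters ζ (1 + j) := by
  have hlet : ∀ j ≤ turnTime L, letters ζ (1 + j) = (zigzagPrefix (j + 1)).getD j black := by
    intro j hj
    have e : letters ζ (1 + j) = ζ j.succPNat := by
      rw [letters, dif_pos (by omega)]
      congr 1
      exact PNat.eq (add_comm 1 j)
    rw [e, h]
    · rfl
    · rw [← PNat.coe_lt_coe, Nat.succPNat_coe]
      omega
  have hlt : ∀ i < L, ∀ k < 4 * i + 7, letters ζ (1 + (turnTime i + k)) = periodicColor k := by
    intro i hi k hk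
    have h1 := turnTime_strictMono.monotone (show i + 1 ≤ L by omega)
    rw [turnTime_succ] at h1
    rw [hlet _ (by omega)]
    exact (getD_zigzagPrefix _).2 i (by have := le_turnTime i; omega) k hk
  have hL := two_le_turnTime L
  have h2 : letters ζ (1 + 2) = white := by
    rw [hlet 2 hL]
    rfl
  have hturn : ∀ i ≤ L, letters ζ (1 + turnTime i) = white := by
    intro i hi
    rw [hlet _ (turnTime_strictMono.monotone hi)]
    exact (getD_zigzagPrefix _).2 i (by have := le_turnTime i; omega) 0 (by omega)
  refine ⟨fun j hj => ?_, fun i hi k hk => ?_⟩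
  · rcases hj.lt_or_eq with h3 | rfl
    · rw [hlet _ (by omega), (getD_zigzagPrefix _).1 j h3]
      interval_cases j <;> rfl
    · exact h2
  · rcases hk.lt_or_eq with h3 | rfl
    · exact hlt i hi k h3
    -- The last letter of a leg is the first letter of the next block; it is white on both counts,
    -- since `4 * i + 7` is `3` modulo `4`.
    · rw [← turnTime_succ, hturn _ hi]
      unfold periodicColor
      rw [if_neg (by omega)]

section Record

variable {L N : ℕ} {a : ℕ → Color} {v : ℕ → ℤ}

lemma IsZigzagRecord.before_turn (ha : IsZigzagRecord L a) {i : ℕ} (hi : i ≤ L) :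
    a (turnTime i - 1) = black := by
  cases i with
  | zero => exact ha.start 1 (by omega)
  | succ i =>
    rw [turnTime_succ, show turnTime i + (4 * i + 7) - 1 = turnTime i + (4 * i + 6) by omega,
      ha.leg i (by omega) _ (by omega)]
    unfold periodicColor
    rw [if_pos (by omega)]

lemma IsZigzagRecord.start_step (ha : IsZigzagRecord L a) (hN : turnTime L ≤ N)
    (h : Reads N a v) : v 1 = v 0 :=
  h.step_succ_eq (by have := two_le_turnTime L; omega) (by
    rw [ha.start 0 (by omega), ha.start 2 le_rfl]; decide)

lemma IsZigzagRecord.leg_step (ha : IsZigzagRecord L a) (hN : turnTime L ≤ N)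
    (h : Reads N a v) {i : ℕ} (hi : i < L) :
    ∀ k < 4 * i + 7, v (turnTime i + k) = v (turnTime i) := by
  have h1 := turnTime_strictMono.monotone (show i + 1 ≤ L by omega)
  rw [turnTime_succ] at h1
  refine h.straight (by omega) fun k hk => ?_
  rw [add_assoc, ha.leg i hi _ (by omega), ha.leg i hi _ (by omega)]
  exact periodicColor_ne rfl

/-- A path that misses the first turn goes straight as long as the record is the zigzag record. -/
lemma IsZigzagRecord.straight (ha : IsZigzagRecord L a) (hN : turnTime L ≤ N)
    (h : Reads N a v) (hv : v 2 = v 1) : ∀ i ≤ L, ∀ t < turnTime i, v t = v 0 := by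
  have h10 := ha.start_step hN h
  intro i
  induction i with
  | zero =>
    intro _ t ht
    rw [turnTime_zero] at ht
    interval_cases t
    · rfl
    · exact h10
  | succ i ih =>
    intro hi t ht
    have ih := ih (by omega)
    rcases lt_or_ge t (turnTime i) with h1 | h1
    · exact ih t h1
    obtain ⟨k, rfl⟩ := Nat.exists_eq_add_of_le h1
    rw [turnTime_succ] at ht
    have hleg := ha.leg_step hN h (i := i) (by omega)
    rw [hleg k (by omega)]
    cases i with
    | zero => exact hv.trans h10
    | succ i =>
      -- A turn only now would lead the path back straight across the previous turning site between
      -- different letters, although it went straight through that site earlier between equal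
      -- letters.
      by_contra hne
      have hmono := turnTime_strictMono.monotone hi
      rw [turnTime_succ] at hmono
      have hR := turnTime_succ i
      have h2 := two_le_turnTime i
      have s0 := h.1 0 (by omega)
      have s1 := h.1 (turnTime (i + 1)) (by omega)
      have hw : walk v (turnTime i - 1 + 1) = walk v (turnTime (i + 1) + (4 * i + 6) + 1) := by
        rw [show turnTime i - 1 + 1 = turnTime i by omega, add_assoc,
          walk_straight hleg _ (by omega), hR, walk_straight (d := v 0) (t := turnTime i)
          (L := 4 * i + 7) (fun k hk => ih _ (by omega)) _ le_rfl, ← hR,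
          show v (turnTime (i + 1)) = -v 0 by omega]
        push_cast
        ring
      refine h.not_straight (t := turnTime i - 1) (u := turnTime (i + 1) + (4 * i + 6)) (by omega)
        (by omega) ?_ ?_ hw ?_
      · rw [ha.before_turn (by omega), show turnTime i - 1 + 2 = turnTime i + 1 by omega,
          ha.leg i (by omega) 1 (by omega)]
        rfl
      · rw [add_assoc, ha.leg (i + 1) (by omega) _ (by omega),
          ha.leg (i + 1) (by omega) _ (by omega)]
        exact periodicColor_ne rfl
      · exact (ih _ (by omega)).trans (ih _ (by omega)).symm

/-- Sign of the steps at time `t` for a walk that turns at the turning times `0, …, j`. -/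
def zigzagSign (j t : ℕ) : ℤ := (-1) ^ #{m ∈ range (j + 1) | t < turnTime m}

/-- The path with turns at the turning times `0, …, j` and the same steps as `v` thereafter. -/
def fold (j : ℕ) (v : ℕ → ℤ) (t : ℕ) : ℤ := v t * zigzagSign j t

lemma zigzagSign_mul_self (j t : ℕ) : zigzagSign j t * zigzagSign j t = 1 := by
  rw [zigzagSign, ← pow_add, ← two_mul, pow_mul]
  simp

lemma zigzagSign_of_ge {j t : ℕ} (h : turnTime j ≤ t) : zigzagSign j t = 1 := by
  rw [zigzagSign, filter_false_of_mem, card_empty, pow_zero]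
  intro m hm
  have := turnTime_strictMono.monotone (show m ≤ j by have := mem_range.mp hm; omega)
  omega

lemma zigzagSign_leg {i j t : ℕ} (h1 : turnTime i ≤ t) (h2 : t < turnTime (i + 1)) :
    zigzagSign j t = (-1) ^ (j - i) := by
  have : {m ∈ range (j + 1) | t < turnTime m} = Ioc i j := by
    ext m
    simp only [mem_filter, mem_range, mem_Ioc]
    constructor
    · rintro ⟨h3, h4⟩
      exact ⟨turnTime_strictMono.lt_iff_lt.mp (h1.trans_lt h4), by omega⟩
    · rintro ⟨h3, h4⟩
      exact ⟨by omega, h2.trans_le (turnTime_strictMono.monotone h3)⟩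
  rw [zigzagSign, this, Nat.card_Ioc]

lemma zigzagSign_start {j t : ℕ} (h : t < 2) : zigzagSign j t = (-1) ^ (j + 1) := by
  rw [zigzagSign, filter_true_of_mem, card_range]
  intro m _
  have := two_le_turnTime m
  omega

lemma fold_fold (j : ℕ) (v : ℕ → ℤ) : fold j (fold j v) = v := by
  funext t
  rw [fold, fold, mul_assoc, zigzagSign_mul_self, mul_one]

lemma zigzagSign_eq (j t : ℕ) : zigzagSign j t = 1 ∨ zigzagSign j t = -1 :=
  neg_one_pow_eq_or ℤ _

/-- The sites visited by a zigzag walk before a turn are on the next leg, with matching letters. -/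
lemma IsZigzagRecord.fold_walk (ha : IsZigzagRecord L a) {w : ℕ → ℤ} {δ : ℕ → ℤ} {j : ℕ}
    (hj : j ≤ L) (h0 : w 0 = -δ 0) (h1 : w 1 = -δ 0) (hδ : ∀ i < j, δ (i + 1) = -δ i)
    (hw : ∀ i < j, ∀ k < 4 * i + 7, w (turnTime i + k) = δ i) :
    ∀ t ≤ turnTime j, ∃ k ≤ 4 * j + 3,
      walk w t = walk w (turnTime j) + δ j * k ∧ a t = periodicColor k := by
  induction j with
  | zero =>
    intro t ht
    rw [turnTime_zero] at *
    refine ⟨2 - t, by omega, ?_, ?_⟩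
    · have := walk_straight (v := w) (t := 0) (L := 2) (d := -δ 0) fun i hi => by
        interval_cases i
        · exact h0
        · exact h1
      simp only [zero_add, walk_zero] at this
      rw [this t ht, this 2 le_rfl, Nat.cast_sub ht]
      push_cast
      ring
    · rw [ha.start t ht]
      exact periodicColor_congr (Or.inl (by omega))
  | succ j ih =>
    intro t ht
    have ih := ih (by omega) (fun i hi => hδ i (by omega)) fun i hi => hw i (by omega)
    have hex : ∃ k ≤ 4 * j + 7, walk w t = walk w (turnTime j) + δ j * k ∧ a t = periodicColor k := by
      rcases le_total t (turnTime j) with h | h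
      · obtain ⟨k, hk, hk'⟩ := ih t h
        exact ⟨k, by omega, hk'⟩
      · obtain ⟨k, rfl⟩ := Nat.exists_eq_add_of_le h
        rw [turnTime_succ] at ht
        exact ⟨k, by omega, walk_straight (hw j (by omega)) k (by omega),
          ha.leg j (by omega) k (by omega)⟩
    obtain ⟨k, hk, hk1, hk2⟩ := hex
    -- The next turn is at distance `4 * j + 7` along the leg, so distances are reflected; the
    -- colors match because `4 * j + 7` is `3` modulo `4`.
    refine ⟨4 * j + 7 - k, by omega, ?_, ?_⟩
    · rw [hk1, turnTime_succ, walk_straight (hw j (by omega)) _ le_rfl, hδ j (by omega),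
        Nat.cast_sub hk]
      push_cast
      ring
    · rw [hk2]
      exact periodicColor_congr (Or.inl (by omega))

lemma walk_fold_of_ge {j t : ℕ} (h : turnTime j ≤ t) : walk (fold j v) t
    = walk (fold j v) (turnTime j) - walk v (turnTime j) + walk v t := by
  obtain ⟨k, rfl⟩ := Nat.exists_eq_add_of_le h
  induction k with
  | zero => rw [add_zero]; ring
  | succ k ih =>
    rw [← add_assoc, walk_succ, walk_succ, ih (by omega), fold, zigzagSign_of_ge (by omega)]
    ring

/-- From the turning time `j` on, the folded path is a translate of `v`. All its earlier sites lie
on the leg that follows and show the letters prescribed there, so they add no constraint, whereas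
the earlier sites of `v` can only lower its `fit`. -/
lemma IsZigzagRecord.fit_le_fit_fold (ha : IsZigzagRecord L a) (hN : turnTime L ≤ N)
    (h : Reads N a v) (hv : v 2 = v 1) {j : ℕ} (hj : j < L) :
    fit (walk v) a (range (N + 1)) ≤ fit (walk (fold j v)) a (range (N + 1)) := by
  have hs := ha.straight hN h hv L le_rfl
  have hjL := turnTime_strictMono.monotone (show j + 1 ≤ L by omega)
  rw [turnTime_succ] at hjL
  have h2 := two_le_turnTime j
  have hsub : Icc (turnTime j) N ⊆ range (N + 1) := fun t ht => by
    rw [mem_Icc] at ht; rw [mem_range]; omega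
  have hwalk := ha.fold_walk (w := fold j v) (δ := fun i => v 0 * (-1) ^ (j - i)) hj.le
    (by rw [fold, zigzagSign_start (by omega), pow_succ]; simp)
    (by rw [fold, zigzagSign_start (by omega), pow_succ, hs 1 (by omega)]; simp)
    (fun i hi => by
      rw [show j - i = j - (i + 1) + 1 by omega, pow_succ]; ring)
    (fun i hi k hk => by
      have := turnTime_strictMono.monotone (show i + 1 ≤ j by omega)
      rw [turnTime_succ] at this
      rw [fold, zigzagSign_leg (i := i) (by omega) (by rw [turnTime_succ]; omega), hs _ (by omega)])
  have hleg : ∀ k ≤ 4 * j + 7, walk (fold j v) (turnTime j + k)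
      = walk (fold j v) (turnTime j) + v 0 * k :=
    walk_straight fun k hk => by
      rw [fold, zigzagSign_of_ge (by omega), hs _ (by omega), mul_one]
  calc fit (walk v) a (range (N + 1)) ≤ fit (walk v) a (Icc (turnTime j) N) := fit_anti _ _ hsub
    _ = fit (walk (fold j v)) a (Icc (turnTime j) N) := by
        rw [← fit_comp (add_right_injective
          (walk (fold j v) (turnTime j) - walk v (turnTime j))) (walk v)]
        exact fit_congr (fun t ht => (walk_fold_of_ge (mem_Icc.mp ht).1).symm) fun _ _ => rfl
    _ = fit (walk (fold j v)) a (range (N + 1)) := by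
        rw [fit, fit]
        congr 1
        ext c
        simp only [Set.mem_ofPred_eq, mem_Icc, mem_range]
        constructor
        · intro hc t ht
          rcases le_total (turnTime j) t with h1 | h1
          · exact hc t ⟨h1, by omega⟩
          · obtain ⟨k, hk, e1, e2⟩ := hwalk t h1
            simp only [Nat.sub_self, pow_zero, mul_one] at e1
            rw [e1, ← hleg k (by omega), e2, ← ha.leg j hj k (by omega)]
            exact hc _ ⟨by omega, by omega⟩
        · exact fun hc t ht => hc t (by omega)

lemma weight_eq_half_pow {θ : Params} (hp : θ.p = 1 / 2) (hε : θ.ε = 0) {v : ℕ → ℤ}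
    (h : ∀ i < N, v i = 1 ∨ v i = -1) : weight θ N v = (1 / 2) ^ N := by
  rw [weight, prod_eq_pow_card (b := 1 / 2), card_range]
  intro i hi
  rcases h i (mem_range.mp hi) with h | h <;> rw [h, stepProb_eq, hp, hε] <;> norm_num

/-- The path folded at the larger index turns at that turning time, and the other one goes straight
there. -/
lemma fold_ne (hs : ∀ t < turnTime L, v t = v 0) {v' : ℕ → ℤ} (hs' : ∀ t < turnTime L, v' t = v' 0)
    (h0 : v 0 ≠ 0) {j j' : ℕ} (hjj : j < j') (hj : j' < L) : fold j v ≠ fold j' v' := by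
  intro he
  have h1 := turnTime_strictMono hjj
  have h2 := turnTime_strictMono hj
  have h3 := two_le_turnTime j
  have e1 := congrFun he (turnTime j')
  have e2 := congrFun he (turnTime j' - 1)
  obtain ⟨i, rfl⟩ : ∃ i, j' = i + 1 := ⟨j' - 1, by omega⟩
  have h4 := turnTime_succ i
  rw [fold, fold, zigzagSign_of_ge (by omega), zigzagSign_of_ge le_rfl, hs _ h2, hs' _ h2] at e1
  rw [fold, fold, zigzagSign_of_ge (by omega), zigzagSign_leg (i := i) (by omega)
    (by omega), hs _ (by omega), hs' _ (by omega), show i + 1 - i = 1 by omega] at e2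
  omega

open scoped Classical in
/-- Paths that miss the first turn of the zigzag record carry a small part of its probability. -/
lemma IsZigzagRecord.mul_sum_straight_le {θ : Params} (hp : θ.p = 1 / 2) (hε : θ.ε = 0)
    (ha : IsZigzagRecord L a) (hN : turnTime L ≤ N) :
    L * ∑ v ∈ paths N with (Reads N a v ∧ v 2 = v 1),
        weight θ N v * fit (walk v) a (range (N + 1))
      ≤ ∑ v ∈ paths N, weight θ N v * fit (walk v) a (range (N + 1)) := by
  set S := {v ∈ paths N | Reads N a v ∧ v 2 = v 1}
  have hS : ∀ v ∈ S, v ∈ paths N ∧ Reads N a v ∧ v 2 = v 1 := fun v hv => mem_filter.mp hv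
  have hsteps : ∀ v ∈ S, ∀ j, ∀ i < N, fold j v i = 1 ∨ fold j v i = -1 := by
    intro v hv j i hi
    rw [fold]
    rcases (hS v hv).2.1.1 i hi with h1 | h1 <;> rcases zigzagSign_eq j i with h2 | h2 <;>
      simp [h1, h2]
  have hinj : Set.InjOn (fun x : ℕ × (ℕ → ℤ) => fold x.1 x.2) ↑(range L ×ˢ S) := by
    rintro ⟨j, v⟩ hx ⟨j', v'⟩ hx' he
    simp only [coe_product, Set.mem_prod, mem_coe, mem_range] at hx hx' he
    obtain ⟨-, hr, hv⟩ := hS v hx.2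
    obtain ⟨-, hr', hv'⟩ := hS v' hx'.2
    have hs := ha.straight hN hr hv L le_rfl
    have hs' := ha.straight hN hr' hv' L le_rfl
    have hL := two_le_turnTime L
    have n1 : v 0 ≠ 0 := by have := hr.1 0 (by omega); omega
    have n2 : v' 0 ≠ 0 := by have := hr'.1 0 (by omega); omega
    rcases lt_trichotomy j j' with h | rfl | h
    · exact absurd he (fold_ne hs hs' n1 h hx'.1)
    · rw [← fold_fold j v, he, fold_fold]
    · exact absurd he.symm (fold_ne hs' hs n2 h hx.1)
  calc L * ∑ v ∈ S, weight θ N v * fit (walk v) a (range (N + 1))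
      = ∑ j ∈ range L, ∑ v ∈ S, weight θ N v * fit (walk v) a (range (N + 1)) := by
        rw [sum_const, card_range, nsmul_eq_mul]
    _ ≤ ∑ j ∈ range L, ∑ v ∈ S,
        weight θ N (fold j v) * fit (walk (fold j v)) a (range (N + 1)) := by
        refine sum_le_sum fun j hj => sum_le_sum fun v hv => ?_
        obtain ⟨-, hr, hv2⟩ := hS v hv
        -- At `p = 1/2` all paths with steps `±1` have the same weight, so folding affects only
        -- `fit`.
        rw [weight_eq_half_pow hp hε hr.1, weight_eq_half_pow hp hε (hsteps v hv j)]
        exact mul_le_mul_of_nonneg_left (ha.fit_le_fit_fold hN hr hv2 (mem_range.mp hj))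
          (by positivity)
    _ = ∑ w ∈ (range L ×ˢ S).image fun x => fold x.1 x.2,
        weight θ N w * fit (walk w) a (range (N + 1)) := by
        rw [sum_image hinj, sum_product]
    _ ≤ _ := by
        refine sum_le_sum_of_subset_of_nonneg ?_ fun v _ _ =>
          mul_nonneg (weight_nonneg ..) (fit_nonneg ..)
        intro w hw
        obtain ⟨⟨j, v⟩, hx, rfl⟩ := mem_image.mp hw
        have hv := (mem_product.mp hx).2
        refine mem_paths.mpr ⟨fun i hi => ?_, fun i hi => ?_⟩
        · rw [mem_stepSet]
          rcases hsteps v hv j i hi with h | h <;> simp [h]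
        · simp only [fold]
          rw [(mem_paths.mp (hS v hv).1).2 i hi, zero_mul]

/-- Such a path visits the two neighbors of its starting point at the indices `1` and `5`, where the
letters are black and white; exactly one candidate for the site of time 0 is black. -/
lemma IsZigzagRecord.blackFit_of_turn (ha : IsZigzagRecord L a) (hL : 1 ≤ L)
    (hN : turnTime L ≤ N) (h : Reads N a v) (hv : v 2 ≠ v 1) :
    blackFit N v a (-1) + blackFit N v a 1 = fit (walk v) a (range (N + 1)) := by
  have h9 : turnTime 1 ≤ turnTime L := turnTime_strictMono.monotone hL
  have h9' : turnTime 1 = 9 := rfl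
  have h10 := ha.start_step hN h
  have hleg := ha.leg_step hN h (i := 0) (by omega)
  rw [turnTime_zero] at hleg
  have s1 := h.1 1 (by omega)
  have s2 := h.1 2 (by omega)
  have w1 : walk v 1 = v 1 := by
    have := walk_succ v 0
    simpa [h10] using this
  have w5 : walk v 5 = -v 1 := by
    have e1 := walk_straight hleg 3 (by omega)
    rw [walk_succ v 1, w1] at e1
    change walk v 5 = _ at e1
    rw [e1, show v 2 = -v 1 by omega]
    push_cast
    ring
  have a1 : a 1 = black := ha.start 1 (by omega)
  have a5 : a 5 = white := ha.leg 0 (by omega) 3 (by omega)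
  have hb : blackFit N v a (v 1) = fit (walk v) a (range (N + 1)) :=
    blackFit_eq_of_visited (i := 1) (by omega) w1 a1
  have hw : blackFit N v a (-v 1) = 0 := by
    have : {c : ℤ → Color | c (-v 1) = black ∧ ∀ j ∈ range (N + 1), c (walk v j) = a j} = ∅ := by
      ext c
      simp only [Set.mem_ofPred_eq, Set.mem_empty_iff_false, iff_false, not_and]
      intro h1 h2
      have := h2 5 (mem_range.mpr (by omega))
      rw [w5, h1, a5] at this
      exact Bool.noConfusion this
    rw [blackFit, this, measureReal_empty]
  rcases s1 with h1 | h1 <;> rw [h1] at hb hw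
  · rw [hw, hb, zero_add]
  · rw [neg_neg] at hw
    rw [hw, hb, add_zero]

end Record

/-- Paths that make the first turn contribute exactly `1/2`. The others deviate by at most `1/2`,
and their share is at most `1 / L` by `mul_sum_straight_le`. -/
lemma abs_condBlack_sub_half_le (θ : Params) (hp : θ.p = 1 / 2) (hε : θ.ε = 0) {L : ℕ} (hL : 1 ≤ L)
    {ζ : Config} {m n : ℕ+} (hm : (m : ℕ) = turnTime L + 2) (hmn : m < n)
    (h : ∀ k < m, ζ k = zigzag k) : |condBlack θ ζ n - 1 / 2| ≤ 1 / (2 * L) := by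
  classical
  have ha := isZigzagRecord_of_agree hm h
  have hmn' : (m : ℕ) < n := hmn
  obtain ⟨N, hN⟩ := Nat.exists_eq_add_of_le' (show 2 ≤ (n : ℕ) by omega)
  have hpos := tail_pos θ hε (letters ζ) N
  rw [condBlack_eq_tail θ hε ζ hN]
  set a := fun j => letters ζ (1 + j)
  have hmain := ha.mul_sum_straight_le hp hε (N := N) (by omega)
  set T := ∑ v ∈ paths N, weight θ N v * fit (walk v) a (range (N + 1))
  rw [div_sub' hpos.ne', abs_div, abs_of_pos hpos, div_le_div_iff₀ hpos (by positivity), mul_comm T,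
    mul_sum, ← sum_sub_distrib]
  have hle : |∑ v ∈ paths N, (weight θ N v * (θ.p * blackFit N v a (-1)
      + (1 - θ.p) * blackFit N v a 1) - 1 / 2 * (weight θ N v * fit (walk v) a (range (N + 1))))|
      ≤ 1 / 2 * ∑ v ∈ paths N with (Reads N a v ∧ v 2 = v 1),
        weight θ N v * fit (walk v) a (range (N + 1)) := by
    refine (abs_sum_le_sum_abs _ _).trans ?_
    rw [sum_filter, mul_sum]
    refine sum_le_sum fun v hv => ?_
    have hw := weight_nonneg θ N v
    have hf := fit_nonneg (walk v) a (range (N + 1))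
    have b1 := blackFit_le N v a (-1)
    have b2 := blackFit_le N v a 1
    have b3 := blackFit_nonneg N v a (-1)
    have b4 := blackFit_nonneg N v a 1
    have e : weight θ N v * (θ.p * blackFit N v a (-1) + (1 - θ.p) * blackFit N v a 1)
        - 1 / 2 * (weight θ N v * fit (walk v) a (range (N + 1)))
        = weight θ N v * (1 / 2 * (blackFit N v a (-1) + blackFit N v a 1
          - fit (walk v) a (range (N + 1)))) := by
      rw [hp]; ring
    rw [e, abs_mul, abs_of_nonneg hw]
    split_ifs with hread
    · rw [mul_left_comm]
      refine mul_le_mul_of_nonneg_left ?_ hw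
      rw [abs_le]
      constructor <;> linarith
    · rw [mul_zero]
      by_cases h0 : weight θ N v * fit (walk v) a (range (N + 1)) = 0
      · rcases mul_eq_zero.mp h0 with h1 | h1
        · rw [h1, zero_mul]
        · rw [show blackFit N v a (-1) = 0 by linarith, show blackFit N v a 1 = 0 by linarith, h1]
          simp
      · have hr := reads_of_ne_zero hε hv h0
        rw [ha.blackFit_of_turn hL (by omega) hr fun hv2 => hread ⟨hr, hv2⟩, sub_self]
        simp
  have hL' : (0 : ℝ) ≤ L := Nat.cast_nonneg L
  calc _ ≤ (1 / 2 * ∑ v ∈ paths N with (Reads N a v ∧ v 2 = v 1),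
        weight θ N v * fit (walk v) a (range (N + 1))) * (2 * L) :=
        mul_le_mul_of_nonneg_right hle (by positivity)
    _ = L * ∑ v ∈ paths N with (Reads N a v ∧ v 2 = v 1),
        weight θ N v * fit (walk v) a (range (N + 1)) := by ring
    _ ≤ 1 * T := by rw [one_mul]; exact hmain

lemma zigzag_notMem_badSet (θ : Params) (hp : θ.p = 1 / 2) (hε : θ.ε = 0) :
    zigzag ∉ badSet θ := by
  rintro ⟨δ, hδ, h⟩
  obtain ⟨K, hK⟩ := exists_nat_one_div_lt hδ
  -- Agreement before time `turnTime (K + 1) + 2` covers the letters up to and including the turning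
  -- letter with number `K + 1`, as letters are indexed from time 1.
  obtain ⟨n, ζ, hmn, hζ, hle⟩ := h ⟨turnTime (K + 1) + 2, by omega⟩
  have h1 := abs_condBlack_sub_half_le θ hp hε (L := K + 1) (by omega) rfl hmn hζ
  have h2 := abs_condBlack_sub_half_le θ hp hε (L := K + 1) (by omega) rfl hmn fun _ _ => rfl
  have e : (1 : ℝ) / (2 * (K + 1 : ℕ)) = 1 / (K + 1) / 2 := by push_cast; field_simp
  rw [e, abs_le] at h1 h2
  have : |condBlack θ zigzag n - condBlack θ ζ n| ≤ 1 / (K + 1) := by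
    rw [abs_le]
    constructor <;> linarith
  linarith

end RWRS

theorem theorem1p3 :
    (∃ U : Set (ℝ × ℝ), IsOpen U ∧ ((1 : ℝ), (0 : ℝ)) ∈ U ∧
      Set.Ioc RWRS.pStar 1 ×ˢ {(0 : ℝ)} ⊆ U ∧
      ∀ θ : RWRS.Params, (θ.p, θ.ε) ∈ U →
        RWRS.badSet θ = ∅ ∧
        ∃ V : RWRS.Config → ℝ, RWRS.IsVersion θ V ∧ Continuous V) ∧
    (∀ θ : RWRS.Params, 1 / 2 < θ.p → θ.p < 4 / 5 → θ.ε = 0 → RWRS.badSet θ = Set.univ) ∧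
    (∀ θ : RWRS.Params, θ.p = 1 / 2 → θ.ε = 0 →
      RWRS.badSet θ ≠ ∅ ∧ RWRS.badSet θ ≠ Set.univ ∧
      RWRS.allBlack ∈ RWRS.badSet θ ∧ RWRS.zigzag ∉ RWRS.badSet θ) := by
  refine ⟨RWRS.exists_open_region, fun θ h1 h2 h3 => RWRS.badSet_eq_univ θ h1 h2 h3,
    fun θ hp hε => ?_⟩
  have hB := RWRS.allBlack_mem_badSet θ hp hε
  have hz := RWRS.zigzag_notMem_badSet θ hp hε
  exact ⟨fun h => by rw [h] at hB; exact hB, fun h => hz (by rw [h]; exact Set.mem_univ _), hB, hz⟩
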